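/- Let $n\ge m$ and let $X\in\mathbb{R}^{n\times m}$ have independent entries $X_{ij}\sim \mathrm{N}(M_{ij},1)$, where the mean matrix $M\in\mathbb{R}^{n\times m}$ is unknown and is estimated under the Frobenius loss $\|\hat M-M\|_{\mathrm F}^2=\sum_{i,j}(\hat M_{ij}-M_{ij})^2$. Let $X=U\,\mathrm{diag}(s_1,\dots,s_m)\,V^\top$ be the singular value decomposition, with $U\in\mathbb{R}^{n\times m}$, $V\in\mathbb{R}^{m\times m}$, $U^\top U=V^\top V=I_m$ and $s_1\ge\dots\ge s_m\ge 0$. For $p>0$ put $$\alpha(s,p)=\Big(\sum_{i=1}^m s_i^{2p-2}\Big)^{-1}\Big((n-m+p-1)\sum_{i=1}^m s_i^{p-2}+2\sum_{i<j}\frac{s_i^p-s_j^p}{s_i^2-s_j^2}\Big),$$ and let $\hat M^*_p=U\,\mathrm{diag}(\hat\sigma_1,\dots,\hat\sigma_m)\,V^\top$ with $\hat\sigma_i=s_i-\alpha(s,p)\,s_i^{p-1}$. (These formulas determine $\hat M^*_p$ whenever the singular values of $X$ are positive and distinct, that is, outside a Lebesgue null set, on which $\hat M^*_p$ may be given arbitrary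 values.) If $p\in(0,1]$ and $n-m\ge 5-3p$, then $\hat M^*_p$ is minimax under the Frobenius loss: $\sup_M \mathrm{E}_M\|\hat M^*_p-M\|_{\mathrm F}^2$ equals the infimum, over all (possibly randomized) estimators $\hat M$, of $\sup_M \mathrm{E}_M\|\hat M-M\|_{\mathrm F}^2$. -/

import Mathlib

open MeasureTheory ProbabilityTheory
open scoped ENNReal Matrix

namespace MatrixMean

/-- The law of a real `n × m` matrix `X` with independent entries `X i j ∼ N(M i j, 1)`. -/
noncomputable def gaussianLaw {n m : ℕ} (M : Fin n → Fin m → ℝ) :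
    Measure (Fin n → Fin m → ℝ) :=
  Measure.pi fun i => Measure.pi fun j => gaussianReal (M i j) 1

instance {n m : ℕ} (M : Fin n → Fin m → ℝ) : IsProbabilityMeasure (gaussianLaw M) := by
  unfold gaussianLaw; infer_instance

/-- The law with mean `M` is the law with mean `0` translated by `M`. -/
theorem gaussianLaw_eq_map {n m : ℕ} (M : Fin n → Fin m → ℝ) :
    gaussianLaw M = (gaussianLaw (0 : Fin n → Fin m → ℝ)).map (fun Z => M + Z) := by
  unfold gaussianLaw
  have h1 : ∀ i, (Measure.pi fun j => gaussianReal (M i j) 1) =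
      (Measure.pi fun j : Fin m => gaussianReal ((0 : Fin n → Fin m → ℝ) i j) 1).map
        (fun z => M i + z) := by
    intro i
    have h2 : ∀ j, gaussianReal (M i j) 1 =
        (gaussianReal ((0 : Fin n → Fin m → ℝ) i j) 1).map (fun x => M i j + x) := by
      intro j
      rw [gaussianReal_map_const_add]
      simp
    have hp : ∀ j, IsProbabilityMeasure
        ((gaussianReal ((0 : Fin n → Fin m → ℝ) i j) 1).map (fun x => M i j + x)) :=
      fun j => by rw [← h2 j]; infer_instance
    simp_rw [h2]
    exact (Measure.pi_map_pi (fun j => by fun_prop)).symm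
  have hp : ∀ i, IsProbabilityMeasure
      ((Measure.pi fun j : Fin m => gaussianReal ((0 : Fin n → Fin m → ℝ) i j) 1).map
        (fun z => M i + z)) :=
    fun i => by rw [← h1 i]; infer_instance
  simp_rw [h1]
  exact (Measure.pi_map_pi (fun i => by fun_prop)).symm

/-- The normal mean matrix model, as a Markov kernel from means to observations. -/
noncomputable def gaussianModel (n m : ℕ) :
    Kernel (Fin n → Fin m → ℝ) (Fin n → Fin m → ℝ) where
  toFun := gaussianLaw
  measurable' := by
    have h : (gaussianLaw : (Fin n → Fin m → ℝ) → _) =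
        fun M => (gaussianLaw (0 : Fin n → Fin m → ℝ)).map (fun Z => M + Z) :=
      funext gaussianLaw_eq_map
    rw [h]
    refine Measure.measurable_of_measurable_coe _ fun s hs => ?_
    have h2 : ∀ M : Fin n → Fin m → ℝ,
        (gaussianLaw (0 : Fin n → Fin m → ℝ)).map (fun Z => M + Z) s =
        gaussianLaw (0 : Fin n → Fin m → ℝ)
          (Prod.mk M ⁻¹' ((fun q : (Fin n → Fin m → ℝ) × (Fin n → Fin m → ℝ) => q.1 + q.2) ⁻¹' s)) :=
      fun M => Measure.map_apply (by fun_prop) hs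
    simp_rw [h2]
    exact measurable_measure_prodMk_left ((by fun_prop :
      Measurable fun q : (Fin n → Fin m → ℝ) × (Fin n → Fin m → ℝ) => q.1 + q.2) hs)

/-- The Frobenius loss `∑ i j, (Mhat i j - M i j) ^ 2`. -/
noncomputable def frobeniusLoss {n m : ℕ} (M Mhat : Fin n → Fin m → ℝ) : ℝ≥0∞ :=
  ENNReal.ofReal (∑ i, ∑ j, (Mhat i j - M i j) ^ 2)

/-- The Frobenius risk `E_M ‖δ(X) - M‖²` of `δ` at the mean matrix `M`. -/
noncomputable def frobeniusRisk {n m : ℕ} (δ : (Fin n → Fin m → ℝ) → (Fin n → Fin m → ℝ))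
    (M : Fin n → Fin m → ℝ) : ℝ≥0∞ :=
  ∫⁻ X, frobeniusLoss M (δ X) ∂(gaussianModel n m M)

/-- `δ` is a minimax estimator of `M` under the Frobenius loss: it is measurable (up to null sets
of the model), and its largest risk is the least possible, that is, the infimum over all
(also randomized) estimators of the largest risk. -/
def IsMinimax {n m : ℕ} (δ : (Fin n → Fin m → ℝ) → (Fin n → Fin m → ℝ)) : Prop :=
  (∀ M, AEMeasurable δ (gaussianModel n m M)) ∧
    ⨆ M, frobeniusRisk δ M = minimaxRisk frobeniusLoss (gaussianModel n m)

/-- `X = U diag(s) Vᵀ` is a singular value decomposition: `UᵀU = VᵀV = I` and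
`s₁ ≥ ⋯ ≥ s_m ≥ 0`. -/
structure IsSVD {n m : ℕ} (X : Matrix (Fin n) (Fin m) ℝ) (U : Matrix (Fin n) (Fin m) ℝ)
    (s : Fin m → ℝ) (V : Matrix (Fin m) (Fin m) ℝ) : Prop where
  left_orth : Uᵀ * U = 1
  right_orth : Vᵀ * V = 1
  antitone : Antitone s
  nonneg : ∀ i, 0 ≤ s i
  eq : X = U * Matrix.diagonal s * Vᵀ

/-- The sum `∑_{i<j} (s_i^p - s_j^p) / (s_i² - s_j²)`. -/
noncomputable def pairSum {m : ℕ} (p : ℝ) (s : Fin m → ℝ) : ℝ :=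
  ∑ i, ∑ j ∈ Finset.Ioi i, (s i ^ p - s j ^ p) / (s i ^ 2 - s j ^ 2)

/-- The data-dependent shrinkage factor
`α(s,p) = (∑ s_i^(2p-2))⁻¹ ((n-m+p-1) ∑ s_i^(p-2) + 2 ∑_{i<j} (s_i^p - s_j^p)/(s_i² - s_j²))`. -/
noncomputable def alphaOpt (n : ℕ) {m : ℕ} (p : ℝ) (s : Fin m → ℝ) : ℝ :=
  (∑ i, s i ^ (2 * p - 2))⁻¹ *
    (((n : ℝ) - m + p - 1) * ∑ i, s i ^ (p - 2) + 2 * pairSum p s)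

/-- The unbiased estimate of the Frobenius risk of the estimator that replaces `s_i` by
`s_i - a s_i^(p-1)` for a constant `a`. -/
noncomputable def unbiasedRisk (n : ℕ) {m : ℕ} (p : ℝ) (s : Fin m → ℝ) (a : ℝ) : ℝ :=
  n * m + a * (a * ∑ i, s i ^ (2 * p - 2)
    - 2 * ((n : ℝ) - m + p - 1) * ∑ i, s i ^ (p - 2) - 4 * pairSum p s)

/-- `alphaOpt` is the minimizer of the unbiased risk estimate. -/
theorem unbiasedRisk_alphaOpt_le (n : ℕ) {m : ℕ} (p : ℝ) (s : Fin m → ℝ) (hs : ∀ i, 0 < s i)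
    (a : ℝ) : unbiasedRisk n p s (alphaOpt n p s) ≤ unbiasedRisk n p s a := by
  rcases Nat.eq_zero_or_pos m with rfl | hm
  · simp [unbiasedRisk, pairSum]
  have hC : 0 < ∑ i, s i ^ (2 * p - 2) :=
    Finset.sum_pos (fun i _ => Real.rpow_pos_of_pos (hs i) _) ⟨⟨0, hm⟩, Finset.mem_univ _⟩
  unfold unbiasedRisk alphaOpt
  generalize (∑ i, s i ^ (2 * p - 2)) = C at hC ⊢
  generalize (∑ i, s i ^ (p - 2)) = B
  generalize pairSum p s = D
  have key : ∀ N : ℝ, (C⁻¹ * N) * (C * (C⁻¹ * N) - 2 * N) ≤ a * (C * a - 2 * N) := by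
    intro N
    have h1 : C * (C⁻¹ * N) = N := by field_simp
    have h2 : 0 ≤ C * (a - C⁻¹ * N) ^ 2 := by positivity
    nlinarith [h1, h2, congrArg (fun x => x * (C⁻¹ * N)) h1, congrArg (fun x => x * a) h1]
  have := key (((n : ℝ) - m + p - 1) * B + 2 * D)
  linarith

/-- `δ` is the estimator that replaces each singular value `s_i` of the observation by
`s_i - α(s,p) s_i^(p-1)`. The formula is imposed wherever it makes sense, that is, when the
singular values are positive and distinct, which excludes only a null set of observations; the
values of `δ` on this null set are arbitrary. -/
def IsSureEstimator {n m : ℕ} (p : ℝ) (δ : (Fin n → Fin m → ℝ) → (Fin n → Fin m → ℝ)) : Prop :=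
  ∀ (X : Fin n → Fin m → ℝ) (U : Matrix (Fin n) (Fin m) ℝ) (s : Fin m → ℝ)
    (V : Matrix (Fin m) (Fin m) ℝ),
    IsSVD (Matrix.of X) U s V → (∀ i, 0 < s i) → Function.Injective s →
      Matrix.of (δ X) =
        U * Matrix.diagonal (fun i => s i - alphaOpt n p s * s i ^ (p - 1)) * Vᵀ

end MatrixMean

/-!
The estimator is minimax because its risk never exceeds `n m`, the risk of `X` itself, and `n m` is
the minimax risk.

**Upper bound.** With `A = XᵀX`, the estimator is `X - α X A^(p/2 - 1)`. Stein's identity would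
express its risk as `n m` plus the expectation of `‖g‖² + 2 div g` with `g = -α X A^(p/2 - 1)`, but
`g` is singular where `A` is. Everything is therefore done for the regularization that replaces `A`
by `A + ε`, with `α` computed from the eigenvalues of `A + ε`. This field is smooth with derivatives
of polynomial growth, so Stein's identity (`integral_sub_mul_gaussianLaw`) needs no further care,
and `‖g‖² + 2 div g ≤ 0` remains true at *every* matrix, for every `ε > 0`
(`sum_sq_sureField_add_le_zero`): each term that the regularization adds has the right sign. The
regularized estimators converge almost everywhere, and Fatou's lemma gives the bound for the limit
(`frobeniusRisk_le_of_isSureEstimator`), without any domination.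

No derivative of a singular value or of a singular vector is taken. Up to one constant factor, which
cancels in `α X A^(p/2 - 1)`, the power is `∫ t^(p/2 - 1) (A + ε + t)⁻¹ dt`, and the sum of the
divided differences in `α` is `∫ t^(p/2) ((tr R)² - tr R²) dt / 2` with `R = (A + ε + t)⁻¹`. Both
depend on `X` through resolvents, whose derivatives are explicit; a spectral decomposition is used
only to evaluate the resulting traces at a fixed `X`. Let `f i` be the eigenvalues of the power,
`B` their sum, `K` the second integral (without the factor `1/2`), `k = n - m + p - 1`,
`N = k B + K` the numerator of `α` and `C` its denominator. The divergence of `X A^(p/2 - 1)` is at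
least `N`, the derivative of `C` in the direction of this field is nonpositive, and that of `N` is
at least `-(2 - p) k B² - 2 B K`. So the claim reduces to
`N² ≥ 2 (2 - p) k B² + 4 B K`, which holds since `k ≥ 4 - 2 p ≥ 2`; this is the assumption
`n - m ≥ 5 - 3 p`.

**Lower bound.** Under a Gaussian prior with covariance `tan² θ` times the identity, every estimator
has average risk at least `sin² θ n m` (`sin_sq_mul_le_minimaxRisk`); let `θ → π/2`.
-/

namespace MatrixMean

open Set Filter Topology

variable {n m : ℕ}

/-! ### The Stieltjes integral of a power -/

/-- The Stieltjes integral `∫₀^∞ t^(a-1) / (t + x) dt`, a constant multiple of `x^(a-1)`. -/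
noncomputable def stieltjes (a x : ℝ) : ℝ := ∫ t in Ioi (0 : ℝ), t ^ (a - 1) * (t + x)⁻¹

theorem integrableOn_rpow_mul_inv {a x : ℝ} (ha : 0 < a) (ha1 : a < 1) (hx : 0 < x) :
    IntegrableOn (fun t : ℝ => t ^ (a - 1) * (t + x)⁻¹) (Ioi 0) := by
  have hm : Measurable fun t : ℝ => t ^ (a - 1) * (t + x)⁻¹ := by fun_prop
  rw [← Ioc_union_Ioi_eq_Ioi (zero_le_one (α := ℝ))]
  refine IntegrableOn.union ?_ ?_
  · have h : IntegrableOn (fun t : ℝ => t ^ (a - 1)) (Ioc 0 1) :=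
      (intervalIntegrable_iff_integrableOn_Ioc_of_le zero_le_one).1
        (intervalIntegral.intervalIntegrable_rpow' (by linarith))
    refine Integrable.mono' (h.mul_const x⁻¹) hm.aestronglyMeasurable ?_
    filter_upwards [ae_restrict_mem measurableSet_Ioc] with t ht
    have ht0 : 0 < t := ht.1
    rw [Real.norm_of_nonneg (by positivity)]
    gcongr
    linarith
  · have h : IntegrableOn (fun t : ℝ => t ^ (a - 2)) (Ioi 1) :=
      integrableOn_Ioi_rpow_of_lt (by linarith) one_pos
    refine Integrable.mono' h hm.aestronglyMeasurable ?_
    filter_upwards [ae_restrict_mem measurableSet_Ioi] with t ht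
    have ht0 : 0 < t := lt_trans one_pos ht
    rw [Real.norm_of_nonneg (by positivity)]
    have : t ^ (a - 2) = t ^ (a - 1) * t⁻¹ := by
      rw [← Real.rpow_neg_one t, ← Real.rpow_add ht0]; ring_nf
    rw [this]
    gcongr
    linarith

theorem integrableOn_rpow_mul_inv_mul_inv {a x y : ℝ} (ha : 0 < a) (ha1 : a < 1) (hx : 0 < x)
    (hy : 0 < y) : IntegrableOn (fun t : ℝ => t ^ (a - 1) * ((t + x)⁻¹ * (t + y)⁻¹)) (Ioi 0) := by
  refine Integrable.mono' ((integrableOn_rpow_mul_inv ha ha1 hx).mul_const y⁻¹)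
    (by fun_prop) ?_
  filter_upwards [ae_restrict_mem measurableSet_Ioi] with t ht
  have ht0 : 0 < t := ht
  rw [Real.norm_of_nonneg (by positivity), mul_assoc]
  gcongr
  linarith

theorem integrableOn_rpow_mul_inv_mul_inv' {a x y : ℝ} (ha : 0 < a) (ha1 : a < 1) (hx : 0 < x)
    (hy : 0 < y) : IntegrableOn (fun t : ℝ => t ^ a * ((t + x)⁻¹ * (t + y)⁻¹)) (Ioi 0) := by
  refine Integrable.mono' (integrableOn_rpow_mul_inv ha ha1 hx) (by fun_prop) ?_
  filter_upwards [ae_restrict_mem measurableSet_Ioi] with t ht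
  have ht0 : 0 < t := ht
  rw [Real.norm_of_nonneg (by positivity)]
  have : t ^ a = t ^ (a - 1) * t := by
    rw [← Real.rpow_add_one ht0.ne']; ring_nf
  rw [this]
  have h : t * (t + y)⁻¹ ≤ 1 := by
    rw [mul_inv_le_iff₀ (by linarith)]; linarith
  calc t ^ (a - 1) * t * ((t + x)⁻¹ * (t + y)⁻¹)
      = t ^ (a - 1) * (t + x)⁻¹ * (t * (t + y)⁻¹) := by ring
    _ ≤ t ^ (a - 1) * (t + x)⁻¹ * 1 := by gcongr
    _ = _ := mul_one _

theorem integrableOn_rpow_mul_inv_mul_inv_mul_inv {a x y z : ℝ} (ha : 0 < a) (ha1 : a < 1)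
    (hx : 0 < x) (hy : 0 < y) (hz : 0 < z) :
    IntegrableOn (fun t : ℝ => t ^ a * ((t + x)⁻¹ * (t + y)⁻¹ * (t + z)⁻¹)) (Ioi 0) := by
  refine Integrable.mono' ((integrableOn_rpow_mul_inv_mul_inv' ha ha1 hx hy).mul_const z⁻¹)
    (by fun_prop) ?_
  filter_upwards [ae_restrict_mem measurableSet_Ioi] with t ht
  have ht0 : 0 < t := ht
  rw [Real.norm_of_nonneg (by positivity), ← mul_assoc]
  gcongr
  linarith

theorem stieltjes_pos {a x : ℝ} (ha : 0 < a) (ha1 : a < 1) (hx : 0 < x) : 0 < stieltjes a x := by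
  refine (setIntegral_pos_iff_support_of_nonneg_ae ?_ (integrableOn_rpow_mul_inv ha ha1 hx)).2 ?_
  · filter_upwards [ae_restrict_mem measurableSet_Ioi] with t ht
    have ht0 : 0 < t := ht
    simp only [Pi.zero_apply]; positivity
  · have : Function.support (fun t : ℝ => t ^ (a - 1) * (t + x)⁻¹) ∩ Ioi 0 = Ioi 0 := by
      refine inter_eq_right.2 fun t ht => ?_
      have ht0 : 0 < t := ht
      simp only [Function.mem_support]; positivity
    rw [this]; simp

theorem stieltjes_eq {a x : ℝ} (hx : 0 < x) :
    stieltjes a x = stieltjes a 1 * x ^ (a - 1) := by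
  have h := integral_comp_mul_left_Ioi (fun t : ℝ => t ^ (a - 1) * (t + x)⁻¹) 0 hx
  rw [mul_zero, smul_eq_mul] at h
  have h2 : ∫ t in Ioi (0 : ℝ), (x * t) ^ (a - 1) * (x * t + x)⁻¹ =
      x ^ (a - 1) * x⁻¹ * stieltjes a 1 := by
    rw [stieltjes, ← integral_const_mul]
    refine setIntegral_congr_fun measurableSet_Ioi fun t ht => ?_
    have ht0 : 0 < t := ht
    rw [Real.mul_rpow hx.le ht0.le, show x * t + x = x * (t + 1) by ring, mul_inv]
    ring
  rw [h2] at h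
  have h3 : stieltjes a x = x * (x⁻¹ * stieltjes a x) := by field_simp
  rw [h3, stieltjes, ← h]
  field_simp

/-- Integration by parts: `∫ t^(a-1) x / (t+x)² dt = (1 - a) ∫ t^(a-1) / (t+x) dt`. -/
theorem integral_rpow_mul_inv_sq {a x : ℝ} (ha : 0 < a) (ha1 : a < 1) (hx : 0 < x) :
    ∫ t in Ioi (0 : ℝ), t ^ (a - 1) * (x * (t + x)⁻¹ ^ 2) = (1 - a) * stieltjes a x := by
  have hi1 := integrableOn_rpow_mul_inv ha ha1 hx
  have hi2 : IntegrableOn (fun t : ℝ => t ^ (a - 1) * (x * (t + x)⁻¹ ^ 2)) (Ioi 0) := by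
    refine IntegrableOn.congr_fun
      (Integrable.const_mul (integrableOn_rpow_mul_inv_mul_inv ha ha1 hx hx) x)
      (fun t _ => ?_) measurableSet_Ioi
    ring
  have hderiv : ∀ t ∈ Ioi (0 : ℝ), HasDerivAt (fun t : ℝ => t ^ a * (t + x)⁻¹)
      ((a - 1) * (t ^ (a - 1) * (t + x)⁻¹) + t ^ (a - 1) * (x * (t + x)⁻¹ ^ 2)) t := by
    intro t ht
    have ht0 : 0 < t := ht
    have h1 := (Real.hasDerivAt_rpow_const (p := a) (Or.inl ht0.ne'))
    have h2 := ((hasDerivAt_id t).add_const x).inv (by simp only [id]; linarith)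
    convert! h1.mul h2 using 1
    have : t ^ a = t ^ (a - 1) * t := by
      rw [← Real.rpow_add_one ht0.ne']; ring_nf
    simp only [id, Pi.inv_apply]
    rw [this]
    have : t + x ≠ 0 := by linarith
    field_simp
    ring
  have hinf : Tendsto (fun t : ℝ => t ^ a * (t + x)⁻¹) atTop (𝓝 0) := by
    have hb : Tendsto (fun t : ℝ => t ^ (-(1 - a))) atTop (𝓝 0) :=
      tendsto_rpow_neg_atTop (by linarith)
    refine squeeze_zero' ?_ ?_ hb
    · filter_upwards [eventually_gt_atTop 0] with t ht; positivity
    · filter_upwards [eventually_gt_atTop 0] with t ht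
      have : t ^ (-(1 - a)) = t ^ a * t⁻¹ := by
        rw [← Real.rpow_neg_one t, ← Real.rpow_add ht]; ring_nf
      rw [this]; gcongr; linarith
  have key := integral_Ioi_of_hasDerivAt_of_tendsto (a := (0:ℝ)) (m := 0)
    (f := fun t : ℝ => t ^ a * (t + x)⁻¹)
    (by
      refine ContinuousAt.continuousWithinAt ?_
      exact (Real.continuousAt_rpow_const _ _ (Or.inr ha.le)).mul
        (ContinuousAt.inv₀ (by fun_prop) (by simpa using hx.ne')))
    hderiv ((hi1.const_mul (a - 1)).add hi2) hinf
  rw [integral_add (hi1.const_mul (a - 1)) hi2, integral_const_mul] at key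
  simp only [Real.zero_rpow ha.ne', zero_mul, sub_zero] at key
  rw [stieltjes]; linarith

/-- The divided difference of `x ↦ x * stieltjes a x`. -/
theorem integral_rpow_mul_inv_mul_inv {a x y : ℝ} (ha : 0 < a) (ha1 : a < 1) (hx : 0 < x)
    (hy : 0 < y) (hxy : x ≠ y) :
    ∫ t in Ioi (0 : ℝ), t ^ a * ((t + x)⁻¹ * (t + y)⁻¹) =
      (x * stieltjes a x - y * stieltjes a y) / (x - y) := by
  have hi1 := integrableOn_rpow_mul_inv ha ha1 hx
  have hi2 := integrableOn_rpow_mul_inv ha ha1 hy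
  have hne : x - y ≠ 0 := sub_ne_zero.2 hxy
  rw [eq_div_iff hne, stieltjes, stieltjes, ← integral_const_mul, ← integral_const_mul,
    ← integral_sub (hi1.const_mul x) (hi2.const_mul y), ← integral_mul_const]
  refine setIntegral_congr_fun measurableSet_Ioi fun t ht => ?_
  have ht0 : 0 < t := ht
  have : t ^ a = t ^ (a - 1) * t := by
    rw [← Real.rpow_add_one ht0.ne']; ring_nf
  rw [this]
  have : t + x ≠ 0 := by linarith
  have : t + y ≠ 0 := by linarith
  field_simp
  ring

/-- A lower bound for the Stieltjes integral that decays polynomially. -/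
theorem stieltjes_one_div_le {a x : ℝ} (ha : 0 < a) (ha1 : a < 1) (hx : 0 < x) :
    stieltjes a 1 / (1 + x) ≤ stieltjes a x := by
  rw [stieltjes, stieltjes, div_eq_mul_inv, ← integral_mul_const]
  refine setIntegral_mono_on ((integrableOn_rpow_mul_inv ha ha1 one_pos).mul_const _)
    (integrableOn_rpow_mul_inv ha ha1 hx) measurableSet_Ioi fun t ht => ?_
  have ht0 : 0 < t := ht
  rw [mul_assoc, ← mul_inv]
  gcongr
  nlinarith

/-! ### Resolvents of the Gram matrix -/

/-- The Gram matrix `XᵀX`. -/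
def gram (X : Fin n → Fin m → ℝ) : Matrix (Fin m) (Fin m) ℝ := (Matrix.of X)ᵀ * Matrix.of X

/-- The derivative `HᵀX + XᵀH` of the Gram matrix at `X` in the direction `H`. -/
def gramDeriv (X H : Fin n → Fin m → ℝ) : Matrix (Fin m) (Fin m) ℝ :=
  (Matrix.of H)ᵀ * Matrix.of X + (Matrix.of X)ᵀ * Matrix.of H

/-- The resolvent `(XᵀX + t)⁻¹`. -/
noncomputable def gramResolvent (X : Fin n → Fin m → ℝ) (t : ℝ) : Matrix (Fin m) (Fin m) ℝ :=
  (gram X + t • 1)⁻¹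

/-- The derivative of the resolvent at `X` in the direction `H`. -/
noncomputable def gramResolventDeriv (X H : Fin n → Fin m → ℝ) (t : ℝ) :
    Matrix (Fin m) (Fin m) ℝ :=
  -(gramResolvent X t * gramDeriv X H * gramResolvent X t)

theorem exists_gram_spectral (X : Fin n → Fin m → ℝ) :
    ∃ (V : Matrix (Fin m) (Fin m) ℝ) (l : Fin m → ℝ), Vᵀ * V = 1 ∧ V * Vᵀ = 1 ∧
      (∀ i, 0 ≤ l i) ∧ gram X = V * Matrix.diagonal l * Vᵀ := by
  have hpsd : (gram X).PosSemidef := by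
    have := Matrix.posSemidef_conjTranspose_mul_self (Matrix.of X)
    rwa [Matrix.conjTranspose_eq_transpose_of_trivial] at this
  have hA := hpsd.isHermitian
  have hU := hA.eigenvectorUnitary.2
  rw [Matrix.mem_unitaryGroup_iff'] at hU
  refine ⟨hA.eigenvectorUnitary, hA.eigenvalues, ?_, ?_, hpsd.eigenvalues_nonneg, ?_⟩
  · rwa [Matrix.star_eq_conjTranspose, Matrix.conjTranspose_eq_transpose_of_trivial] at hU
  · refine mul_eq_one_comm.1 ?_
    rwa [Matrix.star_eq_conjTranspose, Matrix.conjTranspose_eq_transpose_of_trivial] at hU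
  · have h := hA.spectral_theorem
    rw [Unitary.conjStarAlgAut_apply] at h
    simpa [Matrix.star_eq_conjTranspose, Matrix.conjTranspose_eq_transpose_of_trivial,
      Function.comp_def] using h

section Spectral

variable {X : Fin n → Fin m → ℝ} {V : Matrix (Fin m) (Fin m) ℝ} {l : Fin m → ℝ}

theorem conj_mul_conj (hV : Vᵀ * V = 1) (c d : Fin m → ℝ) :
    V * Matrix.diagonal c * Vᵀ * (V * Matrix.diagonal d * Vᵀ) =
      V * Matrix.diagonal (fun i => c i * d i) * Vᵀ := by
  calc V * Matrix.diagonal c * Vᵀ * (V * Matrix.diagonal d * Vᵀ)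
      = V * Matrix.diagonal c * (Vᵀ * V) * Matrix.diagonal d * Vᵀ := by
        simp only [Matrix.mul_assoc]
    _ = _ := by
        rw [hV, Matrix.mul_one, Matrix.mul_assoc V, Matrix.diagonal_mul_diagonal]

theorem trace_conj (hV : Vᵀ * V = 1) (c : Fin m → ℝ) :
    (V * Matrix.diagonal c * Vᵀ).trace = ∑ i, c i := by
  rw [Matrix.trace_mul_comm, ← Matrix.mul_assoc, hV, Matrix.one_mul, Matrix.trace_diagonal]

theorem conj_apply {ι κ : Type*} {U : Matrix ι (Fin m) ℝ} {W : Matrix κ (Fin m) ℝ}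
    (c : Fin m → ℝ) (i : ι) (j : κ) :
    (U * Matrix.diagonal c * Wᵀ) i j = ∑ k, c k * (U i k * W j k) := by
  rw [Matrix.mul_apply]
  refine Finset.sum_congr rfl fun k _ => ?_
  rw [Matrix.mul_diagonal, Matrix.transpose_apply]; ring

theorem gram_add_smul_one (hV' : V * Vᵀ = 1) (h : gram X = V * Matrix.diagonal l * Vᵀ) (t : ℝ) :
    gram X + t • 1 = V * Matrix.diagonal (fun i => t + l i) * Vᵀ := by
  have : Matrix.diagonal (fun i => t + l i) =
      Matrix.diagonal l + t • (1 : Matrix (Fin m) (Fin m) ℝ) := by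
    ext i j
    rcases eq_or_ne i j with rfl | hij
    · simp [add_comm]
    · simp [hij]
  rw [this, Matrix.mul_add, Matrix.add_mul, h, Matrix.mul_smul, Matrix.mul_one, Matrix.smul_mul, hV']

theorem gramResolvent_eq (hV : Vᵀ * V = 1) (hV' : V * Vᵀ = 1) (hl : ∀ i, 0 ≤ l i)
    (h : gram X = V * Matrix.diagonal l * Vᵀ) {t : ℝ} (ht : 0 < t) :
    gramResolvent X t = V * Matrix.diagonal (fun i => (t + l i)⁻¹) * Vᵀ := by
  refine Matrix.inv_eq_right_inv ?_
  rw [gram_add_smul_one hV' h, conj_mul_conj hV]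
  have : (fun i => (t + l i) * (t + l i)⁻¹) = fun _ => 1 := by
    funext i; exact mul_inv_cancel₀ (by linarith [hl i])
  rw [this, Matrix.diagonal_one, Matrix.mul_one, hV']

theorem abs_orthogonal_apply_le (hV' : V * Vᵀ = 1) (i k : Fin m) : |V i k| ≤ 1 := by
  have h : ∑ j, V i j * V i j = 1 := by
    have := congrFun (congrFun hV' i) i
    rw [Matrix.mul_apply, Matrix.one_apply_eq] at this
    simpa using this
  have h2 : V i k * V i k ≤ 1 := by
    rw [← h]
    exact Finset.single_le_sum (f := fun j => V i j * V i j)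
      (fun j _ => mul_self_nonneg _) (Finset.mem_univ k)
  exact abs_le_one_iff_mul_self_le_one.2 h2

end Spectral

theorem gram_det_ne_zero (X : Fin n → Fin m → ℝ) {t : ℝ} (ht : 0 < t) :
    IsUnit (gram X + t • 1).det := by
  obtain ⟨V, l, hV, hV', hl, h⟩ := exists_gram_spectral X
  refine (Matrix.isUnit_iff_isUnit_det _).1 ?_
  refine IsUnit.of_mul_eq_one (V * Matrix.diagonal (fun i => (t + l i)⁻¹) * Vᵀ) ?_
  rw [gram_add_smul_one hV' h, conj_mul_conj hV]
  have : (fun i => (t + l i) * (t + l i)⁻¹) = fun _ => 1 := by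
    funext i; exact mul_inv_cancel₀ (by linarith [hl i])
  rw [this, Matrix.diagonal_one, Matrix.mul_one, hV']

theorem abs_gramResolvent_le (X : Fin n → Fin m → ℝ) {t : ℝ} (ht : 0 < t) (i j : Fin m) :
    |gramResolvent X t i j| ≤ m * t⁻¹ := by
  obtain ⟨V, l, hV, hV', hl, h⟩ := exists_gram_spectral X
  rw [gramResolvent_eq hV hV' hl h ht, conj_apply]
  refine (Finset.abs_sum_le_sum_abs _ _).trans ?_
  have : ∀ k ∈ Finset.univ, |(t + l k)⁻¹ * (V i k * V j k)| ≤ t⁻¹ := by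
    intro k _
    have hk : 0 < t + l k := by linarith [hl k]
    rw [abs_mul, abs_mul, abs_of_pos (inv_pos.2 hk)]
    calc (t + l k)⁻¹ * (|V i k| * |V j k|) ≤ t⁻¹ * (1 * 1) := by
          gcongr
          · linarith [hl k]
          · exact abs_orthogonal_apply_le hV' _ _
          · exact abs_orthogonal_apply_le hV' _ _
      _ = t⁻¹ := by ring
  simpa using Finset.sum_le_card_nsmul _ _ _ this

theorem gramResolvent_apply (X : Fin n → Fin m → ℝ) (t : ℝ) (i j : Fin m) :
    gramResolvent X t i j = (gram X + t • 1).det⁻¹ * (gram X + t • 1).adjugate i j := by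
  rw [gramResolvent, Matrix.inv_def, Ring.inverse_eq_inv', Matrix.smul_apply, smul_eq_mul]

theorem continuous_gram : Continuous (gram : (Fin n → Fin m → ℝ) → _) := by
  unfold gram
  have h : Continuous fun X : Fin n → Fin m → ℝ => Matrix.of X := continuous_id
  exact (h.matrix_transpose).matrix_mul h

theorem continuous_gramDeriv (H : Fin n → Fin m → ℝ) :
    Continuous (fun X : Fin n → Fin m → ℝ => gramDeriv X H) := by
  unfold gramDeriv
  have h : Continuous fun X : Fin n → Fin m → ℝ => Matrix.of X := continuous_id
  exact (continuous_const.matrix_mul h).add (h.matrix_transpose.matrix_mul continuous_const)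

theorem measurable_gramResolvent (ε : ℝ) (i j : Fin m) :
    Measurable fun q : (Fin n → Fin m → ℝ) × ℝ => gramResolvent q.1 (q.2 + ε) i j := by
  have h : Continuous fun q : (Fin n → Fin m → ℝ) × ℝ =>
      gram q.1 + (q.2 + ε) • (1 : Matrix (Fin m) (Fin m) ℝ) :=
    (continuous_gram.comp continuous_fst).add
      ((continuous_snd.add continuous_const).smul continuous_const)
  simp_rw [gramResolvent_apply]
  exact (h.matrix_det.measurable.inv).mul ((h.matrix_adjugate.matrix_elem i j).measurable)

theorem measurable_gramResolventDeriv (ε : ℝ) (H : Fin n → Fin m → ℝ) (i j : Fin m) :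
    Measurable fun q : (Fin n → Fin m → ℝ) × ℝ => gramResolventDeriv q.1 H (q.2 + ε) i j := by
  have h : ∀ k l, Measurable fun q : (Fin n → Fin m → ℝ) × ℝ => gramDeriv q.1 H k l := fun k l =>
    (((continuous_gramDeriv H).comp continuous_fst).matrix_elem k l).measurable
  simp only [gramResolventDeriv, Matrix.neg_apply, Matrix.mul_apply]
  have h2 := measurable_gramResolvent (n := n) (m := m) ε
  fun_prop

theorem abs_mul_mul_apply_le {B S D : Matrix (Fin m) (Fin m) ℝ} {b s d : ℝ}
    (hB : ∀ i j, |B i j| ≤ b) (hS : ∀ i j, |S i j| ≤ s) (hD : ∀ i j, |D i j| ≤ d) (i j : Fin m) :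
    |(B * S * D) i j| ≤ m ^ 2 * (b * s * d) := by
  have hb := fun i j => (abs_nonneg (B i j)).trans (hB i j)
  have hs := fun i j => (abs_nonneg (S i j)).trans (hS i j)
  have h1 : ∀ i j, |(B * S) i j| ≤ m * (b * s) := by
    intro i j
    rw [Matrix.mul_apply]
    refine (Finset.abs_sum_le_sum_abs _ _).trans ?_
    have : ∀ k ∈ Finset.univ, |B i k * S k j| ≤ b * s := fun k _ => by
      rw [abs_mul]; exact mul_le_mul (hB _ _) (hS _ _) (abs_nonneg _) (hb i k)
    simpa using Finset.sum_le_card_nsmul _ _ _ this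
  rw [Matrix.mul_apply]
  refine (Finset.abs_sum_le_sum_abs _ _).trans ?_
  have : ∀ k ∈ Finset.univ, |(B * S) i k * D k j| ≤ m * (b * s) * d := fun k _ => by
    rw [abs_mul]
    exact mul_le_mul (h1 _ _) (hD _ _) (abs_nonneg _) ((abs_nonneg _).trans (h1 i k))
  refine (Finset.sum_le_card_nsmul _ _ _ this).trans_eq ?_
  simp; ring

theorem abs_apply_le_norm (X : Fin n → Fin m → ℝ) (i : Fin n) (j : Fin m) : |X i j| ≤ ‖X‖ :=
  (norm_le_pi_norm (X i) j).trans (norm_le_pi_norm X i)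

theorem abs_gramDeriv_le (X H : Fin n → Fin m → ℝ) (i j : Fin m) :
    |gramDeriv X H i j| ≤ 2 * n * (‖X‖ * ‖H‖) := by
  rw [gramDeriv, Matrix.add_apply, Matrix.mul_apply, Matrix.mul_apply, ← Finset.sum_add_distrib]
  refine (Finset.abs_sum_le_sum_abs _ _).trans ?_
  have : ∀ k ∈ Finset.univ, |(Matrix.of H)ᵀ i k * Matrix.of X k j +
      (Matrix.of X)ᵀ i k * Matrix.of H k j| ≤ 2 * (‖X‖ * ‖H‖) := fun k _ => by
    simp only [Matrix.transpose_apply, Matrix.of_apply]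
    refine (abs_add_le _ _).trans ?_
    rw [abs_mul, abs_mul]
    have h1 := mul_le_mul (abs_apply_le_norm H k i) (abs_apply_le_norm X k j) (abs_nonneg _)
      (norm_nonneg _)
    have h2 := mul_le_mul (abs_apply_le_norm X k i) (abs_apply_le_norm H k j) (abs_nonneg _)
      (norm_nonneg _)
    linarith
  refine (Finset.sum_le_card_nsmul _ _ _ this).trans_eq ?_
  simp; ring

theorem abs_gramResolventDeriv_le (X H : Fin n → Fin m → ℝ) {t : ℝ} (ht : 0 < t) (i j : Fin m) :
    |gramResolventDeriv X H t i j| ≤ 2 * n * m ^ 4 * (‖X‖ * ‖H‖) * (t⁻¹ * t⁻¹) := by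
  rw [gramResolventDeriv, Matrix.neg_apply, abs_neg]
  refine (abs_mul_mul_apply_le (abs_gramResolvent_le X ht) (abs_gramDeriv_le X H)
    (abs_gramResolvent_le X ht) i j).trans_eq ?_
  ring

section Deriv

attribute [local instance] Matrix.linftyOpNormedRing Matrix.linftyOpNormedAlgebra

theorem hasDerivAt_gramResolvent (X H : Fin n → Fin m → ℝ) {t : ℝ} (ht : 0 < t) (τ : ℝ)
    (i j : Fin m) :
    HasDerivAt (fun τ : ℝ => gramResolvent (X + τ • H) t i j)
      (gramResolventDeriv (X + τ • H) H t i j) τ := by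
  have hg : ∀ i j, HasDerivAt (fun τ : ℝ => (gram (X + τ • H) + t • 1) i j)
      (gramDeriv (X + τ • H) H i j) τ := by
    intro i j
    simp only [gram, gramDeriv, Matrix.add_apply, Matrix.mul_apply, Matrix.transpose_apply,
      Matrix.of_apply, Pi.add_apply, Pi.smul_apply, smul_eq_mul, ← Finset.sum_add_distrib]
    refine HasDerivAt.add_const _ (HasDerivAt.fun_sum fun k _ => ?_)
    have h : ∀ l, HasDerivAt (fun τ : ℝ => X k l + τ * H k l) (H k l) τ := fun l => by
      simpa using ((hasDerivAt_id τ).mul_const (H k l)).const_add (X k l)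
    exact (h i).mul (h j)
  have hg' : HasDerivAt (fun τ : ℝ => gram (X + τ • H) + t • 1) (gramDeriv (X + τ • H) H) τ :=
    hasDerivAt_pi.2 fun i => hasDerivAt_pi.2 fun j => hg i j
  obtain ⟨u, hu⟩ := (Matrix.isUnit_iff_isUnit_det _).2 (gram_det_ne_zero (X + τ • H) ht)
  have hinv := hasFDerivAt_ringInverse (𝕜 := ℝ) u
  rw [hu] at hinv
  have h := hinv.comp_hasDerivAt τ hg'
  have h2 := hasDerivAt_pi.1 (hasDerivAt_pi.1 h i) j
  convert! h2 using 1
  · funext τ'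
    simp [gramResolvent, Matrix.nonsing_inv_eq_ringInverse]
  · have : (↑u⁻¹ : Matrix (Fin m) (Fin m) ℝ) = gramResolvent (X + τ • H) t := by
      rw [gramResolvent, ← hu, Matrix.coe_units_inv]
    simp [gramResolventDeriv, this]

end Deriv

/-! ### Integrals of resolvents and their directional derivatives -/

/-- The matrix `∫₀^∞ t^(a-1) (XᵀX + ε + t)⁻¹ dt`, a constant multiple of `(XᵀX + ε)^(a-1)`. -/
noncomputable def powInt (a ε : ℝ) (X : Fin n → Fin m → ℝ) : Matrix (Fin m) (Fin m) ℝ :=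
  Matrix.of fun i j => ∫ t in Ioi (0 : ℝ), t ^ (a - 1) * gramResolvent X (t + ε) i j

/-- The derivative of `powInt a ε` at `X` in the direction `H`. -/
noncomputable def powIntDeriv (a ε : ℝ) (X H : Fin n → Fin m → ℝ) : Matrix (Fin m) (Fin m) ℝ :=
  Matrix.of fun i j => ∫ t in Ioi (0 : ℝ), t ^ (a - 1) * gramResolventDeriv X H (t + ε) i j

/-- `(tr R)² - tr R²`, which is the sum of `ρᵢ ρⱼ` over `i ≠ j` when `R` is symmetric with
eigenvalues `ρ`. -/
noncomputable def pairTrace (R : Matrix (Fin m) (Fin m) ℝ) : ℝ := R.trace * R.trace - (R * R).trace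

/-- The derivative of `pairTrace` at `R` in the direction `S`. -/
noncomputable def pairTraceDeriv (R S : Matrix (Fin m) (Fin m) ℝ) : ℝ :=
  2 * (R.trace * S.trace - (R * S).trace)

/-- The integral `∫₀^∞ t^a ((tr R)² - tr R²) dt` with `R = (XᵀX + ε + t)⁻¹`. It is the sum over
`i ≠ j` of the divided differences of a multiple of `x ↦ x^a` at the eigenvalues of `XᵀX + ε`. -/
noncomputable def pairInt (a ε : ℝ) (X : Fin n → Fin m → ℝ) : ℝ :=
  ∫ t in Ioi (0 : ℝ), t ^ a * pairTrace (gramResolvent X (t + ε))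

/-- The derivative of `pairInt a ε` at `X` in the direction `H`. -/
noncomputable def pairIntDeriv (a ε : ℝ) (X H : Fin n → Fin m → ℝ) : ℝ :=
  ∫ t in Ioi (0 : ℝ), t ^ a *
    pairTraceDeriv (gramResolvent X (t + ε)) (gramResolventDeriv X H (t + ε))

section Parametric

variable {φ φ' : (Fin n → Fin m → ℝ) → ℝ → ℝ} {b b' : ℝ → ℝ}

theorem measurable_integral_param (hm : Measurable fun q : (Fin n → Fin m → ℝ) × ℝ => φ q.1 q.2) :
    Measurable fun X => ∫ t in Ioi (0 : ℝ), φ X t :=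
  (hm.stronglyMeasurable.integral_prod_right' (ν := volume.restrict (Ioi (0 : ℝ)))).measurable

theorem integrableOn_param {φ : (Fin n → Fin m → ℝ) → ℝ → ℝ} {b : ℝ → ℝ}
    (hm : Measurable fun q : (Fin n → Fin m → ℝ) × ℝ => φ q.1 q.2)
    (X : Fin n → Fin m → ℝ) {c : ℝ} (hb : ∀ t, 0 < t → |φ X t| ≤ c * b t)
    (hbi : IntegrableOn b (Ioi 0)) : IntegrableOn (φ X) (Ioi 0) := by
  refine Integrable.mono' (hbi.const_mul c)
    (hm.comp measurable_prodMk_left).aestronglyMeasurable ?_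
  filter_upwards [ae_restrict_mem measurableSet_Ioi] with t ht using hb t ht

theorem abs_integral_param_le (X : Fin n → Fin m → ℝ) {c : ℝ}
    (hb : ∀ t, 0 < t → |φ X t| ≤ c * b t) (hbi : IntegrableOn b (Ioi 0)) :
    |∫ t in Ioi (0 : ℝ), φ X t| ≤ c * ∫ t in Ioi (0 : ℝ), b t := by
  rw [← integral_const_mul]
  refine norm_integral_le_of_norm_le (f := φ X) (Integrable.const_mul hbi c) ?_
  filter_upwards [ae_restrict_mem measurableSet_Ioi] with t ht using hb t ht

theorem hasDerivAt_integral_param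
    (hm : Measurable fun q : (Fin n → Fin m → ℝ) × ℝ => φ q.1 q.2)
    (hm' : Measurable fun q : (Fin n → Fin m → ℝ) × ℝ => φ' q.1 q.2)
    (X H : Fin n → Fin m → ℝ) (c c' : ℝ)
    (hb : ∀ X t, 0 < t → |φ X t| ≤ c * b t)
    (hb' : ∀ X t, 0 < t → |φ' X t| ≤ c' * ‖X‖ * b' t)
    (hb0 : ∀ t, 0 < t → 0 ≤ b' t) (hc' : 0 ≤ c')
    (hbi : IntegrableOn b (Ioi 0)) (hbi' : IntegrableOn b' (Ioi 0))
    (hd : ∀ t, 0 < t → ∀ τ : ℝ,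
      HasDerivAt (fun τ : ℝ => φ (X + τ • H) t) (φ' (X + τ • H) t) τ) :
    HasDerivAt (fun τ : ℝ => ∫ t in Ioi (0 : ℝ), φ (X + τ • H) t)
      (∫ t in Ioi (0 : ℝ), φ' X t) 0 := by
  have h := (hasDerivAt_integral_of_dominated_loc_of_deriv_le
    (μ := volume.restrict (Ioi (0 : ℝ))) (F := fun (τ : ℝ) t => φ (X + τ • H) t)
    (F' := fun (τ : ℝ) t => φ' (X + τ • H) t) (x₀ := 0)
    (bound := fun t => c' * (‖X‖ + ‖H‖) * b' t) (s := Metric.ball 0 1)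
    (Metric.ball_mem_nhds _ one_pos)
    (Eventually.of_forall fun τ => (hm.comp measurable_prodMk_left).aestronglyMeasurable)
    (integrableOn_param hm _ (fun t ht => hb _ t ht) hbi)
    (hm'.comp measurable_prodMk_left).aestronglyMeasurable
    (by
      filter_upwards [ae_restrict_mem measurableSet_Ioi] with t ht τ hτ
      have hτ1 : |τ| ≤ 1 := by simpa using (mem_ball_zero_iff.1 hτ).le
      refine (hb' _ t ht).trans ?_
      have h1 : ‖X + τ • H‖ ≤ ‖X‖ + ‖H‖ := by
        refine (norm_add_le _ _).trans ?_
        rw [norm_smul]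
        have := mul_le_mul_of_nonneg_right hτ1 (norm_nonneg H)
        rw [one_mul] at this
        exact add_le_add_right this _
      have := hb0 t ht
      gcongr)
    (hbi'.const_mul _)
    (by
      filter_upwards [ae_restrict_mem measurableSet_Ioi] with t ht τ _ using hd t ht τ)).2
  simpa using h

end Parametric

section Bounds

variable {a ε : ℝ}

theorem measurable_pairTrace_integrand (a ε : ℝ) :
    Measurable fun q : (Fin n → Fin m → ℝ) × ℝ =>
      q.2 ^ a * pairTrace (gramResolvent q.1 (q.2 + ε)) := by
  have h := measurable_gramResolvent (n := n) (m := m) ε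
  simp only [pairTrace, Matrix.trace, Matrix.diag, Matrix.mul_apply]
  fun_prop

theorem measurable_pairTraceDeriv_integrand (a ε : ℝ) (H : Fin n → Fin m → ℝ) :
    Measurable fun q : (Fin n → Fin m → ℝ) × ℝ => q.2 ^ a *
      pairTraceDeriv (gramResolvent q.1 (q.2 + ε)) (gramResolventDeriv q.1 H (q.2 + ε)) := by
  have h := measurable_gramResolvent (n := n) (m := m) ε
  have h' := measurable_gramResolventDeriv ε H
  simp only [pairTraceDeriv, Matrix.trace, Matrix.diag, Matrix.mul_apply]
  fun_prop

theorem measurable_powInt_integrand (a ε : ℝ) (i j : Fin m) :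
    Measurable fun q : (Fin n → Fin m → ℝ) × ℝ =>
      q.2 ^ (a - 1) * gramResolvent q.1 (q.2 + ε) i j := by
  have h := measurable_gramResolvent (n := n) (m := m) ε
  fun_prop

theorem measurable_powIntDeriv_integrand (a ε : ℝ) (H : Fin n → Fin m → ℝ) (i j : Fin m) :
    Measurable fun q : (Fin n → Fin m → ℝ) × ℝ =>
      q.2 ^ (a - 1) * gramResolventDeriv q.1 H (q.2 + ε) i j := by
  have h := measurable_gramResolventDeriv ε H
  fun_prop

theorem abs_powInt_integrand_le (hε : 0 < ε) (X : Fin n → Fin m → ℝ) (i j : Fin m) (t : ℝ)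
    (ht : 0 < t) :
    |t ^ (a - 1) * gramResolvent X (t + ε) i j| ≤ m * (t ^ (a - 1) * (t + ε)⁻¹) := by
  have ht' : 0 < t + ε := by linarith
  rw [abs_mul, abs_of_nonneg (by positivity)]
  calc _ ≤ t ^ (a - 1) * (m * (t + ε)⁻¹) := by
        gcongr; exact abs_gramResolvent_le X ht' i j
    _ = _ := by ring

theorem abs_powIntDeriv_integrand_le (hε : 0 < ε) (X H : Fin n → Fin m → ℝ) (i j : Fin m) (t : ℝ)
    (ht : 0 < t) :
    |t ^ (a - 1) * gramResolventDeriv X H (t + ε) i j| ≤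
      2 * n * m ^ 4 * ‖H‖ * ‖X‖ * (t ^ (a - 1) * ((t + ε)⁻¹ * (t + ε)⁻¹)) := by
  have ht' : 0 < t + ε := by linarith
  rw [abs_mul, abs_of_nonneg (by positivity)]
  calc _ ≤ t ^ (a - 1) * (2 * n * m ^ 4 * (‖X‖ * ‖H‖) * ((t + ε)⁻¹ * (t + ε)⁻¹)) := by
        gcongr; exact abs_gramResolventDeriv_le X H ht' i j
    _ = _ := by ring

theorem abs_trace_mul_trace_sub_le {R S : Matrix (Fin m) (Fin m) ℝ} {r s : ℝ}
    (hR : ∀ i j, |R i j| ≤ r) (hS : ∀ i j, |S i j| ≤ s) :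
    |R.trace * S.trace - (R * S).trace| ≤ 2 * m ^ 2 * (r * s) := by
  have h : R.trace * S.trace - (R * S).trace =
      ∑ i, ∑ j, (R i i * S j j - R i j * S j i) := by
    simp only [Matrix.trace, Matrix.diag, Matrix.mul_apply, Finset.sum_mul_sum,
      Finset.sum_sub_distrib]
  rw [h]
  have h1 : ∀ i ∈ Finset.univ, |∑ j, (R i i * S j j - R i j * S j i)| ≤ m * (2 * (r * s)) := by
    intro i _
    refine (Finset.abs_sum_le_sum_abs _ _).trans ?_
    have : ∀ j ∈ Finset.univ, |R i i * S j j - R i j * S j i| ≤ 2 * (r * s) := fun j _ => by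
      refine (abs_sub _ _).trans ?_
      rw [abs_mul, abs_mul]
      have h1 := mul_le_mul (hR i i) (hS j j) (abs_nonneg _) ((abs_nonneg _).trans (hR i i))
      have h2 := mul_le_mul (hR i j) (hS j i) (abs_nonneg _) ((abs_nonneg _).trans (hR i i))
      linarith
    simpa using Finset.sum_le_card_nsmul _ _ _ this
  refine (Finset.abs_sum_le_sum_abs _ _).trans ((Finset.sum_le_card_nsmul _ _ _ h1).trans_eq ?_)
  simp; ring

theorem abs_pairInt_integrand_le (hε : 0 < ε) (X : Fin n → Fin m → ℝ) (t : ℝ) (ht : 0 < t) :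
    |t ^ a * pairTrace (gramResolvent X (t + ε))| ≤
      2 * m ^ 4 * (t ^ a * ((t + ε)⁻¹ * (t + ε)⁻¹)) := by
  have ht' : 0 < t + ε := by linarith
  rw [abs_mul, abs_of_nonneg (by positivity)]
  calc _ ≤ t ^ a * (2 * m ^ 2 * ((m * (t + ε)⁻¹) * (m * (t + ε)⁻¹))) := by
        gcongr
        exact abs_trace_mul_trace_sub_le (abs_gramResolvent_le X ht') (abs_gramResolvent_le X ht')
    _ = _ := by ring

theorem abs_pairIntDeriv_integrand_le (hε : 0 < ε) (X H : Fin n → Fin m → ℝ) (t : ℝ)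
    (ht : 0 < t) :
    |t ^ a * pairTraceDeriv (gramResolvent X (t + ε)) (gramResolventDeriv X H (t + ε))| ≤
      8 * n * m ^ 7 * ‖H‖ * ‖X‖ * (t ^ a * ((t + ε)⁻¹ * (t + ε)⁻¹ * (t + ε)⁻¹)) := by
  have ht' : 0 < t + ε := by linarith
  rw [abs_mul, abs_of_nonneg (by positivity), pairTraceDeriv, abs_mul, abs_two]
  calc _ ≤ t ^ a * (2 * (2 * m ^ 2 * ((m * (t + ε)⁻¹) *
          (2 * n * m ^ 4 * (‖X‖ * ‖H‖) * ((t + ε)⁻¹ * (t + ε)⁻¹))))) := by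
        gcongr
        exact abs_trace_mul_trace_sub_le (abs_gramResolvent_le X ht')
          (abs_gramResolventDeriv_le X H ht')
    _ = _ := by ring

theorem hasDerivAt_powInt (ha : 0 < a) (ha1 : a < 1) (hε : 0 < ε) (X H : Fin n → Fin m → ℝ)
    (i j : Fin m) :
    HasDerivAt (fun τ : ℝ => powInt a ε (X + τ • H) i j) (powIntDeriv a ε X H i j) 0 := by
  refine hasDerivAt_integral_param (measurable_powInt_integrand a ε i j)
    (measurable_powIntDeriv_integrand a ε H i j) X H m (2 * n * m ^ 4 * ‖H‖)
    (fun X t ht => abs_powInt_integrand_le hε X i j t ht)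
    (fun X t ht => abs_powIntDeriv_integrand_le hε X H i j t ht)
    (fun t ht => by positivity) (by positivity) (integrableOn_rpow_mul_inv ha ha1 hε)
    (integrableOn_rpow_mul_inv_mul_inv ha ha1 hε hε) fun t ht τ => ?_
  exact (hasDerivAt_gramResolvent X H (by linarith) τ i j).const_mul _

theorem hasDerivAt_pairInt (ha : 0 < a) (ha1 : a < 1) (hε : 0 < ε) (X H : Fin n → Fin m → ℝ) :
    HasDerivAt (fun τ : ℝ => pairInt a ε (X + τ • H)) (pairIntDeriv a ε X H) 0 := by
  refine hasDerivAt_integral_param (measurable_pairTrace_integrand a ε)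
    (measurable_pairTraceDeriv_integrand a ε H) X H (2 * m ^ 4) (8 * n * m ^ 7 * ‖H‖)
    (fun X t ht => abs_pairInt_integrand_le hε X t ht)
    (fun X t ht => abs_pairIntDeriv_integrand_le hε X H t ht)
    (fun t ht => by positivity) (by positivity) (integrableOn_rpow_mul_inv_mul_inv' ha ha1 hε hε)
    (integrableOn_rpow_mul_inv_mul_inv_mul_inv ha ha1 hε hε hε) fun t ht τ => ?_
  refine HasDerivAt.const_mul _ ?_
  have hR := fun i j => hasDerivAt_gramResolvent X H (t := t + ε) (by linarith) τ i j
  simp only [pairTrace, pairTraceDeriv, Matrix.trace, Matrix.diag, Matrix.mul_apply]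
  have h1 := HasDerivAt.fun_sum (u := Finset.univ) fun i _ => hR i i
  have h2 := HasDerivAt.fun_sum (u := Finset.univ) fun i _ =>
    HasDerivAt.fun_sum (u := Finset.univ) fun j _ => (hR i j).mul (hR j i)
  convert! (h1.mul h1).sub h2 using 1
  rw [mul_sub]
  congr 1
  · ring
  · simp only [Finset.sum_add_distrib]
    rw [Finset.sum_comm (f := fun i j => gramResolventDeriv (X + τ • H) H (t + ε) i j * _)]
    rw [two_mul]
    congr 1
    exact Finset.sum_congr rfl fun i _ => Finset.sum_congr rfl fun j _ => mul_comm _ _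

theorem integrableOn_powIntDeriv_integrand (ha : 0 < a) (ha1 : a < 1) (hε : 0 < ε)
    (X H : Fin n → Fin m → ℝ) (i j : Fin m) :
    IntegrableOn (fun t : ℝ => t ^ (a - 1) * gramResolventDeriv X H (t + ε) i j) (Ioi 0) :=
  integrableOn_param (φ := fun X t => t ^ (a - 1) * gramResolventDeriv X H (t + ε) i j)
    (measurable_powIntDeriv_integrand a ε H i j) X
    (fun t ht => abs_powIntDeriv_integrand_le hε X H i j t ht)
    (integrableOn_rpow_mul_inv_mul_inv ha ha1 hε hε)

theorem integrableOn_pairInt_integrand (ha : 0 < a) (ha1 : a < 1) (hε : 0 < ε)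
    (X : Fin n → Fin m → ℝ) :
    IntegrableOn (fun t : ℝ => t ^ a * pairTrace (gramResolvent X (t + ε))) (Ioi 0) :=
  integrableOn_param (φ := fun X t => t ^ a * pairTrace (gramResolvent X (t + ε)))
    (measurable_pairTrace_integrand a ε) X
    (fun t ht => abs_pairInt_integrand_le hε X t ht)
    (integrableOn_rpow_mul_inv_mul_inv' ha ha1 hε hε)

theorem integrableOn_pairIntDeriv_integrand (ha : 0 < a) (ha1 : a < 1) (hε : 0 < ε)
    (X H : Fin n → Fin m → ℝ) :
    IntegrableOn (fun t : ℝ => t ^ a *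
      pairTraceDeriv (gramResolvent X (t + ε)) (gramResolventDeriv X H (t + ε))) (Ioi 0) :=
  integrableOn_param (φ := fun X t => t ^ a *
      pairTraceDeriv (gramResolvent X (t + ε)) (gramResolventDeriv X H (t + ε)))
    (measurable_pairTraceDeriv_integrand a ε H) X
    (fun t ht => abs_pairIntDeriv_integrand_le hε X H t ht)
    (integrableOn_rpow_mul_inv_mul_inv_mul_inv ha ha1 hε hε hε)

end Bounds

section Linear

theorem gramDeriv_add (X H H' : Fin n → Fin m → ℝ) :
    gramDeriv X (H + H') = gramDeriv X H + gramDeriv X H' := by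
  simp only [gramDeriv, ← Matrix.of_add_of, Matrix.transpose_add, Matrix.add_mul, Matrix.mul_add]
  abel

theorem gramDeriv_smul (X H : Fin n → Fin m → ℝ) (c : ℝ) :
    gramDeriv X (c • H) = c • gramDeriv X H := by
  simp only [gramDeriv, ← Matrix.smul_of, Matrix.transpose_smul, Matrix.smul_mul,
    Matrix.mul_smul, smul_add]

/-- The directional derivative of the resolvent is linear in the direction. -/
theorem gramResolventDeriv_linear (X H H' : Fin n → Fin m → ℝ) (c : ℝ) (t : ℝ) :
    gramResolventDeriv X (H + c • H') t =
      gramResolventDeriv X H t + c • gramResolventDeriv X H' t := by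
  simp only [gramResolventDeriv, gramDeriv_add, gramDeriv_smul, Matrix.mul_add, Matrix.add_mul,
    Matrix.mul_smul, Matrix.smul_mul, neg_add, smul_neg]

variable {a ε : ℝ}

theorem powIntDeriv_linear (ha : 0 < a) (ha1 : a < 1) (hε : 0 < ε) (X H H' : Fin n → Fin m → ℝ)
    (c : ℝ) : powIntDeriv a ε X (H + c • H') = powIntDeriv a ε X H + c • powIntDeriv a ε X H' := by
  ext i j
  have h1 := integrableOn_powIntDeriv_integrand ha ha1 hε X H i j
  have h2 := integrableOn_powIntDeriv_integrand ha ha1 hε X H' i j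
  simp only [powIntDeriv, Matrix.of_apply, Matrix.add_apply, Matrix.smul_apply, smul_eq_mul]
  rw [← integral_const_mul, ← integral_add h1 (h2.const_mul c)]
  refine integral_congr_ae (Eventually.of_forall fun t => ?_)
  simp only [gramResolventDeriv_linear, Matrix.add_apply, Matrix.smul_apply, smul_eq_mul]
  ring

theorem pairIntDeriv_linear (ha : 0 < a) (ha1 : a < 1) (hε : 0 < ε) (X H H' : Fin n → Fin m → ℝ)
    (c : ℝ) : pairIntDeriv a ε X (H + c • H') = pairIntDeriv a ε X H + c * pairIntDeriv a ε X H' := by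
  have h1 := integrableOn_pairIntDeriv_integrand ha ha1 hε X H
  have h2 := integrableOn_pairIntDeriv_integrand ha ha1 hε X H'
  simp only [pairIntDeriv]
  rw [← integral_const_mul, ← integral_add h1 (h2.const_mul c)]
  refine integral_congr_ae (Eventually.of_forall fun t => ?_)
  simp only [gramResolventDeriv_linear, pairTraceDeriv, Matrix.trace_add, Matrix.trace_smul,
    Matrix.mul_add, Matrix.mul_smul, smul_eq_mul]
  ring

end Linear

/-! ### The regularized estimator and its unbiased risk estimate -/

/-- The matrix unit with a one at the position `(i, j)`. -/
def unitMat (i : Fin n) (j : Fin m) : Fin n → Fin m → ℝ := Pi.single i (Pi.single j 1)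

/-- The numerator of the regularized shrinkage factor. -/
noncomputable def shrinkNum (a ε k : ℝ) (X : Fin n → Fin m → ℝ) : ℝ :=
  k * (powInt a ε X).trace + pairInt a ε X

/-- The derivative of `shrinkNum a ε k` at `X` in the direction `H`. -/
noncomputable def shrinkNumDeriv (a ε k : ℝ) (X H : Fin n → Fin m → ℝ) : ℝ :=
  k * (powIntDeriv a ε X H).trace + pairIntDeriv a ε X H

/-- The denominator of the regularized shrinkage factor. -/
noncomputable def shrinkDen (a ε : ℝ) (X : Fin n → Fin m → ℝ) : ℝ :=
  (powInt a ε X * (gram X + ε • 1) * powInt a ε X).trace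

/-- The derivative of `shrinkDen a ε` at `X` in the direction `H`. -/
noncomputable def shrinkDenDeriv (a ε : ℝ) (X H : Fin n → Fin m → ℝ) : ℝ :=
  (powIntDeriv a ε X H * (gram X + ε • 1) * powInt a ε X +
    powInt a ε X * gramDeriv X H * powInt a ε X +
    powInt a ε X * (gram X + ε • 1) * powIntDeriv a ε X H).trace

/-- The regularized shrinkage factor. -/
noncomputable def shrinkFactor (a ε k : ℝ) (X : Fin n → Fin m → ℝ) : ℝ :=
  shrinkNum a ε k X / shrinkDen a ε X

/-- The derivative of `shrinkFactor a ε k` at `X` in the direction `H`. -/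
noncomputable def shrinkFactorDeriv (a ε k : ℝ) (X H : Fin n → Fin m → ℝ) : ℝ :=
  shrinkNumDeriv a ε k X H / shrinkDen a ε X -
    shrinkNum a ε k X * shrinkDenDeriv a ε X H / shrinkDen a ε X ^ 2

/-- The matrix field `X (XᵀX + ε)^(a-1)`, up to a constant factor. -/
noncomputable def powField (a ε : ℝ) (X : Fin n → Fin m → ℝ) : Fin n → Fin m → ℝ :=
  fun i j => (Matrix.of X * powInt a ε X) i j

/-- The derivative of `powField a ε` at `X` in the direction `H`. -/
noncomputable def powFieldDeriv (a ε : ℝ) (X H : Fin n → Fin m → ℝ) : Fin n → Fin m → ℝ :=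
  fun i j => (Matrix.of H * powInt a ε X + Matrix.of X * powIntDeriv a ε X H) i j

/-- The regularized correction `-α_ε(X) X (XᵀX + ε)^(a-1)` that is added to the observation. -/
noncomputable def sureField (a ε k : ℝ) (X : Fin n → Fin m → ℝ) : Fin n → Fin m → ℝ :=
  fun i j => -(shrinkFactor a ε k X * powField a ε X i j)

/-- The derivative of `sureField a ε k` at `X` in the direction `H`. -/
noncomputable def sureFieldDeriv (a ε k : ℝ) (X H : Fin n → Fin m → ℝ) : Fin n → Fin m → ℝ :=
  fun i j => -(shrinkFactorDeriv a ε k X H * powField a ε X i j +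
    shrinkFactor a ε k X * powFieldDeriv a ε X H i j)

section Linear

variable {a ε k : ℝ}

theorem shrinkFactorDeriv_linear (ha : 0 < a) (ha1 : a < 1) (hε : 0 < ε)
    (X H H' : Fin n → Fin m → ℝ) (c : ℝ) :
    shrinkFactorDeriv a ε k X (H + c • H') =
      shrinkFactorDeriv a ε k X H + c * shrinkFactorDeriv a ε k X H' := by
  simp only [shrinkFactorDeriv, shrinkNumDeriv, shrinkDenDeriv, powIntDeriv_linear ha ha1 hε,
    pairIntDeriv_linear ha ha1 hε, gramDeriv_add, gramDeriv_smul, Matrix.mul_add, Matrix.add_mul,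
    Matrix.mul_smul, Matrix.smul_mul, Matrix.trace_add, Matrix.trace_smul, smul_eq_mul]
  ring

theorem sum_mul_shrinkFactorDeriv_unitMat (ha : 0 < a) (ha1 : a < 1) (hε : 0 < ε)
    (X Y : Fin n → Fin m → ℝ) :
    ∑ i, ∑ j, Y i j * shrinkFactorDeriv a ε k X (unitMat i j) = shrinkFactorDeriv a ε k X Y := by
  have h0 : shrinkFactorDeriv a ε k X 0 = 0 := by
    have h := shrinkFactorDeriv_linear (k := k) ha ha1 hε X 0 0 1
    rw [smul_zero, add_zero] at h
    linarith
  let L : (Fin n → Fin m → ℝ) →ₗ[ℝ] ℝ :=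
    { toFun := shrinkFactorDeriv a ε k X
      map_add' := fun H H' => by
        simpa using shrinkFactorDeriv_linear (k := k) ha ha1 hε X H H' 1
      map_smul' := fun c H => by
        simpa [h0] using shrinkFactorDeriv_linear (k := k) ha ha1 hε X 0 H c }
  have hY : Y = ∑ i, ∑ j, Y i j • (unitMat i j : Fin n → Fin m → ℝ) := by
    ext i j
    simp [unitMat, Finset.sum_apply, Pi.single_apply, apply_ite, ite_apply]
  calc _ = L (∑ i, ∑ j, Y i j • unitMat i j) := by
        simp only [map_sum, map_smul, smul_eq_mul]; rfl
    _ = _ := by rw [← hY]; rfl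

end Linear

section Spectral

variable {a ε : ℝ} {X : Fin n → Fin m → ℝ} {V : Matrix (Fin m) (Fin m) ℝ} {l : Fin m → ℝ}

theorem integral_conj_apply {d : ℝ → Fin m → ℝ} {w : ℝ → ℝ}
    (hd : ∀ k, IntegrableOn (fun t => w t * d t k) (Ioi 0)) (i j : Fin m) :
    ∫ t in Ioi (0 : ℝ), w t * (V * Matrix.diagonal (d t) * Vᵀ) i j =
      (V * Matrix.diagonal (fun k => ∫ t in Ioi (0 : ℝ), w t * d t k) * Vᵀ) i j := by
  simp only [conj_apply, Finset.mul_sum, ← mul_assoc]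
  rw [integral_finsetSum _ fun k _ => ((hd k).mul_const _).mul_const _]
  refine Finset.sum_congr rfl fun k _ => ?_
  rw [integral_mul_const, integral_mul_const]

theorem gramResolvent_add_eq (hV : Vᵀ * V = 1) (hV' : V * Vᵀ = 1) (hl : ∀ i, 0 ≤ l i)
    (h : gram X = V * Matrix.diagonal l * Vᵀ) (hε : 0 < ε) {t : ℝ} (ht : 0 < t) :
    gramResolvent X (t + ε) = V * Matrix.diagonal (fun i => (t + (ε + l i))⁻¹) * Vᵀ := by
  rw [gramResolvent_eq hV hV' hl h (by linarith)]
  simp only [add_assoc]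

theorem powInt_eq (ha : 0 < a) (ha1 : a < 1) (hε : 0 < ε) (hV : Vᵀ * V = 1) (hV' : V * Vᵀ = 1)
    (hl : ∀ i, 0 ≤ l i) (h : gram X = V * Matrix.diagonal l * Vᵀ) :
    powInt a ε X = V * Matrix.diagonal (fun i => stieltjes a (ε + l i)) * Vᵀ := by
  ext i j
  have := integral_conj_apply (V := V) (d := fun t i => (t + (ε + l i))⁻¹)
    (w := fun t => t ^ (a - 1))
    (fun k => integrableOn_rpow_mul_inv ha ha1 (by linarith [hl k])) i j
  refine Eq.trans ?_ this
  refine setIntegral_congr_fun measurableSet_Ioi fun t ht => ?_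
  rw [← gramResolvent_add_eq hV hV' hl h hε ht]

theorem pairTrace_conj (hV : Vᵀ * V = 1) (r : Fin m → ℝ) :
    pairTrace (V * Matrix.diagonal r * Vᵀ) = (∑ i, r i) * (∑ i, r i) - ∑ i, r i * r i := by
  rw [pairTrace, conj_mul_conj hV, trace_conj hV, trace_conj hV]

theorem pairInt_eq (hε : 0 < ε) (hV : Vᵀ * V = 1) (hV' : V * Vᵀ = 1)
    (hl : ∀ i, 0 ≤ l i) (h : gram X = V * Matrix.diagonal l * Vᵀ) :
    pairInt a ε X = ∫ t in Ioi (0 : ℝ), t ^ a *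
      ((∑ i, (t + (ε + l i))⁻¹) * (∑ i, (t + (ε + l i))⁻¹) -
        ∑ i, (t + (ε + l i))⁻¹ * (t + (ε + l i))⁻¹) := by
  refine setIntegral_congr_fun measurableSet_Ioi fun t ht => ?_
  rw [gramResolvent_add_eq hV hV' hl h hε ht, pairTrace_conj hV]

theorem shrinkDen_eq (ha : 0 < a) (ha1 : a < 1) (hε : 0 < ε) (hV : Vᵀ * V = 1)
    (hV' : V * Vᵀ = 1) (hl : ∀ i, 0 ≤ l i) (h : gram X = V * Matrix.diagonal l * Vᵀ) :
    shrinkDen a ε X = ∑ i, stieltjes a (ε + l i) ^ 2 * (ε + l i) := by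
  rw [shrinkDen, powInt_eq ha ha1 hε hV hV' hl h, gram_add_smul_one hV' h, conj_mul_conj hV,
    conj_mul_conj hV, trace_conj hV]
  exact Finset.sum_congr rfl fun i _ => by ring

theorem gramDeriv_powField (ha : 0 < a) (ha1 : a < 1) (hε : 0 < ε) (hV : Vᵀ * V = 1)
    (hV' : V * Vᵀ = 1) (hl : ∀ i, 0 ≤ l i) (h : gram X = V * Matrix.diagonal l * Vᵀ) :
    gramDeriv X (powField a ε X) =
      V * Matrix.diagonal (fun i => 2 * (stieltjes a (ε + l i) * l i)) * Vᵀ := by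
  have hof : Matrix.of (powField a ε X) = Matrix.of X * powInt a ε X := rfl
  have hF := powInt_eq ha ha1 hε hV hV' hl h
  have hFT : (powInt a ε X)ᵀ = powInt a ε X := by
    rw [hF, Matrix.transpose_mul, Matrix.transpose_mul, Matrix.transpose_transpose,
      Matrix.diagonal_transpose, Matrix.mul_assoc]
  have hg : gramDeriv X (powField a ε X) = powInt a ε X * gram X + gram X * powInt a ε X := by
    rw [gramDeriv, hof, Matrix.transpose_mul, hFT, gram, Matrix.mul_assoc, Matrix.mul_assoc]
  rw [hg, hF, h, conj_mul_conj hV, conj_mul_conj hV, ← Matrix.add_mul, ← Matrix.mul_add,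
    Matrix.diagonal_add]
  congr 3
  funext i; ring

theorem gramResolventDeriv_powField (ha : 0 < a) (ha1 : a < 1) (hε : 0 < ε) (hV : Vᵀ * V = 1)
    (hV' : V * Vᵀ = 1) (hl : ∀ i, 0 ≤ l i) (h : gram X = V * Matrix.diagonal l * Vᵀ)
    {t : ℝ} (ht : 0 < t) :
    gramResolventDeriv X (powField a ε X) (t + ε) =
      V * Matrix.diagonal (fun i => -2 * (stieltjes a (ε + l i) * l i) *
        ((t + (ε + l i))⁻¹ * (t + (ε + l i))⁻¹)) * Vᵀ := by
  rw [gramResolventDeriv, gramDeriv_powField ha ha1 hε hV hV' hl h,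
    gramResolvent_add_eq hV hV' hl h hε ht, conj_mul_conj hV, conj_mul_conj hV,
    ← Matrix.neg_mul, ← Matrix.mul_neg, Matrix.diagonal_neg]
  congr 3
  funext i; ring

theorem powIntDeriv_powField (ha : 0 < a) (ha1 : a < 1) (hε : 0 < ε) (hV : Vᵀ * V = 1)
    (hV' : V * Vᵀ = 1) (hl : ∀ i, 0 ≤ l i) (h : gram X = V * Matrix.diagonal l * Vᵀ) :
    powIntDeriv a ε X (powField a ε X) =
      V * Matrix.diagonal (fun i => -2 * (1 - a) * stieltjes a (ε + l i) ^ 2 *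
        (l i / (ε + l i))) * Vᵀ := by
  have hx : ∀ i, 0 < ε + l i := fun i => by linarith [hl i]
  have hd : ∀ k, IntegrableOn (fun t : ℝ => t ^ (a - 1) *
      (-2 * (stieltjes a (ε + l k) * l k) * ((t + (ε + l k))⁻¹ * (t + (ε + l k))⁻¹)))
      (Ioi 0) := fun k => by
    refine IntegrableOn.congr_fun (Integrable.const_mul
      (integrableOn_rpow_mul_inv_mul_inv ha ha1 (hx k) (hx k))
      (-2 * (stieltjes a (ε + l k) * l k))) (fun t _ => ?_) measurableSet_Ioi
    ring
  ext i j
  have := integral_conj_apply (V := V) hd i j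
  have h2 : powIntDeriv a ε X (powField a ε X) i j = _ := Eq.trans
    (setIntegral_congr_fun measurableSet_Ioi fun t ht => by
      rw [gramResolventDeriv_powField ha ha1 hε hV hV' hl h ht]) this
  rw [h2]
  refine congrArg (fun d : Fin m → ℝ => (V * Matrix.diagonal d * Vᵀ) i j) (funext fun k => ?_)
  have h3 := integral_rpow_mul_inv_sq ha ha1 (hx k)
  have h4 : ∀ t : ℝ, t ^ (a - 1) *
      (-2 * (stieltjes a (ε + l k) * l k) * ((t + (ε + l k))⁻¹ * (t + (ε + l k))⁻¹)) =
      -2 * (stieltjes a (ε + l k) * l k) / (ε + l k) *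
        (t ^ (a - 1) * ((ε + l k) * (t + (ε + l k))⁻¹ ^ 2)) := fun t => by
    have := (hx k).ne'
    field_simp
  simp_rw [h4]
  rw [integral_const_mul, h3]
  ring

theorem shrinkDenDeriv_powField (ha : 0 < a) (ha1 : a < 1) (hε : 0 < ε) (hV : Vᵀ * V = 1)
    (hV' : V * Vᵀ = 1) (hl : ∀ i, 0 ≤ l i) (h : gram X = V * Matrix.diagonal l * Vᵀ) :
    shrinkDenDeriv a ε X (powField a ε X) =
      ∑ i, (4 * a - 2) * (stieltjes a (ε + l i) ^ 3 * l i) := by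
  have hx : ∀ i, ε + l i ≠ 0 := fun i => by linarith [hl i]
  rw [shrinkDenDeriv, powIntDeriv_powField ha ha1 hε hV hV' hl h,
    gramDeriv_powField ha ha1 hε hV hV' hl h, powInt_eq ha ha1 hε hV hV' hl h,
    gram_add_smul_one hV' h]
  simp only [conj_mul_conj hV, Matrix.trace_add, trace_conj hV, ← Finset.sum_add_distrib]
  refine Finset.sum_congr rfl fun i _ => ?_
  have := hx i
  field_simp
  ring

theorem sum_sq_powField (ha : 0 < a) (ha1 : a < 1) (hε : 0 < ε) (hV : Vᵀ * V = 1)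
    (hV' : V * Vᵀ = 1) (hl : ∀ i, 0 ≤ l i) (h : gram X = V * Matrix.diagonal l * Vᵀ) :
    ∑ i, ∑ j, powField a ε X i j ^ 2 = ∑ i, stieltjes a (ε + l i) ^ 2 * l i := by
  have hF := powInt_eq ha ha1 hε hV hV' hl h
  have hFT : (powInt a ε X)ᵀ = powInt a ε X := by
    rw [hF, Matrix.transpose_mul, Matrix.transpose_mul, Matrix.transpose_transpose,
      Matrix.diagonal_transpose, Matrix.mul_assoc]
  have h1 : ∑ i, ∑ j, powField a ε X i j ^ 2 =
      ((Matrix.of X * powInt a ε X)ᵀ * (Matrix.of X * powInt a ε X)).trace := by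
    rw [Finset.sum_comm]
    simp only [Matrix.trace, Matrix.diag, Matrix.mul_apply (M := (Matrix.of X * powInt a ε X)ᵀ),
      Matrix.transpose_apply, powField, sq]
  have h2 : (Matrix.of X * powInt a ε X)ᵀ * (Matrix.of X * powInt a ε X) =
      powInt a ε X * gram X * powInt a ε X := by
    rw [Matrix.transpose_mul, hFT, gram]
    simp only [Matrix.mul_assoc]
  rw [h1, h2, hF, h, conj_mul_conj hV, conj_mul_conj hV, trace_conj hV]
  exact Finset.sum_congr rfl fun i _ => by ring

theorem mul_single_mul_apply {α β γ δ : Type*} [Fintype β] [Fintype γ] [DecidableEq β]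
    [DecidableEq γ] (M : Matrix α β ℝ) (N : Matrix γ δ ℝ) (i : β) (j : γ) (a : α) (b : δ) :
    (M * Matrix.single i j (1 : ℝ) * N) a b = M a i * N j b := by
  simp [Matrix.mul_apply, Matrix.single_apply, ite_and, Finset.sum_ite_eq]

theorem of_unitMat (i : Fin n) (j : Fin m) :
    Matrix.of (unitMat i j) = Matrix.single i j (1 : ℝ) := by
  ext a b
  simp only [unitMat, Matrix.of_apply, Pi.single_apply, Matrix.single_apply, ite_apply,
    Pi.zero_apply, ite_and, eq_comm]

/-- The divergence of `X ↦ X R` for the resolvent `R`, without the term `n tr R`. -/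
theorem sum_mul_gramResolventDeriv_unitMat (hV : Vᵀ * V = 1) (hV' : V * Vᵀ = 1)
    (hl : ∀ i, 0 ≤ l i) (h : gram X = V * Matrix.diagonal l * Vᵀ) {t : ℝ} (ht : 0 < t) :
    ∑ i, ∑ j, (Matrix.of X * gramResolventDeriv X (unitMat i j) t) i j =
      -(∑ i, l i * ((t + l i)⁻¹ * (t + l i)⁻¹) + (∑ i, l i * (t + l i)⁻¹) * ∑ i, (t + l i)⁻¹) := by
  have hR := gramResolvent_eq hV hV' hl h ht
  set R := gramResolvent X t with hRdef
  have hRT : Rᵀ = R := by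
    rw [hR, Matrix.transpose_mul, Matrix.transpose_mul, Matrix.transpose_transpose,
      Matrix.diagonal_transpose, Matrix.mul_assoc]
  have h1 : ∀ i j, (Matrix.of X * gramResolventDeriv X (unitMat i j) t) i j =
      -((Matrix.of X * R) i j * (Matrix.of X * R) i j +
        (Matrix.of X * R * (Matrix.of X)ᵀ) i i * R j j) := by
    intro i j
    have : Matrix.of X * gramResolventDeriv X (unitMat i j) t =
        -((Matrix.of X * R) * Matrix.single j i (1 : ℝ) * (Matrix.of X * R) +
          (Matrix.of X * R * (Matrix.of X)ᵀ) * Matrix.single i j (1 : ℝ) * R) := by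
      rw [gramResolventDeriv, ← hRdef, gramDeriv, of_unitMat, Matrix.transpose_single]
      simp only [Matrix.mul_neg, Matrix.mul_add, Matrix.add_mul, Matrix.mul_assoc]
    rw [this, Matrix.neg_apply, Matrix.add_apply, mul_single_mul_apply, mul_single_mul_apply]
  simp only [h1, Finset.sum_neg_distrib, Finset.sum_add_distrib]
  congr 2
  · have h2 : ∑ i, ∑ j, (Matrix.of X * R) i j * (Matrix.of X * R) i j =
        ((Matrix.of X * R)ᵀ * (Matrix.of X * R)).trace := by
      rw [Finset.sum_comm]
      simp only [Matrix.trace, Matrix.diag, Matrix.mul_apply (M := (Matrix.of X * R)ᵀ),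
        Matrix.transpose_apply]
    have h3 : (Matrix.of X * R)ᵀ * (Matrix.of X * R) = R * gram X * R := by
      rw [Matrix.transpose_mul, hRT, gram]; simp only [Matrix.mul_assoc]
    rw [h2, h3, hR, h, conj_mul_conj hV, conj_mul_conj hV, trace_conj hV]
    exact Finset.sum_congr rfl fun i _ => by ring
  · have h2 : ∑ i, ∑ j, (Matrix.of X * R * (Matrix.of X)ᵀ) i i * R j j =
        (Matrix.of X * R * (Matrix.of X)ᵀ).trace * R.trace := by
      rw [Matrix.trace, Matrix.trace, Finset.sum_mul_sum]; rfl
    have h3 : (Matrix.of X * R * (Matrix.of X)ᵀ).trace = (gram X * R).trace := by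
      rw [Matrix.trace_mul_comm, gram, Matrix.mul_assoc]
    rw [h2, h3, hR, h, conj_mul_conj hV, trace_conj hV, trace_conj hV]

end Spectral

section Inequality

variable {a ε : ℝ} {X : Fin n → Fin m → ℝ} {V : Matrix (Fin m) (Fin m) ℝ} {l : Fin m → ℝ}

theorem sum_mul_self_le_mul_self_sum {ι : Type*} (s : Finset ι) {r : ι → ℝ} (hr : ∀ i, 0 ≤ r i) :
    ∑ i ∈ s, r i * r i ≤ (∑ i ∈ s, r i) * ∑ i ∈ s, r i := by
  rw [Finset.sum_mul_sum]
  exact Finset.sum_le_sum fun i hi =>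
    Finset.single_le_sum (f := fun j => r i * r j) (fun j _ => mul_nonneg (hr i) (hr j)) hi

/-- Symmetrizing over pairs gains the factor two that the risk bound needs. -/
theorem two_mul_sum_le_sum_mul_pair {f l r : Fin m → ℝ} (hf : ∀ i, 0 ≤ f i) (hr : ∀ i, 0 ≤ r i)
    (hlr : ∀ i, l i * r i ≤ 1) :
    2 * ∑ i, f i * l i * (r i * r i) * ((∑ j, r j) - r i) ≤
      (∑ i, f i) * ((∑ i, r i) * (∑ i, r i) - ∑ i, r i * r i) := by
  rw [Finset.mul_sum, Finset.sum_mul]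
  refine Finset.sum_le_sum fun i _ => ?_
  have hS : ∑ j, r j = r i + ∑ j ∈ Finset.univ.erase i, r j :=
    (Finset.add_sum_erase _ _ (Finset.mem_univ i)).symm
  have hQ : ∑ j, r j * r j = r i * r i + ∑ j ∈ Finset.univ.erase i, r j * r j :=
    (Finset.add_sum_erase _ (fun j => r j * r j) (Finset.mem_univ i)).symm
  have hle := sum_mul_self_le_mul_self_sum (Finset.univ.erase i) hr
  have hT : 0 ≤ ∑ j ∈ Finset.univ.erase i, r j := Finset.sum_nonneg fun j _ => hr j
  rw [hS, hQ]
  generalize ∑ j ∈ Finset.univ.erase i, r j = T at *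
  generalize ∑ j ∈ Finset.univ.erase i, r j * r j = Q at *
  have h1 : f i * l i * (r i * r i) * (r i + T - r i) ≤ f i * (r i * T) := by
    calc f i * l i * (r i * r i) * (r i + T - r i) = f i * (r i * T) * (l i * r i) := by ring
      _ ≤ f i * (r i * T) * 1 :=
        mul_le_mul_of_nonneg_left (hlr i) (mul_nonneg (hf i) (mul_nonneg (hr i) hT))
      _ = _ := mul_one _
  have h2 : f i * (2 * (r i * T)) ≤ f i * ((r i + T) * (r i + T) - (r i * r i + Q)) :=
    mul_le_mul_of_nonneg_left (by nlinarith) (hf i)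
  linarith

theorem sum_resolvent_le {x l : Fin m → ℝ} (hlx : ∀ i, l i ≤ x i) (hx : ∀ i, 0 < x i)
    {t : ℝ} (ht : 0 < t) :
    ∑ i, l i * ((t + x i)⁻¹ * (t + x i)⁻¹) + (∑ i, l i * (t + x i)⁻¹) * ∑ i, (t + x i)⁻¹ ≤
      2 * ∑ i, x i * (t + x i)⁻¹ ^ 2 + (m - 1) * ∑ i, (t + x i)⁻¹ -
        t * ((∑ i, (t + x i)⁻¹) * (∑ i, (t + x i)⁻¹) - ∑ i, (t + x i)⁻¹ * (t + x i)⁻¹) := by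
  have hr : ∀ i, 0 < (t + x i)⁻¹ := fun i => inv_pos.2 (by linarith [hx i])
  have h1 : ∀ i, x i * (t + x i)⁻¹ = 1 - t * (t + x i)⁻¹ := fun i => by
    have : t + x i ≠ 0 := by linarith [hx i]
    field_simp; ring
  have e1 : ∑ i, l i * ((t + x i)⁻¹ * (t + x i)⁻¹) ≤ ∑ i, x i * (t + x i)⁻¹ ^ 2 := by
    refine Finset.sum_le_sum fun i _ => ?_
    have := mul_le_mul_of_nonneg_right (hlx i) (mul_pos (hr i) (hr i)).le
    rwa [sq]
  have e2 : ∑ i, l i * (t + x i)⁻¹ ≤ ∑ i, (1 - t * (t + x i)⁻¹) :=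
    Finset.sum_le_sum fun i _ => by
      rw [← h1]; exact mul_le_mul_of_nonneg_right (hlx i) (hr i).le
  have e3 : ∑ i, x i * (t + x i)⁻¹ ^ 2 =
      ∑ i, (t + x i)⁻¹ - t * ∑ i, (t + x i)⁻¹ * (t + x i)⁻¹ := by
    rw [Finset.mul_sum, ← Finset.sum_sub_distrib]
    refine Finset.sum_congr rfl fun i _ => ?_
    rw [sq, ← mul_assoc, h1]; ring
  have hS : 0 ≤ ∑ i, (t + x i)⁻¹ := Finset.sum_nonneg fun i _ => (hr i).le
  rw [Finset.sum_sub_distrib, ← Finset.mul_sum] at e2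
  simp only [Finset.sum_const, Finset.card_univ, Fintype.card_fin, nsmul_eq_mul, mul_one] at e2
  have e4 := mul_le_mul_of_nonneg_right e2 hS
  generalize ∑ i, (t + x i)⁻¹ = S at *
  generalize ∑ i, (t + x i)⁻¹ * (t + x i)⁻¹ = Q at *
  nlinarith

/-- The divergence of `X (XᵀX + ε)^(a-1)` is at least the numerator of the shrinkage factor: both
terms that the regularization adds are nonnegative. -/
theorem shrinkNum_le_sum_powFieldDeriv (ha : 0 < a) (ha1 : a < 1) (hε : 0 < ε)
    (X : Fin n → Fin m → ℝ) :
    shrinkNum a ε ((n : ℝ) - m - 1 + 2 * a) X ≤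
      ∑ i, ∑ j, powFieldDeriv a ε X (unitMat i j) i j := by
  obtain ⟨V, l, hV, hV', hl, h⟩ := exists_gram_spectral X
  have hx : ∀ i, 0 < ε + l i := fun i => by linarith [hl i]
  have htr : (powInt a ε X).trace = ∑ i, stieltjes a (ε + l i) := by
    rw [powInt_eq ha ha1 hε hV hV' hl h, trace_conj hV]
  set q : ℝ → ℝ := fun t => ∑ i, l i * ((t + (ε + l i))⁻¹ * (t + (ε + l i))⁻¹) +
    (∑ i, l i * (t + (ε + l i))⁻¹) * ∑ i, (t + (ε + l i))⁻¹ with hq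
  -- The divergence as a single integral.
  have h1 : ∑ i, ∑ j, powFieldDeriv a ε X (unitMat i j) i j =
      n * (powInt a ε X).trace + ∑ i, ∑ j, ∑ k, X i k * powIntDeriv a ε X (unitMat i j) k j := by
    simp only [powFieldDeriv, Matrix.add_apply, Finset.sum_add_distrib]
    congr 1
    have : ∀ (i : Fin n) (j : Fin m), (Matrix.of (unitMat i j) * powInt a ε X) i j = powInt a ε X j j := by
      intro i j
      have := mul_single_mul_apply (1 : Matrix (Fin n) (Fin n) ℝ) (powInt a ε X) i j i j
      rwa [Matrix.one_mul, Matrix.one_apply_eq, one_mul, ← of_unitMat] at this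
    simp only [this, Finset.sum_const, Finset.card_univ, Fintype.card_fin, nsmul_eq_mul]
    rfl
  have h2 : ∑ i, ∑ j, ∑ k, X i k * powIntDeriv a ε X (unitMat i j) k j =
      ∫ t in Ioi (0 : ℝ), ∑ i, ∑ j, ∑ k, X i k *
        (t ^ (a - 1) * gramResolventDeriv X (unitMat i j) (t + ε) k j) := by
    have hi := fun i j k => Integrable.const_mul
      (integrableOn_powIntDeriv_integrand ha ha1 hε X (unitMat i j) k j) (X i k)
    rw [integral_finsetSum _ fun i _ => integrable_finsetSum _ fun j _ =>
      integrable_finsetSum _ fun k _ => hi i j k]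
    refine Finset.sum_congr rfl fun i _ => ?_
    rw [integral_finsetSum _ fun j _ => integrable_finsetSum _ fun k _ => hi i j k]
    refine Finset.sum_congr rfl fun j _ => ?_
    rw [integral_finsetSum _ fun k _ => hi i j k]
    refine Finset.sum_congr rfl fun k _ => ?_
    rw [integral_const_mul]; rfl
  have h3 : ∑ i, ∑ j, ∑ k, X i k * powIntDeriv a ε X (unitMat i j) k j =
      ∫ t in Ioi (0 : ℝ), -(t ^ (a - 1) * q t) := by
    rw [h2]
    refine setIntegral_congr_fun measurableSet_Ioi fun t ht => ?_
    have ht0 : 0 < t := ht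
    have := sum_mul_gramResolventDeriv_unitMat hV hV' hl h (t := t + ε) (by linarith)
    simp only [add_assoc] at this
    rw [← mul_neg, ← this]
    simp only [Matrix.mul_apply, Finset.mul_sum, Matrix.of_apply]
    refine Finset.sum_congr rfl fun i _ => Finset.sum_congr rfl fun j _ =>
      Finset.sum_congr rfl fun k _ => by ring
  -- The three integrals on the other side.
  have i1 : IntegrableOn (fun t : ℝ => 2 * ∑ i, t ^ (a - 1) *
      ((ε + l i) * (t + (ε + l i))⁻¹ ^ 2)) (Ioi 0) := by
    refine Integrable.const_mul (integrable_finsetSum _ fun i _ => ?_) 2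
    refine IntegrableOn.congr_fun (Integrable.const_mul
      (integrableOn_rpow_mul_inv_mul_inv ha ha1 (hx i) (hx i)) (ε + l i))
      (fun t _ => ?_) measurableSet_Ioi
    ring
  have i2 : IntegrableOn (fun t : ℝ => ((m : ℝ) - 1) * ∑ i, t ^ (a - 1) *
      (t + (ε + l i))⁻¹) (Ioi 0) :=
    Integrable.const_mul (integrable_finsetSum _ fun i _ =>
      integrableOn_rpow_mul_inv ha ha1 (hx i)) _
  have i3 := integrableOn_pairInt_integrand ha ha1 hε X
  have i4 : IntegrableOn (fun t : ℝ => t ^ (a - 1) * q t) (Ioi 0) := by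
    have e : ∀ t : ℝ, t ^ (a - 1) * q t = ∑ i, l i * (t ^ (a - 1) *
        ((t + (ε + l i))⁻¹ * (t + (ε + l i))⁻¹)) + ∑ i, ∑ j, l i * (t ^ (a - 1) *
        ((t + (ε + l i))⁻¹ * (t + (ε + l j))⁻¹)) := fun t => by
      rw [hq]
      dsimp only
      rw [Finset.sum_mul_sum]
      simp only [mul_add, Finset.mul_sum]
      congr 1
      · exact Finset.sum_congr rfl fun i _ => by ring
      · exact Finset.sum_congr rfl fun i _ => Finset.sum_congr rfl fun j _ => by ring
    simp_rw [e]
    exact (integrable_finsetSum _ fun i _ => Integrable.const_mul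
      (integrableOn_rpow_mul_inv_mul_inv ha ha1 (hx i) (hx i)) _).add
      (integrable_finsetSum _ fun i _ => integrable_finsetSum _ fun j _ => Integrable.const_mul
      (integrableOn_rpow_mul_inv_mul_inv ha ha1 (hx i) (hx j)) _)
  have h4 : ∫ t in Ioi (0 : ℝ), t ^ (a - 1) * q t ≤
      ∫ t in Ioi (0 : ℝ), (2 * ∑ i, t ^ (a - 1) * ((ε + l i) * (t + (ε + l i))⁻¹ ^ 2) +
        ((m : ℝ) - 1) * ∑ i, t ^ (a - 1) * (t + (ε + l i))⁻¹ -
        t ^ a * pairTrace (gramResolvent X (t + ε))) := by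
    refine setIntegral_mono_on i4 ((i1.add i2).sub i3) measurableSet_Ioi fun t ht => ?_
    have ht0 : 0 < t := ht
    rw [gramResolvent_add_eq hV hV' hl h hε ht0, pairTrace_conj hV]
    have hta : t ^ a = t ^ (a - 1) * t := by
      rw [← Real.rpow_add_one ht0.ne']; ring_nf
    have := mul_le_mul_of_nonneg_left
      (sum_resolvent_le (x := fun i => ε + l i) (l := l) (fun i => by linarith) hx ht0)
      (Real.rpow_nonneg ht0.le (a - 1))
    refine this.trans_eq ?_
    rw [hta, ← Finset.mul_sum, ← Finset.mul_sum]
    ring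
  have h5 : ∫ t in Ioi (0 : ℝ), (2 * ∑ i, t ^ (a - 1) * ((ε + l i) * (t + (ε + l i))⁻¹ ^ 2) +
        ((m : ℝ) - 1) * ∑ i, t ^ (a - 1) * (t + (ε + l i))⁻¹ -
        t ^ a * pairTrace (gramResolvent X (t + ε))) =
      2 * ∑ i, (1 - a) * stieltjes a (ε + l i) + ((m : ℝ) - 1) * ∑ i, stieltjes a (ε + l i) -
        pairInt a ε X := by
    have i1' : ∀ i ∈ Finset.univ, IntegrableOn (fun t : ℝ => t ^ (a - 1) *
      ((ε + l i) * (t + (ε + l i))⁻¹ ^ 2)) (Ioi 0) := fun i _ => by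
      refine IntegrableOn.congr_fun (Integrable.const_mul
        (integrableOn_rpow_mul_inv_mul_inv ha ha1 (hx i) (hx i)) (ε + l i))
        (fun t _ => ?_) measurableSet_Ioi
      ring
    have i12 : IntegrableOn (fun t : ℝ => 2 * ∑ i, t ^ (a - 1) *
        ((ε + l i) * (t + (ε + l i))⁻¹ ^ 2) +
        ((m : ℝ) - 1) * ∑ i, t ^ (a - 1) * (t + (ε + l i))⁻¹) (Ioi 0) := i1.add i2
    rw [integral_sub i12 i3, integral_add i1 i2, integral_const_mul, integral_const_mul,
      integral_finsetSum _ i1',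
      integral_finsetSum _ fun i _ => integrableOn_rpow_mul_inv ha ha1 (hx i)]
    simp only [integral_rpow_mul_inv_sq ha ha1 (hx _)]
    rfl
  rw [h1, h3, integral_neg, shrinkNum, htr]
  rw [h5, ← Finset.mul_sum] at h4
  nlinarith

theorem pairInt_nonneg (hε : 0 < ε) (X : Fin n → Fin m → ℝ) : 0 ≤ pairInt a ε X := by
  obtain ⟨V, l, hV, hV', hl, h⟩ := exists_gram_spectral X
  rw [pairInt_eq hε hV hV' hl h]
  refine setIntegral_nonneg measurableSet_Ioi fun t ht => ?_
  have ht0 : 0 < t := ht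
  refine mul_nonneg (Real.rpow_nonneg ht0.le _) (sub_nonneg.2 ?_)
  exact sum_mul_self_le_mul_self_sum _ fun i => inv_nonneg.2 (by linarith [hl i])

theorem neg_le_pairIntDeriv_powField (ha : 0 < a) (ha1 : a < 1) (hε : 0 < ε)
    (X : Fin n → Fin m → ℝ) :
    -(2 * (powInt a ε X).trace * pairInt a ε X) ≤ pairIntDeriv a ε X (powField a ε X) := by
  obtain ⟨V, l, hV, hV', hl, h⟩ := exists_gram_spectral X
  have hx : ∀ i, 0 < ε + l i := fun i => by linarith [hl i]
  rw [pairInt, pairIntDeriv, ← integral_const_mul, ← integral_neg]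
  refine setIntegral_mono_on ((integrableOn_pairInt_integrand ha ha1 hε X).const_mul _).neg
    (integrableOn_pairIntDeriv_integrand ha ha1 hε X _) measurableSet_Ioi fun t ht => ?_
  have ht0 : 0 < t := ht
  rw [gramResolventDeriv_powField ha ha1 hε hV hV' hl h ht0,
    gramResolvent_add_eq hV hV' hl h hε ht0, pairTrace_conj hV, pairTraceDeriv, conj_mul_conj hV,
    trace_conj hV, trace_conj hV, trace_conj hV, powInt_eq ha ha1 hε hV hV' hl h, trace_conj hV]
  have key := two_mul_sum_le_sum_mul_pair (f := fun i => stieltjes a (ε + l i)) (l := l)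
    (r := fun i => (t + (ε + l i))⁻¹) (fun i => (stieltjes_pos ha ha1 (hx i)).le)
    (fun i => inv_nonneg.2 (by linarith [hl i])) (fun i => by
      rw [mul_inv_le_iff₀ (by linarith [hl i])]; linarith)
  have e : (∑ i, (t + (ε + l i))⁻¹) * (∑ i, -2 * (stieltjes a (ε + l i) * l i) *
      ((t + (ε + l i))⁻¹ * (t + (ε + l i))⁻¹)) - ∑ i, (t + (ε + l i))⁻¹ *
      (-2 * (stieltjes a (ε + l i) * l i) * ((t + (ε + l i))⁻¹ * (t + (ε + l i))⁻¹)) =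
      -(2 * ∑ i, stieltjes a (ε + l i) * l i * ((t + (ε + l i))⁻¹ * (t + (ε + l i))⁻¹) *
        ((∑ j, (t + (ε + l j))⁻¹) - (t + (ε + l i))⁻¹)) := by
    rw [Finset.mul_sum, Finset.mul_sum, ← Finset.sum_sub_distrib, ← Finset.sum_neg_distrib]
    exact Finset.sum_congr rfl fun i _ => by ring
  rw [e]
  have := mul_le_mul_of_nonneg_left key (Real.rpow_nonneg ht0.le a)
  nlinarith

theorem shrinkDen_pos (ha : 0 < a) (ha1 : a < 1) (hε : 0 < ε) (hm : 0 < m)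
    (X : Fin n → Fin m → ℝ) : 0 < shrinkDen a ε X := by
  obtain ⟨V, l, hV, hV', hl, h⟩ := exists_gram_spectral X
  have hx : ∀ i, 0 < ε + l i := fun i => by linarith [hl i]
  rw [shrinkDen_eq ha ha1 hε hV hV' hl h]
  exact Finset.sum_pos (fun i _ => mul_pos (pow_pos (stieltjes_pos ha ha1 (hx i)) 2) (hx i))
    ⟨⟨0, hm⟩, Finset.mem_univ _⟩

/-- The unbiased estimate of the difference between the risk of the regularized estimator and the
risk of `X` is nonpositive at every observation. -/
theorem sum_sq_sureField_add_le_zero (ha : 0 < a) (ha1 : a ≤ 1 / 2) (hε : 0 < ε)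
    (hk : 4 * (1 - a) ≤ (n : ℝ) - m - 1 + 2 * a) (X : Fin n → Fin m → ℝ) :
    ∑ i, ∑ j, (sureField a ε ((n : ℝ) - m - 1 + 2 * a) X i j ^ 2 +
      2 * sureFieldDeriv a ε ((n : ℝ) - m - 1 + 2 * a) X (unitMat i j) i j) ≤ 0 := by
  rcases Nat.eq_zero_or_pos m with rfl | hm
  · simp
  have ha1' : a < 1 := by linarith
  have hC := shrinkDen_pos (n := n) ha ha1' hε hm X
  have hdiv := shrinkNum_le_sum_powFieldDeriv ha ha1' hε X
  have hK := pairInt_nonneg (a := a) hε X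
  have hdK := neg_le_pairIntDeriv_powField ha ha1' hε X
  obtain ⟨V, l, hV, hV', hl, h⟩ := exists_gram_spectral X
  have hx : ∀ i, 0 < ε + l i := fun i => by linarith [hl i]
  have hf : ∀ i, 0 < stieltjes a (ε + l i) := fun i => stieltjes_pos ha ha1' (hx i)
  have hB : (powInt a ε X).trace = ∑ i, stieltjes a (ε + l i) := by
    rw [powInt_eq ha ha1' hε hV hV' hl h, trace_conj hV]
  have hdB : (powIntDeriv a ε X (powField a ε X)).trace =
      ∑ i, -2 * (1 - a) * stieltjes a (ε + l i) ^ 2 * (l i / (ε + l i)) := by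
    rw [powIntDeriv_powField ha ha1' hε hV hV' hl h, trace_conj hV]
  have hCe := shrinkDen_eq ha ha1' hε hV hV' hl h
  have hdC := shrinkDenDeriv_powField ha ha1' hε hV hV' hl h
  have hY := sum_sq_powField ha ha1' hε hV hV' hl h
  have hsplit : ∑ i, ∑ j, (sureField a ε ((n : ℝ) - m - 1 + 2 * a) X i j ^ 2 +
      2 * sureFieldDeriv a ε ((n : ℝ) - m - 1 + 2 * a) X (unitMat i j) i j) =
      shrinkFactor a ε ((n : ℝ) - m - 1 + 2 * a) X ^ 2 * ∑ i, ∑ j, powField a ε X i j ^ 2 -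
      2 * (shrinkFactor a ε ((n : ℝ) - m - 1 + 2 * a) X *
        ∑ i, ∑ j, powFieldDeriv a ε X (unitMat i j) i j) -
      2 * shrinkFactorDeriv a ε ((n : ℝ) - m - 1 + 2 * a) X (powField a ε X) := by
    rw [← sum_mul_shrinkFactorDeriv_unitMat ha ha1' hε]
    simp only [Finset.mul_sum, ← Finset.sum_sub_distrib, sureField, sureFieldDeriv]
    exact Finset.sum_congr rfl fun i _ => Finset.sum_congr rfl fun j _ => by ring
  set k : ℝ := (n : ℝ) - m - 1 + 2 * a with hkdef
  rw [hsplit, shrinkFactor, shrinkFactorDeriv, shrinkNumDeriv]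
  have hYC : ∑ i, ∑ j, powField a ε X i j ^ 2 ≤ shrinkDen a ε X := by
    rw [hY, hCe]
    refine Finset.sum_le_sum fun i _ => mul_le_mul_of_nonneg_left ?_ (by positivity)
    linarith
  have hdC0 : shrinkDenDeriv a ε X (powField a ε X) ≤ 0 := by
    rw [hdC]
    refine Finset.sum_nonpos fun i _ => mul_nonpos_of_nonpos_of_nonneg (by linarith) ?_
    exact mul_nonneg (pow_pos (hf i) 3).le (hl i)
  have hB0 : 0 ≤ (powInt a ε X).trace := by
    rw [hB]; exact Finset.sum_nonneg fun i _ => (hf i).le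
  have hk0 : 0 ≤ k := by linarith
  have hdB1 : -(2 * (1 - a) * (powInt a ε X).trace ^ 2) ≤
      (powIntDeriv a ε X (powField a ε X)).trace := by
    have e1 : ∑ i, stieltjes a (ε + l i) * stieltjes a (ε + l i) ≤ (powInt a ε X).trace ^ 2 := by
      rw [hB, sq]; exact sum_mul_self_le_mul_self_sum _ fun i => (hf i).le
    have e2 : -(2 * (1 - a) * ∑ i, stieltjes a (ε + l i) * stieltjes a (ε + l i)) ≤
        (powIntDeriv a ε X (powField a ε X)).trace := by
      rw [hdB, Finset.mul_sum, ← Finset.sum_neg_distrib]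
      refine Finset.sum_le_sum fun i _ => ?_
      have h1 : l i / (ε + l i) ≤ 1 := (div_le_one (hx i)).2 (by linarith)
      have h2 : 0 ≤ 2 * (1 - a) * stieltjes a (ε + l i) ^ 2 := by
        have : 0 ≤ 1 - a := by linarith
        positivity
      have h3 := mul_le_mul_of_nonneg_left h1 h2
      linarith
    have h4 : 0 ≤ 2 * (1 - a) := by linarith
    nlinarith [mul_le_mul_of_nonneg_left e1 h4]
  have hNe : shrinkNum a ε k X = k * (powInt a ε X).trace + pairInt a ε X := rfl
  generalize shrinkDenDeriv a ε X (powField a ε X) = dC at *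
  generalize (powIntDeriv a ε X (powField a ε X)).trace = dB at *
  generalize pairIntDeriv a ε X (powField a ε X) = dK at *
  generalize ∑ i, ∑ j, powFieldDeriv a ε X (unitMat i j) i j = Dv at *
  generalize ∑ i, ∑ j, powField a ε X i j ^ 2 = Y2 at *
  generalize shrinkDen a ε X = C at *
  generalize (powInt a ε X).trace = B at *
  generalize pairInt a ε X = K at *
  have hN0 : 0 ≤ shrinkNum a ε k X := by rw [hNe]; positivity
  generalize shrinkNum a ε k X = N at *
  -- `N² + 2 dN ≥ 0`, where `dN = k dB + dK`.
  have hkey : 0 ≤ N ^ 2 + 2 * (k * dB + dK) := by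
    have h1 := mul_le_mul_of_nonneg_left hdB1 hk0
    have h2 : 0 ≤ k * B ^ 2 * (k - 4 * (1 - a)) :=
      mul_nonneg (by positivity) (by linarith)
    have h3 : 0 ≤ B * K * (k - 2) := mul_nonneg (by positivity) (by linarith)
    rw [hNe]
    nlinarith [sq_nonneg K]
  have hNC : 0 ≤ N / C := by positivity
  have t1 : (N / C) ^ 2 * Y2 ≤ N ^ 2 / C := by
    calc (N / C) ^ 2 * Y2 ≤ (N / C) ^ 2 * C := by gcongr
      _ = N ^ 2 / C := by field_simp
  have t2 : N ^ 2 / C ≤ N / C * Dv := by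
    calc N ^ 2 / C = N / C * N := by ring
      _ ≤ _ := by gcongr
  have t3 : N * dC / C ^ 2 ≤ 0 :=
    div_nonpos_of_nonpos_of_nonneg (mul_nonpos_of_nonneg_of_nonpos hN0 hdC0) (by positivity)
  have t4 : 0 ≤ (N ^ 2 + 2 * (k * dB + dK)) / C := by positivity
  rw [add_div, mul_div_assoc] at t4
  linarith

end Inequality

/-! ### The Gaussian model: density, moments, integration by parts -/

theorem pi_withDensity_ofReal {ι : Type*} [Fintype ι] {α : ι → Type*} [∀ i, MeasurableSpace (α i)]
    (μ : ∀ i, Measure (α i)) [∀ i, SigmaFinite (μ i)] (f : ∀ i, α i → ℝ)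
    (hf0 : ∀ i x, 0 ≤ f i x) (hf : ∀ i, Integrable (f i) (μ i)) :
    Measure.pi (fun i => (μ i).withDensity fun x => ENNReal.ofReal (f i x)) =
      (Measure.pi μ).withDensity fun x => ENNReal.ofReal (∏ i, f i (x i)) := by
  have : ∀ i, IsFiniteMeasure ((μ i).withDensity fun x => ENNReal.ofReal (f i x)) := fun i =>
    isFiniteMeasure_withDensity_ofReal (hf i).2
  refine Measure.pi_eq fun s hs => ?_
  rw [withDensity_apply _ (MeasurableSet.univ_pi hs), Measure.restrict_pi_pi]
  have hint : Integrable (fun x : ∀ i, α i => ∏ i, f i (x i))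
      (Measure.pi fun i => (μ i).restrict (s i)) :=
    Integrable.fintype_prod_dep fun i => (hf i).mono_measure Measure.restrict_le_self
  rw [← ofReal_integral_eq_lintegral_ofReal hint
    (Eventually.of_forall fun x => Finset.prod_nonneg fun i _ => hf0 i _),
    integral_fintype_prod_eq_prod, ENNReal.ofReal_prod_of_nonneg
      fun i _ => integral_nonneg (hf0 i)]
  refine Finset.prod_congr rfl fun i _ => ?_
  rw [withDensity_apply _ (hs i), ofReal_integral_eq_lintegral_ofReal
    ((hf i).mono_measure Measure.restrict_le_self) (Eventually.of_forall (hf0 i))]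

/-- The density of `gaussianLaw M`. -/
noncomputable def gaussianDensity (M X : Fin n → Fin m → ℝ) : ℝ :=
  ∏ i, ∏ j, gaussianPDFReal (M i j) 1 (X i j)

theorem gaussianDensity_pos (M X : Fin n → Fin m → ℝ) : 0 < gaussianDensity M X :=
  Finset.prod_pos fun _ _ => Finset.prod_pos fun _ _ => gaussianPDFReal_pos _ _ _ one_ne_zero

theorem gaussianLaw_eq_withDensity (M : Fin n → Fin m → ℝ) :
    gaussianLaw M = volume.withDensity fun X => ENNReal.ofReal (gaussianDensity M X) := by
  have h1 : ∀ i, (Measure.pi fun j => gaussianReal (M i j) 1) =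
      (volume : Measure (Fin m → ℝ)).withDensity
        fun x => ENNReal.ofReal (∏ j, gaussianPDFReal (M i j) 1 (x j)) := by
    intro i
    rw [volume_pi, ← pi_withDensity_ofReal _ (fun j x => gaussianPDFReal (M i j) 1 x)
      (fun j x => gaussianPDFReal_nonneg _ _ _) (fun j => integrable_gaussianPDFReal _ _)]
    congr 1
    funext j
    rw [gaussianReal_of_var_ne_zero _ one_ne_zero]; rfl
  unfold gaussianLaw
  simp_rw [h1]
  exact pi_withDensity_ofReal (fun _ => (volume : Measure (Fin m → ℝ)))
    (fun i x => ∏ j, gaussianPDFReal (M i j) 1 (x j))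
    (fun i x => Finset.prod_nonneg fun j _ => gaussianPDFReal_nonneg _ _ _)
    (fun i => Integrable.fintype_prod fun j => integrable_gaussianPDFReal _ _)

theorem measurable_gaussianDensity (M : Fin n → Fin m → ℝ) : Measurable (gaussianDensity M) := by
  unfold gaussianDensity
  refine Finset.measurable_prod _ fun i _ => Finset.measurable_prod _ fun j _ => ?_
  exact (measurable_gaussianPDFReal _ _).comp (by fun_prop)

theorem gaussianLaw_absolutelyContinuous (M : Fin n → Fin m → ℝ) : gaussianLaw M ≪ volume := by
  rw [gaussianLaw_eq_withDensity]
  exact withDensity_absolutelyContinuous _ _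

theorem integrable_gaussianLaw_iff (M : Fin n → Fin m → ℝ) (f : (Fin n → Fin m → ℝ) → ℝ) :
    Integrable f (gaussianLaw M) ↔ Integrable (fun X => f X * gaussianDensity M X) := by
  rw [gaussianLaw_eq_withDensity, integrable_withDensity_iff
    (measurable_gaussianDensity M).ennreal_ofReal (Eventually.of_forall fun _ =>
      ENNReal.ofReal_lt_top)]
  simp only [ENNReal.toReal_ofReal (gaussianDensity_pos M _).le]

theorem integral_gaussianLaw (M : Fin n → Fin m → ℝ) (f : (Fin n → Fin m → ℝ) → ℝ) :
    ∫ X, f X ∂(gaussianLaw M) = ∫ X, f X * gaussianDensity M X := by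
  rw [gaussianLaw_eq_withDensity, integral_withDensity_eq_integral_toReal_smul
    (measurable_gaussianDensity M).ennreal_ofReal (Eventually.of_forall fun _ =>
      ENNReal.ofReal_lt_top)]
  simp only [ENNReal.toReal_ofReal (gaussianDensity_pos M _).le, smul_eq_mul, mul_comm]

theorem hasLineDerivAt_gaussianDensity (M X : Fin n → Fin m → ℝ) (i : Fin n) (j : Fin m) :
    HasLineDerivAt ℝ (gaussianDensity M) (-(X i j - M i j) * gaussianDensity M X) X
      (unitMat i j) := by
  have hexp : ∀ X, gaussianDensity M X =
      (∏ _i : Fin n, ∏ _j : Fin m, (√(2 * Real.pi * 1))⁻¹) *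
        Real.exp (∑ i, ∑ j, -(X i j - M i j) ^ 2 / (2 * 1)) := by
    intro X
    simp only [gaussianDensity, gaussianPDFReal, Real.exp_sum, Finset.prod_mul_distrib,
      NNReal.coe_one]
  have h1 : HasDerivAt (fun τ : ℝ => ∑ k, ∑ l,
      -((X + τ • unitMat i j) k l - M k l) ^ 2 / (2 * 1)) (-(X i j - M i j)) 0 := by
    have h2 : ∀ k l, HasDerivAt (fun τ : ℝ => -((X + τ • unitMat i j) k l - M k l) ^ 2 / (2 * 1))
        (-(X k l - M k l) * unitMat i j k l) 0 := by
      intro k l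
      have h3 : HasDerivAt (fun τ : ℝ => X k l + τ * unitMat i j k l - M k l)
          (unitMat i j k l) 0 := by
        simpa using (((hasDerivAt_id (0 : ℝ)).mul_const (unitMat i j k l)).const_add
          (X k l)).sub_const (M k l)
      convert! ((h3.pow 2).neg).div_const (2 * 1) using 1
      simp; ring
    refine (HasDerivAt.fun_sum fun k _ => HasDerivAt.fun_sum fun l _ => h2 k l).congr_deriv ?_
    simp [unitMat, Pi.single_apply, ite_apply]
  rw [HasLineDerivAt]
  simp_rw [hexp]
  refine (h1.exp.const_mul _).congr_deriv ?_
  simp only [zero_smul, add_zero]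
  ring

/-- Stein's identity: integration by parts against the Gaussian law. -/
theorem integral_sub_mul_gaussianLaw (M : Fin n → Fin m → ℝ) {f f' : (Fin n → Fin m → ℝ) → ℝ}
    {i : Fin n} {j : Fin m} (hd : ∀ X, HasLineDerivAt ℝ f (f' X) X (unitMat i j))
    (hf : Integrable f (gaussianLaw M)) (hf' : Integrable f' (gaussianLaw M))
    (hXf : Integrable (fun X => (X i j - M i j) * f X) (gaussianLaw M)) :
    ∫ X, (X i j - M i j) * f X ∂(gaussianLaw M) = ∫ X, f' X ∂(gaussianLaw M) := by
  rw [integrable_gaussianLaw_iff] at hf hf' hXf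
  rw [integral_gaussianLaw, integral_gaussianLaw]
  have e : ∀ X : Fin n → Fin m → ℝ, (X i j - M i j) * f X * gaussianDensity M X =
      -(f X * (-(X i j - M i j) * gaussianDensity M X)) := fun X => by ring
  have h := integral_bilinear_hasLineDerivAt_right_eq_neg_left_of_integrable
    (μ := (volume : Measure (Fin n → Fin m → ℝ)))
    (f := f) (f' := f') (g := gaussianDensity M)
    (g' := fun X => -(X i j - M i j) * gaussianDensity M X)
    (B := ContinuousLinearMap.mul ℝ ℝ) (v := unitMat i j) hf'
    (by
      refine hXf.neg.congr (Eventually.of_forall fun X => ?_)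
      simp only [Pi.neg_apply, ContinuousLinearMap.mul_apply']; ring)
    hf (fun X _ => hd X) (fun X _ => hasLineDerivAt_gaussianDensity M X i j)
  simp only [ContinuousLinearMap.mul_apply'] at h
  simp_rw [e]
  rw [integral_neg, h, neg_neg]

theorem isGaussian_pi {ι : Type*} [Fintype ι] {E : ι → Type*}
    [∀ i, NormedAddCommGroup (E i)] [∀ i, NormedSpace ℝ (E i)] [∀ i, MeasurableSpace (E i)]
    [∀ i, BorelSpace (E i)] [∀ i, SecondCountableTopology (E i)] [∀ i, CompleteSpace (E i)]
    (μ : ∀ i, Measure (E i)) [∀ i, IsGaussian (μ i)] : IsGaussian (Measure.pi μ) := by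
  have h := iIndepFun.hasGaussianLaw (P := Measure.pi μ) (X := fun i (x : ∀ i, E i) => x i)
    (fun i => ⟨by
      have := (measurePreserving_eval μ i).map_eq
      change IsGaussian ((Measure.pi μ).map (Function.eval i))
      rw [this]; infer_instance⟩)
    (iIndepFun_pi (X := fun i (x : E i) => x) fun i => aemeasurable_id)
  have h2 := h.isGaussian_map
  simpa using h2

instance (M : Fin n → Fin m → ℝ) : IsGaussian (gaussianLaw M) := by
  unfold gaussianLaw
  have : ∀ i, IsGaussian (Measure.pi fun j => gaussianReal (M i j) 1) := fun i => isGaussian_pi _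
  exact isGaussian_pi _

theorem integrable_one_add_norm_pow (M : Fin n → Fin m → ℝ) (k : ℕ) :
    Integrable (fun X => (1 + ‖X‖) ^ k) (gaussianLaw M) := by
  have h : MemLp (fun X : Fin n → Fin m → ℝ => 1 + ‖X‖) k (gaussianLaw M) :=
    (memLp_const (1 : ℝ)).add (IsGaussian.memLp_id (gaussianLaw M) k (by simp)).norm
  refine (h.integrable_norm_pow').congr (Eventually.of_forall fun X => ?_)
  simp only
  rw [Real.norm_of_nonneg (by positivity)]

theorem integral_sub_sq_gaussianLaw (M : Fin n → Fin m → ℝ) (i : Fin n) (j : Fin m) :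
    ∫ X, (X i j - M i j) ^ 2 ∂(gaussianLaw M) = 1 := by
  have h1 : MeasurePreserving (fun X : Fin n → Fin m → ℝ => X i j) (gaussianLaw M)
      (gaussianReal (M i j) 1) := by
    unfold gaussianLaw
    exact (measurePreserving_eval (fun j => gaussianReal (M i j) 1) j).comp
      (measurePreserving_eval (fun i => Measure.pi fun j => gaussianReal (M i j) 1) i)
  have h2 := integral_map (μ := gaussianLaw M) (φ := fun X : Fin n → Fin m → ℝ => X i j)
    h1.measurable.aemeasurable (f := fun x => (x - M i j) ^ 2) (by fun_prop)
  rw [← h2, h1.map_eq]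
  have h3 := variance_id_gaussianReal (μ := M i j) (v := 1)
  rw [variance_eq_integral aemeasurable_id] at h3
  simpa using h3

/-! ### Polynomial growth and the risk of the regularized estimator -/

/-- Functions of a matrix that are bounded by a polynomial in the norm. -/
def PolyGrowth (f : (Fin n → Fin m → ℝ) → ℝ) : Prop :=
  ∃ (C : ℝ) (k : ℕ), 0 ≤ C ∧ ∀ X, |f X| ≤ C * (1 + ‖X‖) ^ k

namespace PolyGrowth

variable {f g : (Fin n → Fin m → ℝ) → ℝ}

theorem of_le (hg : PolyGrowth g) (h : ∀ X, |f X| ≤ g X) : PolyGrowth f := by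
  obtain ⟨C, k, hC, hb⟩ := hg
  exact ⟨C, k, hC, fun X => (h X).trans ((le_abs_self _).trans (hb X))⟩

theorem const (c : ℝ) : PolyGrowth fun _ : Fin n → Fin m → ℝ => c :=
  ⟨|c|, 0, abs_nonneg _, fun X => by simp⟩

theorem norm : PolyGrowth fun X : Fin n → Fin m → ℝ => ‖X‖ :=
  ⟨1, 1, zero_le_one, fun X => by simp⟩

theorem apply (i : Fin n) (j : Fin m) : PolyGrowth fun X : Fin n → Fin m → ℝ => X i j :=
  norm.of_le fun X => abs_apply_le_norm X i j

theorem add (hf : PolyGrowth f) (hg : PolyGrowth g) : PolyGrowth fun X => f X + g X := by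
  obtain ⟨C, k, hC, hb⟩ := hf
  obtain ⟨C', k', hC', hb'⟩ := hg
  refine ⟨C + C', k + k', by positivity, fun X => (abs_add_le _ _).trans ?_⟩
  have h1 : (1 : ℝ) ≤ 1 + ‖X‖ := by linarith [norm_nonneg X]
  have h2 : (1 + ‖X‖) ^ k ≤ (1 + ‖X‖) ^ (k + k') := pow_le_pow_right₀ h1 (by omega)
  have h3 : (1 + ‖X‖) ^ k' ≤ (1 + ‖X‖) ^ (k + k') := pow_le_pow_right₀ h1 (by omega)
  nlinarith [hb X, hb' X, mul_le_mul_of_nonneg_left h2 hC, mul_le_mul_of_nonneg_left h3 hC']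

theorem mul (hf : PolyGrowth f) (hg : PolyGrowth g) : PolyGrowth fun X => f X * g X := by
  obtain ⟨C, k, hC, hb⟩ := hf
  obtain ⟨C', k', hC', hb'⟩ := hg
  refine ⟨C * C', k + k', by positivity, fun X => ?_⟩
  rw [abs_mul]
  refine (mul_le_mul (hb X) (hb' X) (abs_nonneg _) (by positivity)).trans_eq ?_
  ring

theorem neg (hf : PolyGrowth f) : PolyGrowth fun X => -f X := by
  obtain ⟨C, k, hC, hb⟩ := hf
  exact ⟨C, k, hC, fun X => by rw [abs_neg]; exact hb X⟩

theorem sub (hf : PolyGrowth f) (hg : PolyGrowth g) : PolyGrowth fun X => f X - g X := by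
  simpa only [sub_eq_add_neg] using hf.add hg.neg

theorem pow (hf : PolyGrowth f) (k : ℕ) : PolyGrowth fun X => f X ^ k := by
  induction k with
  | zero => simpa using const 1
  | succ k ih => simpa only [pow_succ] using ih.mul hf

theorem sum {ι : Type*} (s : Finset ι) {f : ι → (Fin n → Fin m → ℝ) → ℝ}
    (hf : ∀ i, PolyGrowth (f i)) : PolyGrowth fun X => ∑ i ∈ s, f i X := by
  classical
  induction s using Finset.induction_on with
  | empty => simpa using const 0
  | insert i s hi ih => simpa only [Finset.sum_insert hi] using (hf i).add ih

theorem integrable (hf : PolyGrowth f) (hm : Measurable f) (M : Fin n → Fin m → ℝ) :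
    Integrable f (gaussianLaw M) := by
  obtain ⟨C, k, hC, hb⟩ := hf
  exact Integrable.mono' ((integrable_one_add_norm_pow M k).const_mul C)
    hm.aestronglyMeasurable (Eventually.of_forall hb)

theorem matrix_mul {α β γ : Type*} [Fintype β] {f : (Fin n → Fin m → ℝ) → Matrix α β ℝ}
    {g : (Fin n → Fin m → ℝ) → Matrix β γ ℝ} (hf : ∀ i j, PolyGrowth fun X => f X i j)
    (hg : ∀ i j, PolyGrowth fun X => g X i j) (i : α) (j : γ) :
    PolyGrowth fun X => (f X * g X) i j := by
  simp only [Matrix.mul_apply]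
  exact sum _ fun k => (hf i k).mul (hg k j)

theorem trace {f : (Fin n → Fin m → ℝ) → Matrix (Fin m) (Fin m) ℝ}
    (hf : ∀ i j, PolyGrowth fun X => f X i j) : PolyGrowth fun X => (f X).trace :=
  sum _ fun i => hf i i

end PolyGrowth

theorem measurable_matrix_mul {α β γ : Type*} [Fintype β]
    {f : (Fin n → Fin m → ℝ) → Matrix α β ℝ}
    {g : (Fin n → Fin m → ℝ) → Matrix β γ ℝ} (hf : ∀ i j, Measurable fun X => f X i j)
    (hg : ∀ i j, Measurable fun X => g X i j) (i : α) (j : γ) :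
    Measurable fun X => (f X * g X) i j := by
  simp only [Matrix.mul_apply]
  exact Finset.measurable_sum _ fun k _ => (hf i k).mul (hg k j)

theorem measurable_matrix_trace {f : (Fin n → Fin m → ℝ) → Matrix (Fin m) (Fin m) ℝ}
    (hf : ∀ i j, Measurable fun X => f X i j) : Measurable fun X => (f X).trace :=
  Finset.measurable_sum _ fun i _ => hf i i

section

variable {a ε : ℝ}

theorem measurable_powInt (i j : Fin m) :
    Measurable fun X : Fin n → Fin m → ℝ => powInt a ε X i j :=
  measurable_integral_param (measurable_powInt_integrand a ε i j)

theorem measurable_powIntDeriv (H : Fin n → Fin m → ℝ) (i j : Fin m) :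
    Measurable fun X : Fin n → Fin m → ℝ => powIntDeriv a ε X H i j :=
  measurable_integral_param (measurable_powIntDeriv_integrand a ε H i j)

theorem measurable_pairInt : Measurable fun X : Fin n → Fin m → ℝ => pairInt a ε X :=
  measurable_integral_param (measurable_pairTrace_integrand a ε)

theorem measurable_pairIntDeriv (H : Fin n → Fin m → ℝ) :
    Measurable fun X : Fin n → Fin m → ℝ => pairIntDeriv a ε X H :=
  measurable_integral_param (measurable_pairTraceDeriv_integrand a ε H)

theorem measurable_gram_add (i j : Fin m) :
    Measurable fun X : Fin n → Fin m → ℝ => (gram X + ε • 1) i j :=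
  ((continuous_gram.add continuous_const).matrix_elem i j).measurable

theorem measurable_gramDeriv (H : Fin n → Fin m → ℝ) (i j : Fin m) :
    Measurable fun X : Fin n → Fin m → ℝ => gramDeriv X H i j :=
  ((continuous_gramDeriv H).matrix_elem i j).measurable

theorem measurable_of_apply (i : Fin n) (j : Fin m) :
    Measurable fun X : Fin n → Fin m → ℝ => Matrix.of X i j := by
  simp only [Matrix.of_apply]; fun_prop

theorem measurable_shrinkDen : Measurable fun X : Fin n → Fin m → ℝ => shrinkDen a ε X :=
  measurable_matrix_trace (measurable_matrix_mul
    (measurable_matrix_mul measurable_powInt measurable_gram_add) measurable_powInt)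

theorem measurable_shrinkDenDeriv (H : Fin n → Fin m → ℝ) :
    Measurable fun X : Fin n → Fin m → ℝ => shrinkDenDeriv a ε X H := by
  refine measurable_matrix_trace fun i j => ?_
  simp only [Matrix.add_apply (_ + _), Matrix.add_apply (_ * _ * _)]
  refine Measurable.add (Measurable.add ?_ ?_) ?_
  · exact measurable_matrix_mul (measurable_matrix_mul (measurable_powIntDeriv H)
      measurable_gram_add) measurable_powInt i j
  · exact measurable_matrix_mul (measurable_matrix_mul measurable_powInt
      (measurable_gramDeriv H)) measurable_powInt i j
  · exact measurable_matrix_mul (measurable_matrix_mul measurable_powInt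
      measurable_gram_add) (measurable_powIntDeriv H) i j

theorem measurable_shrinkNum (k : ℝ) :
    Measurable fun X : Fin n → Fin m → ℝ => shrinkNum a ε k X :=
  ((measurable_matrix_trace measurable_powInt).const_mul k).add measurable_pairInt

theorem measurable_shrinkNumDeriv (k : ℝ) (H : Fin n → Fin m → ℝ) :
    Measurable fun X : Fin n → Fin m → ℝ => shrinkNumDeriv a ε k X H :=
  ((measurable_matrix_trace (measurable_powIntDeriv H)).const_mul k).add
    (measurable_pairIntDeriv H)

theorem measurable_powField (i : Fin n) (j : Fin m) :
    Measurable fun X : Fin n → Fin m → ℝ => powField a ε X i j :=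
  measurable_matrix_mul measurable_of_apply measurable_powInt i j

theorem measurable_powFieldDeriv (H : Fin n → Fin m → ℝ) (i : Fin n) (j : Fin m) :
    Measurable fun X : Fin n → Fin m → ℝ => powFieldDeriv a ε X H i j := by
  simp only [powFieldDeriv, Matrix.add_apply]
  exact (measurable_matrix_mul (f := fun _ => Matrix.of H) (fun _ _ => measurable_const)
    measurable_powInt i j).add
    (measurable_matrix_mul measurable_of_apply (measurable_powIntDeriv H) i j)

theorem measurable_sureField_apply (k : ℝ) (i : Fin n) (j : Fin m) :
    Measurable fun X : Fin n → Fin m → ℝ => sureField a ε k X i j :=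
  (((measurable_shrinkNum k).div measurable_shrinkDen).mul (measurable_powField i j)).neg

theorem measurable_sureField (k : ℝ) :
    Measurable fun X : Fin n → Fin m → ℝ => sureField a ε k X :=
  measurable_pi_iff.2 fun i => measurable_pi_iff.2 fun j => measurable_sureField_apply k i j

theorem measurable_sureFieldDeriv_apply (k : ℝ) (H : Fin n → Fin m → ℝ) (i : Fin n) (j : Fin m) :
    Measurable fun X : Fin n → Fin m → ℝ => sureFieldDeriv a ε k X H i j :=
  (((((measurable_shrinkNumDeriv k H).div measurable_shrinkDen).sub
    (((measurable_shrinkNum k).mul (measurable_shrinkDenDeriv H)).div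
      (measurable_shrinkDen.pow_const 2))).mul (measurable_powField i j)).add
    (((measurable_shrinkNum k).div measurable_shrinkDen).mul
      (measurable_powFieldDeriv H i j))).neg

theorem polyGrowth_powInt (ha : 0 < a) (ha1 : a < 1) (hε : 0 < ε) (i j : Fin m) :
    PolyGrowth fun X : Fin n → Fin m → ℝ => powInt a ε X i j :=
  (PolyGrowth.const _).of_le fun X => abs_integral_param_le (φ := fun X t =>
    t ^ (a - 1) * gramResolvent X (t + ε) i j) X
    (fun t ht => abs_powInt_integrand_le hε X i j t ht) (integrableOn_rpow_mul_inv ha ha1 hε)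

theorem polyGrowth_powIntDeriv (ha : 0 < a) (ha1 : a < 1) (hε : 0 < ε) (H : Fin n → Fin m → ℝ)
    (i j : Fin m) : PolyGrowth fun X : Fin n → Fin m → ℝ => powIntDeriv a ε X H i j :=
  (((PolyGrowth.const (2 * n * m ^ 4 * ‖H‖)).mul .norm).mul (.const _)).of_le fun X =>
    abs_integral_param_le (φ := fun X t => t ^ (a - 1) * gramResolventDeriv X H (t + ε) i j) X
      (fun t ht => abs_powIntDeriv_integrand_le hε X H i j t ht)
      (integrableOn_rpow_mul_inv_mul_inv ha ha1 hε hε)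

theorem polyGrowth_pairInt (ha : 0 < a) (ha1 : a < 1) (hε : 0 < ε) :
    PolyGrowth fun X : Fin n → Fin m → ℝ => pairInt a ε X :=
  (PolyGrowth.const _).of_le fun X => abs_integral_param_le (φ := fun X t =>
    t ^ a * pairTrace (gramResolvent X (t + ε))) X
    (fun t ht => abs_pairInt_integrand_le hε X t ht)
    (integrableOn_rpow_mul_inv_mul_inv' ha ha1 hε hε)

theorem polyGrowth_pairIntDeriv (ha : 0 < a) (ha1 : a < 1) (hε : 0 < ε)
    (H : Fin n → Fin m → ℝ) : PolyGrowth fun X : Fin n → Fin m → ℝ => pairIntDeriv a ε X H :=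
  (((PolyGrowth.const (8 * n * m ^ 7 * ‖H‖)).mul .norm).mul (.const _)).of_le fun X =>
    abs_integral_param_le (φ := fun X t => t ^ a *
      pairTraceDeriv (gramResolvent X (t + ε)) (gramResolventDeriv X H (t + ε))) X
      (fun t ht => abs_pairIntDeriv_integrand_le hε X H t ht)
      (integrableOn_rpow_mul_inv_mul_inv_mul_inv ha ha1 hε hε hε)

theorem polyGrowth_gram_add (i j : Fin m) :
    PolyGrowth fun X : Fin n → Fin m → ℝ => (gram X + ε • 1) i j := by
  simp only [Matrix.add_apply, gram, Matrix.mul_apply, Matrix.transpose_apply, Matrix.of_apply]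
  exact (PolyGrowth.sum _ fun k => (PolyGrowth.apply k i).mul (.apply k j)).add (.const _)

theorem polyGrowth_gramDeriv (H : Fin n → Fin m → ℝ) (i j : Fin m) :
    PolyGrowth fun X : Fin n → Fin m → ℝ => gramDeriv X H i j :=
  ((PolyGrowth.const (2 * n)).mul (PolyGrowth.norm.mul (.const ‖H‖))).of_le fun X =>
    abs_gramDeriv_le X H i j

theorem polyGrowth_shrinkNum (ha : 0 < a) (ha1 : a < 1) (hε : 0 < ε) (k : ℝ) :
    PolyGrowth fun X : Fin n → Fin m → ℝ => shrinkNum a ε k X :=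
  ((PolyGrowth.const k).mul (.trace (polyGrowth_powInt ha ha1 hε))).add
    (polyGrowth_pairInt ha ha1 hε)

theorem polyGrowth_shrinkNumDeriv (ha : 0 < a) (ha1 : a < 1) (hε : 0 < ε) (k : ℝ)
    (H : Fin n → Fin m → ℝ) :
    PolyGrowth fun X : Fin n → Fin m → ℝ => shrinkNumDeriv a ε k X H :=
  ((PolyGrowth.const k).mul (.trace (polyGrowth_powIntDeriv ha ha1 hε H))).add
    (polyGrowth_pairIntDeriv ha ha1 hε H)

theorem polyGrowth_shrinkDenDeriv (ha : 0 < a) (ha1 : a < 1) (hε : 0 < ε)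
    (H : Fin n → Fin m → ℝ) :
    PolyGrowth fun X : Fin n → Fin m → ℝ => shrinkDenDeriv a ε X H := by
  have hF := polyGrowth_powInt (n := n) (m := m) ha ha1 hε
  have hdF := polyGrowth_powIntDeriv ha ha1 hε H
  refine PolyGrowth.trace fun i j => ?_
  simp only [Matrix.add_apply (_ + _), Matrix.add_apply (_ * _ * _)]
  refine PolyGrowth.add (PolyGrowth.add ?_ ?_) ?_
  · exact .matrix_mul (.matrix_mul hdF polyGrowth_gram_add) hF i j
  · exact .matrix_mul (.matrix_mul hF (polyGrowth_gramDeriv H)) hF i j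
  · exact .matrix_mul (.matrix_mul hF polyGrowth_gram_add) hdF i j

/-- The denominator decays at most polynomially. -/
theorem polyGrowth_inv_shrinkDen (ha : 0 < a) (ha1 : a < 1) (hε : 0 < ε) (hm : 0 < m) :
    PolyGrowth fun X : Fin n → Fin m → ℝ => (shrinkDen a ε X)⁻¹ := by
  have hs := stieltjes_pos ha ha1 one_pos
  have hg : PolyGrowth fun X : Fin n → Fin m → ℝ =>
      (1 + (ε + n * m * ‖X‖ ^ 2)) ^ 2 * (stieltjes a 1 ^ 2 * ε)⁻¹ :=
    (((PolyGrowth.const 1).add ((PolyGrowth.const ε).add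
      ((PolyGrowth.const (n * m)).mul (PolyGrowth.norm.pow 2)))).pow 2).mul (.const _)
  refine hg.of_le fun X => ?_
  have hC := shrinkDen_pos (n := n) ha ha1 hε hm X
  rw [abs_of_pos (inv_pos.2 hC)]
  obtain ⟨V, l, hV, hV', hl, h⟩ := exists_gram_spectral X
  have hx : ∀ i, 0 < ε + l i := fun i => by linarith [hl i]
  let i0 : Fin m := ⟨0, hm⟩
  have hli : l i0 ≤ n * m * ‖X‖ ^ 2 := by
    have h1 : ∑ i, l i = ∑ j, ∑ i, X i j * X i j := by
      rw [← trace_conj hV l, ← h]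
      simp only [gram, Matrix.trace, Matrix.diag, Matrix.mul_apply, Matrix.transpose_apply,
        Matrix.of_apply]
    have h2 : ∑ j, ∑ i, X i j * X i j ≤ ∑ _j : Fin m, ∑ _i : Fin n, ‖X‖ ^ 2 :=
      Finset.sum_le_sum fun j _ => Finset.sum_le_sum fun i _ => by
        rw [← sq, ← sq_abs]
        exact pow_le_pow_left₀ (abs_nonneg _) (abs_apply_le_norm X i j) 2
    have h3 := Finset.single_le_sum (f := l) (fun i _ => hl i) (Finset.mem_univ i0)
    simp only [Finset.sum_const, Finset.card_univ, Fintype.card_fin, nsmul_eq_mul] at h2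
    linarith
  have hlow : stieltjes a 1 ^ 2 * ε / (1 + (ε + n * m * ‖X‖ ^ 2)) ^ 2 ≤ shrinkDen a ε X := by
    rw [shrinkDen_eq ha ha1 hε hV hV' hl h]
    refine le_trans ?_ (Finset.single_le_sum (f := fun i => stieltjes a (ε + l i) ^ 2 * (ε + l i))
      (fun i _ => mul_nonneg (sq_nonneg _) (hx i).le) (Finset.mem_univ i0))
    have h1 := stieltjes_one_div_le ha ha1 (hx i0)
    have h2 : stieltjes a 1 / (1 + (ε + n * m * ‖X‖ ^ 2)) ≤ stieltjes a 1 / (1 + (ε + l i0)) := by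
      have := hx i0
      gcongr
    calc stieltjes a 1 ^ 2 * ε / (1 + (ε + n * m * ‖X‖ ^ 2)) ^ 2
        = (stieltjes a 1 / (1 + (ε + n * m * ‖X‖ ^ 2))) ^ 2 * ε := by
          rw [div_pow, div_mul_eq_mul_div]
      _ ≤ stieltjes a (ε + l i0) ^ 2 * (ε + l i0) := by
          gcongr
          · exact h2.trans h1
          · linarith [hl i0]
  calc (shrinkDen a ε X)⁻¹ ≤ (stieltjes a 1 ^ 2 * ε / (1 + (ε + n * m * ‖X‖ ^ 2)) ^ 2)⁻¹ := by
        gcongr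
    _ = _ := by rw [inv_div, div_eq_mul_inv]

theorem polyGrowth_of_apply (i : Fin n) (j : Fin m) :
    PolyGrowth fun X : Fin n → Fin m → ℝ => Matrix.of X i j := PolyGrowth.apply i j

theorem polyGrowth_powField (ha : 0 < a) (ha1 : a < 1) (hε : 0 < ε) (i : Fin n) (j : Fin m) :
    PolyGrowth fun X : Fin n → Fin m → ℝ => powField a ε X i j :=
  .matrix_mul polyGrowth_of_apply (polyGrowth_powInt ha ha1 hε) i j

theorem polyGrowth_powFieldDeriv (ha : 0 < a) (ha1 : a < 1) (hε : 0 < ε) (H : Fin n → Fin m → ℝ)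
    (i : Fin n) (j : Fin m) :
    PolyGrowth fun X : Fin n → Fin m → ℝ => powFieldDeriv a ε X H i j := by
  simp only [powFieldDeriv, Matrix.add_apply]
  exact (PolyGrowth.matrix_mul (f := fun _ => Matrix.of H) (fun _ _ => .const _)
    (polyGrowth_powInt ha ha1 hε) i j).add
    (.matrix_mul polyGrowth_of_apply (polyGrowth_powIntDeriv ha ha1 hε H) i j)

theorem polyGrowth_sureField (ha : 0 < a) (ha1 : a < 1) (hε : 0 < ε) (hm : 0 < m) (k : ℝ)
    (i : Fin n) (j : Fin m) :
    PolyGrowth fun X : Fin n → Fin m → ℝ => sureField a ε k X i j := by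
  simp only [sureField, shrinkFactor, div_eq_mul_inv]
  exact (((polyGrowth_shrinkNum ha ha1 hε k).mul (polyGrowth_inv_shrinkDen ha ha1 hε hm)).mul
    (polyGrowth_powField ha ha1 hε i j)).neg

theorem polyGrowth_sureFieldDeriv (ha : 0 < a) (ha1 : a < 1) (hε : 0 < ε) (hm : 0 < m) (k : ℝ)
    (H : Fin n → Fin m → ℝ) (i : Fin n) (j : Fin m) :
    PolyGrowth fun X : Fin n → Fin m → ℝ => sureFieldDeriv a ε k X H i j := by
  have hC := polyGrowth_inv_shrinkDen (n := n) ha ha1 hε hm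
  have hN := polyGrowth_shrinkNum (n := n) (m := m) ha ha1 hε k
  simp only [sureFieldDeriv, shrinkFactorDeriv, shrinkFactor, div_eq_mul_inv, ← inv_pow]
  exact (((((polyGrowth_shrinkNumDeriv ha ha1 hε k H).mul hC).sub
    ((hN.mul (polyGrowth_shrinkDenDeriv ha ha1 hε H)).mul (hC.pow 2))).mul
    (polyGrowth_powField ha ha1 hε i j)).add ((hN.mul hC).mul
    (polyGrowth_powFieldDeriv ha ha1 hε H i j))).neg

theorem hasDerivAt_matrix_mul {α β γ : Type*} [Fintype β] {f : ℝ → Matrix α β ℝ}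
    {g : ℝ → Matrix β γ ℝ} {f' : Matrix α β ℝ} {g' : Matrix β γ ℝ} {τ : ℝ}
    (hf : ∀ i j, HasDerivAt (fun τ => f τ i j) (f' i j) τ)
    (hg : ∀ i j, HasDerivAt (fun τ => g τ i j) (g' i j) τ) (i : α) (j : γ) :
    HasDerivAt (fun τ => (f τ * g τ) i j) ((f' * g τ + f τ * g') i j) τ := by
  simp only [Matrix.mul_apply, Matrix.add_apply, ← Finset.sum_add_distrib]
  exact HasDerivAt.fun_sum fun k _ => (hf i k).mul (hg k j)

theorem hasLineDerivAt_sureField (ha : 0 < a) (ha1 : a < 1) (hε : 0 < ε) (hm : 0 < m) (k : ℝ)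
    (X H : Fin n → Fin m → ℝ) (i : Fin n) (j : Fin m) :
    HasLineDerivAt ℝ (fun X => sureField a ε k X i j) (sureFieldDeriv a ε k X H i j) X H := by
  have hX : ∀ i j, HasDerivAt (fun τ : ℝ => Matrix.of (X + τ • H) i j) (Matrix.of H i j) 0 := by
    intro i j
    simpa using ((hasDerivAt_id (0 : ℝ)).mul_const (H i j)).const_add (X i j)
  have hXT : ∀ i j, HasDerivAt (fun τ : ℝ => (Matrix.of (X + τ • H))ᵀ i j)
      ((Matrix.of H)ᵀ i j) 0 := fun i j => hX j i
  have hA : ∀ i j, HasDerivAt (fun τ : ℝ => (gram (X + τ • H) + ε • 1) i j)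
      (gramDeriv X H i j) 0 := by
    intro i j
    have := (hasDerivAt_matrix_mul hXT hX i j).add_const ((ε • (1 : Matrix (Fin m) (Fin m) ℝ)) i j)
    simpa [gramDeriv, gram] using this
  have hF := hasDerivAt_powInt ha ha1 hε X H
  have hK := hasDerivAt_pairInt ha ha1 hε X H
  have hFA := hasDerivAt_matrix_mul (hasDerivAt_matrix_mul hF hA) hF
  have hC : HasDerivAt (fun τ : ℝ => shrinkDen a ε (X + τ • H)) (shrinkDenDeriv a ε X H) 0 := by
    refine (HasDerivAt.fun_sum (u := Finset.univ) fun i _ => hFA i i).congr_deriv ?_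
    simp only [zero_smul, add_zero, shrinkDenDeriv, Matrix.add_mul]
    rfl
  have hN : HasDerivAt (fun τ : ℝ => shrinkNum a ε k (X + τ • H)) (shrinkNumDeriv a ε k X H) 0 :=
    ((HasDerivAt.fun_sum (u := Finset.univ) fun i _ => hF i i).const_mul k).add hK
  have hY : HasDerivAt (fun τ : ℝ => powField a ε (X + τ • H) i j)
      (powFieldDeriv a ε X H i j) 0 := by
    have := hasDerivAt_matrix_mul hX hF i j
    simp only [zero_smul, add_zero] at this
    exact this
  have hC0 := (shrinkDen_pos (n := n) ha ha1 hε hm (X + (0 : ℝ) • H)).ne'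
  have hα := hN.div hC hC0
  refine (hα.mul hY).neg.congr_deriv ?_
  simp only [zero_smul, add_zero] at hC0 ⊢
  simp only [sureFieldDeriv, shrinkFactorDeriv, shrinkFactor, Pi.div_apply, zero_smul, add_zero]
  field_simp

end

theorem frobeniusRisk_eq (δ : (Fin n → Fin m → ℝ) → (Fin n → Fin m → ℝ)) (M : Fin n → Fin m → ℝ) :
    frobeniusRisk δ M = ∫⁻ X, frobeniusLoss M (δ X) ∂(gaussianLaw M) := rfl

/-- The regularized estimator has at most the risk of `X`. -/
theorem frobeniusRisk_regularized_le {a ε : ℝ} (ha : 0 < a) (ha1 : a ≤ 1 / 2) (hε : 0 < ε)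
    (hk : 4 * (1 - a) ≤ (n : ℝ) - m - 1 + 2 * a) (M : Fin n → Fin m → ℝ) :
    frobeniusRisk (fun X => X + sureField a ε ((n : ℝ) - m - 1 + 2 * a) X) M ≤ n * m := by
  rcases Nat.eq_zero_or_pos m with rfl | hm
  · simp [frobeniusRisk, frobeniusLoss]
  have ha1' : a < 1 := by linarith
  set k : ℝ := (n : ℝ) - m - 1 + 2 * a with hkdef
  set g := fun X : Fin n → Fin m → ℝ => sureField a ε k X with hg
  have hGp := polyGrowth_sureField (n := n) ha ha1' hε hm k
  have hGm := measurable_sureField_apply (n := n) (m := m) (a := a) (ε := ε) k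
  have hZp : ∀ i j, PolyGrowth fun X : Fin n → Fin m → ℝ => X i j - M i j := fun i j =>
    (PolyGrowth.apply i j).sub (.const _)
  have hZm : ∀ i j, Measurable fun X : Fin n → Fin m → ℝ => X i j - M i j := fun i j => by
    fun_prop
  have hst : ∀ i j, ∫ X, (X i j - M i j) * g X i j ∂(gaussianLaw M) =
      ∫ X, sureFieldDeriv a ε k X (unitMat i j) i j ∂(gaussianLaw M) := fun i j =>
    integral_sub_mul_gaussianLaw M
      (fun X => hasLineDerivAt_sureField ha ha1' hε hm k X (unitMat i j) i j)
      ((hGp i j).integrable (hGm i j) M)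
      ((polyGrowth_sureFieldDeriv ha ha1' hε hm k _ i j).integrable
        (measurable_sureFieldDeriv_apply k _ i j) M)
      (((hZp i j).mul (hGp i j)).integrable ((hZm i j).mul (hGm i j)) M)
  have i1 : ∀ i j, Integrable (fun X => (X i j - M i j) ^ 2) (gaussianLaw M) := fun i j =>
    ((hZp i j).pow 2).integrable ((hZm i j).pow_const 2) M
  have i2 : ∀ i j, Integrable (fun X => (X i j - M i j) * g X i j) (gaussianLaw M) := fun i j =>
    ((hZp i j).mul (hGp i j)).integrable ((hZm i j).mul (hGm i j)) M
  have i3 : ∀ i j, Integrable (fun X => g X i j ^ 2) (gaussianLaw M) := fun i j =>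
    ((hGp i j).pow 2).integrable ((hGm i j).pow_const 2) M
  have i4 : ∀ i j, Integrable (fun X => sureFieldDeriv a ε k X (unitMat i j) i j)
      (gaussianLaw M) := fun i j =>
    (polyGrowth_sureFieldDeriv ha ha1' hε hm k _ i j).integrable
        (measurable_sureFieldDeriv_apply k _ i j) M
  have e : ∀ X : Fin n → Fin m → ℝ, ∑ i, ∑ j, ((X + g X) i j - M i j) ^ 2 =
      ∑ i, ∑ j, ((X i j - M i j) ^ 2 + 2 * ((X i j - M i j) * g X i j) + g X i j ^ 2) := by
    intro X
    refine Finset.sum_congr rfl fun i _ => Finset.sum_congr rfl fun j _ => ?_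
    simp only [Pi.add_apply]; ring
  have i5 : ∀ i j, Integrable (fun X => (X i j - M i j) ^ 2 +
      2 * ((X i j - M i j) * g X i j) + g X i j ^ 2) (gaussianLaw M) := fun i j =>
    ((i1 i j).add ((i2 i j).const_mul 2)).add (i3 i j)
  have i6 : ∀ i j, Integrable (fun X => g X i j ^ 2 +
      2 * sureFieldDeriv a ε k X (unitMat i j) i j) (gaussianLaw M) := fun i j =>
    (i3 i j).add ((i4 i j).const_mul 2)
  have hint : Integrable (fun X => ∑ i, ∑ j, ((X + g X) i j - M i j) ^ 2) (gaussianLaw M) := by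
    simp_rw [e]
    exact integrable_finsetSum _ fun i _ => integrable_finsetSum _ fun j _ => i5 i j
  have hle : ∫ X, ∑ i, ∑ j, ((X + g X) i j - M i j) ^ 2 ∂(gaussianLaw M) ≤ n * m := by
    have h1 : ∫ X, ∑ i, ∑ j, ((X + g X) i j - M i j) ^ 2 ∂(gaussianLaw M) =
        ∑ i, ∑ j, (1 + ∫ X, (g X i j ^ 2 + 2 * sureFieldDeriv a ε k X (unitMat i j) i j)
          ∂(gaussianLaw M)) := by
      simp_rw [e]
      rw [integral_finsetSum _ fun i _ => integrable_finsetSum _ fun j _ => i5 i j]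
      refine Finset.sum_congr rfl fun i _ => ?_
      rw [integral_finsetSum _ fun j _ => i5 i j]
      refine Finset.sum_congr rfl fun j _ => ?_
      have i7 : Integrable (fun X => (X i j - M i j) ^ 2 + 2 * ((X i j - M i j) * g X i j))
        (gaussianLaw M) := (i1 i j).add ((i2 i j).const_mul 2)
      rw [integral_add i7 (i3 i j), integral_add (i1 i j) ((i2 i j).const_mul 2),
        integral_const_mul, hst, integral_sub_sq_gaussianLaw,
        integral_add (i3 i j) ((i4 i j).const_mul 2), integral_const_mul]
      ring
    have h2 : ∑ i, ∑ j, ∫ X, (g X i j ^ 2 + 2 * sureFieldDeriv a ε k X (unitMat i j) i j)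
          ∂(gaussianLaw M) ≤ 0 := by
      have h3 := fun i => (integral_finsetSum (μ := gaussianLaw M) Finset.univ
        fun j _ => i6 i j).symm
      simp_rw [h3]
      rw [← integral_finsetSum _ fun i _ => integrable_finsetSum _ fun j _ => i6 i j]
      exact integral_nonpos fun X => sum_sq_sureField_add_le_zero ha ha1 hε hk X
    rw [h1]
    simp only [Finset.sum_add_distrib, Finset.sum_const, Finset.card_univ, Fintype.card_fin,
      nsmul_eq_mul, mul_one]
    linarith
  rw [frobeniusRisk_eq]
  simp only [frobeniusLoss]
  rw [← ofReal_integral_eq_lintegral_ofReal hint (Eventually.of_forall fun X =>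
    Finset.sum_nonneg fun i _ => Finset.sum_nonneg fun j _ => sq_nonneg _)]
  refine (ENNReal.ofReal_le_ofReal hle).trans_eq ?_
  rw [← Nat.cast_mul, ENNReal.ofReal_natCast, Nat.cast_mul]

/-! ### The minimax risk -/

theorem measurable_frobeniusLoss {α : Type*} [MeasurableSpace α] {f g : α → Fin n → Fin m → ℝ}
    (hf : Measurable f) (hg : Measurable g) : Measurable fun x => frobeniusLoss (f x) (g x) := by
  unfold frobeniusLoss
  fun_prop

theorem minimaxRisk_le_iSup_frobeniusRisk {δ : (Fin n → Fin m → ℝ) → (Fin n → Fin m → ℝ)}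
    (hδ : AEMeasurable δ) :
    minimaxRisk frobeniusLoss (gaussianModel n m) ≤ ⨆ M, frobeniusRisk δ M := by
  refine iInf₂_le_of_le (Kernel.deterministic (hδ.mk δ) hδ.measurable_mk)
    (Kernel.isMarkovKernel_deterministic _) ?_
  refine iSup_mono fun M => ?_
  have hloss : Measurable fun y => frobeniusLoss M y :=
    measurable_frobeniusLoss measurable_const measurable_id
  rw [Kernel.lintegral_comp _ _ _ hloss, frobeniusRisk_eq]
  change ∫⁻ X, _ ∂(gaussianLaw M) ≤ _
  refine (lintegral_congr_ae ?_).le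
  filter_upwards [(gaussianLaw_absolutelyContinuous M).ae_eq hδ.ae_eq_mk] with X hX
  rw [Kernel.lintegral_deterministic' _ hloss, hX]

theorem integral_dual_gaussianLaw_zero (L : StrongDual ℝ (Fin n → Fin m → ℝ)) :
    ∫ x, L x ∂(gaussianLaw (0 : Fin n → Fin m → ℝ)) = 0 := by
  have hneg : ∀ v : NNReal, MeasurePreserving (fun x : ℝ => -x) (gaussianReal 0 v)
      (gaussianReal 0 v) := fun v => ⟨by fun_prop, by rw [gaussianReal_map_neg, neg_zero]⟩
  have h1 : MeasurePreserving (fun x : Fin n → Fin m → ℝ => -x) (gaussianLaw 0)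
      (gaussianLaw 0) := by
    unfold gaussianLaw
    exact measurePreserving_pi _ _ fun i => measurePreserving_pi _ _ fun j => hneg 1
  have h2 := h1.integral_comp (MeasurableEquiv.neg _).measurableEmbedding (fun x => L x)
  simp only [map_neg, integral_neg] at h2
  linarith

/-- An estimate `y` that does not depend on the standard Gaussian `A` cannot beat the variance of
`s • A + u`. -/
theorem lintegral_frobeniusLoss_prior_ge (y u : Fin n → Fin m → ℝ) (s : ℝ) :
    ENNReal.ofReal (s ^ 2 * (n * m)) ≤
      ∫⁻ A, frobeniusLoss (s • A + u) y ∂(gaussianLaw (0 : Fin n → Fin m → ℝ)) := by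
  have i0 : ∀ (i : Fin n) (j : Fin m), Integrable (fun A : Fin n → Fin m → ℝ => A i j)
      (gaussianLaw 0) := fun i j => (PolyGrowth.apply i j).integrable (by fun_prop) 0
  have i2 : ∀ (i : Fin n) (j : Fin m), Integrable (fun A : Fin n → Fin m → ℝ => A i j ^ 2)
      (gaussianLaw 0) := fun i j => ((PolyGrowth.apply i j).pow 2).integrable (by fun_prop) 0
  have e : ∀ (A : Fin n → Fin m → ℝ) i j, (y i j - (s • A + u) i j) ^ 2 =
      ((y i j - u i j) ^ 2 + (-2 * s * (y i j - u i j)) * A i j) + s ^ 2 * A i j ^ 2 := by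
    intro A i j
    simp only [Pi.add_apply, Pi.smul_apply, smul_eq_mul]; ring
  have i3 : ∀ i j, Integrable (fun A : Fin n → Fin m → ℝ => (y i j - (s • A + u) i j) ^ 2)
      (gaussianLaw 0) := fun i j => by
    simp_rw [e]
    exact ((integrable_const _).add ((i0 i j).const_mul _)).add ((i2 i j).const_mul _)
  have m0 : ∀ (i : Fin n) (j : Fin m), ∫ A, A i j ∂(gaussianLaw (0 : Fin n → Fin m → ℝ)) = 0 :=
    fun i j => integral_dual_gaussianLaw_zero
      ((ContinuousLinearMap.proj (R := ℝ) (φ := fun _ : Fin m => ℝ) j).comp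
        (ContinuousLinearMap.proj (R := ℝ) (φ := fun _ : Fin n => Fin m → ℝ) i))
  have m2 : ∀ (i : Fin n) (j : Fin m),
      ∫ A, A i j ^ 2 ∂(gaussianLaw (0 : Fin n → Fin m → ℝ)) = 1 := fun i j => by
    simpa using integral_sub_sq_gaussianLaw (0 : Fin n → Fin m → ℝ) i j
  simp only [frobeniusLoss]
  rw [← ofReal_integral_eq_lintegral_ofReal
    (integrable_finsetSum _ fun i _ => integrable_finsetSum _ fun j _ => i3 i j)
    (Eventually.of_forall fun X => Finset.sum_nonneg fun i _ => Finset.sum_nonneg fun j _ =>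
      sq_nonneg _)]
  refine ENNReal.ofReal_le_ofReal ?_
  rw [integral_finsetSum _ fun i _ => integrable_finsetSum _ fun j _ => i3 i j]
  have hij : ∀ i j, s ^ 2 ≤
      ∫ A, (y i j - (s • A + u) i j) ^ 2 ∂(gaussianLaw (0 : Fin n → Fin m → ℝ)) := by
    intro i j
    simp_rw [e]
    have i4 : Integrable (fun A : Fin n → Fin m → ℝ => (y i j - u i j) ^ 2 +
        (-2 * s * (y i j - u i j)) * A i j) (gaussianLaw 0) :=
      (integrable_const _).add ((i0 i j).const_mul _)
    rw [integral_add i4 ((i2 i j).const_mul _), integral_add (integrable_const _)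
      ((i0 i j).const_mul _), integral_const_mul, integral_const_mul, m0, m2]
    simp
    positivity
  calc s ^ 2 * (n * m) = ∑ _i : Fin n, ∑ _j : Fin m, s ^ 2 := by
        simp; ring
    _ ≤ _ := Finset.sum_le_sum fun i _ => by
        rw [integral_finsetSum _ fun j _ => i3 i j]
        exact Finset.sum_le_sum fun j _ => hij i j

theorem measurable_lintegral_kernel {α β γ : Type*} [MeasurableSpace α] [MeasurableSpace β]
    [MeasurableSpace γ] (κ : Kernel β γ) [IsMarkovKernel κ] {L : α × γ → ℝ≥0∞}
    (hL : Measurable L) : Measurable fun q : α × β => ∫⁻ y, L (q.1, y) ∂(κ q.2) := by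
  have h : Measurable fun r : (α × β) × γ => L (r.1.1, r.2) :=
    hL.comp ((measurable_fst.comp measurable_fst).prodMk measurable_snd)
  exact Measurable.lintegral_kernel_prod_right' (κ := κ.comap Prod.snd measurable_snd) h

/-- Under the prior that makes `M = tan θ • A` with a standard Gaussian `A`, every estimator has an
average risk of at least `sin² θ n m`: after a rotation by `θ` of the pair of `A` and the noise,
the observation depends on one component only, and `M` contains `sin θ` times the other one. -/
theorem sin_sq_mul_le_minimaxRisk {θ : ℝ} (hθ : 0 < Real.cos θ) :
    ENNReal.ofReal (Real.sin θ ^ 2 * (n * m)) ≤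
      minimaxRisk frobeniusLoss (gaussianModel n m) := by
  refine le_iInf₂ fun κ hκ => ?_
  set γ := gaussianLaw (0 : Fin n → Fin m → ℝ) with hγ
  set τ : ℝ := Real.sin θ / Real.cos θ with hτ
  -- The risk of `κ` at the mean `M` and the observation `X`.
  obtain ⟨φ, hφ⟩ : ∃ φ : (Fin n → Fin m → ℝ) × (Fin n → Fin m → ℝ) → ℝ≥0∞,
    φ = fun q => ∫⁻ y, frobeniusLoss q.1 y ∂(κ q.2) := ⟨_, rfl⟩
  have hφm : Measurable φ := by
    rw [hφ]; exact measurable_lintegral_kernel κ (L := fun q => frobeniusLoss q.1 q.2)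
      (measurable_frobeniusLoss measurable_fst measurable_snd)
  have hrisk : ∀ M, ∫⁻ y, frobeniusLoss M y ∂((κ ∘ₖ gaussianModel n m) M) =
      ∫⁻ Z, φ (M, M + Z) ∂γ := by
    intro M
    have hM : Measurable fun y => frobeniusLoss M y :=
      measurable_frobeniusLoss measurable_const measurable_id
    rw [Kernel.lintegral_comp _ _ _ hM]
    have : ∀ X, ∫⁻ y, frobeniusLoss M y ∂(κ X) = φ (M, X) := fun X => by rw [hφ]
    simp_rw [this]
    change ∫⁻ X, φ (M, X) ∂(gaussianLaw M) = _
    have hM2 : Measurable fun X => φ (M, X) := hφm.comp measurable_prodMk_left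
    rw [gaussianLaw_eq_map, lintegral_map hM2 (by fun_prop)]
  calc ENNReal.ofReal (Real.sin θ ^ 2 * (n * m))
      ≤ ∫⁻ B, ∫⁻ A, φ (τ • (Real.cos θ • A + Real.sin θ • B),
          τ • (Real.cos θ • A + Real.sin θ • B) + (-Real.sin θ • A + Real.cos θ • B)) ∂γ ∂γ := by
        have hpt : ∀ B : Fin n → Fin m → ℝ, ENNReal.ofReal (Real.sin θ ^ 2 * (n * m)) ≤
            ∫⁻ A, φ (τ • (Real.cos θ • A + Real.sin θ • B),
              τ • (Real.cos θ • A + Real.sin θ • B) + (-Real.sin θ • A + Real.cos θ • B)) ∂γ := by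
          intro B
          have hτc : τ * Real.cos θ = Real.sin θ := by rw [hτ]; field_simp
          have e1 : ∀ A : Fin n → Fin m → ℝ, τ • (Real.cos θ • A + Real.sin θ • B) =
              Real.sin θ • A + (τ * Real.sin θ) • B := fun A => by
            rw [smul_add, smul_smul, smul_smul, hτc]
          have e2 : ∀ A : Fin n → Fin m → ℝ, τ • (Real.cos θ • A + Real.sin θ • B) +
              (-Real.sin θ • A + Real.cos θ • B) = (τ * Real.sin θ + Real.cos θ) • B := fun A => by
            rw [e1, add_smul, neg_smul]; abel
          simp_rw [e2, e1]
          simp only [hφ]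
          rw [lintegral_lintegral_swap]
          · calc _ = ∫⁻ _y, ENNReal.ofReal (Real.sin θ ^ 2 * (n * m))
                  ∂(κ ((τ * Real.sin θ + Real.cos θ) • B)) := by simp
              _ ≤ _ := lintegral_mono fun y => lintegral_frobeniusLoss_prior_ge y _ _
          · exact (measurable_frobeniusLoss (f := fun q : (Fin n → Fin m → ℝ) ×
              (Fin n → Fin m → ℝ) => Real.sin θ • q.1 + (τ * Real.sin θ) • B)
              (by fun_prop) measurable_snd).aemeasurable
        calc _ = ∫⁻ _B, ENNReal.ofReal (Real.sin θ ^ 2 * (n * m)) ∂γ := by simp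
          _ ≤ _ := lintegral_mono hpt
    _ = ∫⁻ q, φ (τ • q.1, τ • q.1 + q.2) ∂(γ.prod γ) := by
        have hrot := IsGaussian.map_rotation_eq_self_of_forall_strongDual_eq_zero (μ := γ)
          integral_dual_gaussianLaw_zero θ
        have hm : Measurable fun q : (Fin n → Fin m → ℝ) × (Fin n → Fin m → ℝ) =>
            φ (τ • q.1, τ • q.1 + q.2) := hφm.comp (by fun_prop)
        conv_rhs => rw [← hrot]
        rw [lintegral_map hm (by fun_prop), lintegral_prod_symm]
        · simp only [ContinuousLinearMap.rotation_apply]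
        · exact (hm.comp (ContinuousLinearMap.measurable _)).aemeasurable
    _ = ∫⁻ A, ∫⁻ Z, φ (τ • A, τ • A + Z) ∂γ ∂γ := by
        rw [lintegral_prod]
        exact (hφm.comp (by fun_prop)).aemeasurable
    _ ≤ ∫⁻ _A, (⨆ M, ∫⁻ y, frobeniusLoss M y ∂((κ ∘ₖ gaussianModel n m) M)) ∂γ := by
        refine lintegral_mono fun A => ?_
        rw [← hrisk]
        exact le_iSup (fun M => ∫⁻ y, frobeniusLoss M y ∂((κ ∘ₖ gaussianModel n m) M)) (τ • A)
    _ = _ := by simp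

theorem le_minimaxRisk : (n * m : ℝ≥0∞) ≤ minimaxRisk frobeniusLoss (gaussianModel n m) := by
  have h1 : Tendsto (fun θ : ℝ => ENNReal.ofReal (Real.sin θ ^ 2 * (n * m)))
      (𝓝[<] (Real.pi / 2)) (𝓝 (ENNReal.ofReal (Real.sin (Real.pi / 2) ^ 2 * (n * m)))) :=
    ((ENNReal.continuous_ofReal.comp (by fun_prop)).tendsto _).mono_left nhdsWithin_le_nhds
  have h2 : ENNReal.ofReal (Real.sin (Real.pi / 2) ^ 2 * (n * m)) = n * m := by
    rw [Real.sin_pi_div_two, one_pow, one_mul, ← Nat.cast_mul, ENNReal.ofReal_natCast,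
      Nat.cast_mul]
  rw [h2] at h1
  refine le_of_tendsto h1 ?_
  filter_upwards [Ioo_mem_nhdsLT (show -(Real.pi / 2) < Real.pi / 2 by linarith [Real.pi_pos])]
    with θ hθ using sin_sq_mul_le_minimaxRisk (Real.cos_pos_of_mem_Ioo hθ)

/-! ### Almost every matrix has distinct positive singular values -/

/-- A function that is polynomial on every line through a point where it does not vanish has a
null zero set: each line through that point meets the zero set in a finite set. -/
theorem volume_zeros_eq_zero {f : (Fin n → Fin m → ℝ) → ℝ} (hf : Measurable f)
    (X₀ : Fin n → Fin m → ℝ) (h0 : f X₀ ≠ 0)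
    (hline : ∀ X, ∃ P : Polynomial ℝ, ∀ τ : ℝ, P.eval τ = f (X₀ + τ • X)) :
    volume {X | f X = 0} = 0 := by
  set Z : Set (Fin n → Fin m → ℝ) := {Y | f (X₀ + Y) = 0} with hZ
  have hfin : ∀ X : Fin n → Fin m → ℝ, volume {τ : ℝ | τ • X ∈ Z} = 0 := by
    intro X
    obtain ⟨P, hP⟩ := hline X
    have hP0 : P ≠ 0 := by
      rintro rfl
      have := hP 0
      simp only [Polynomial.eval_zero, zero_smul, add_zero] at this
      exact h0 this.symm
    refine ((Polynomial.finite_setOfPred_isRoot hP0).subset fun τ hτ => ?_).measure_zero _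
    have hτ' : f (X₀ + τ • X) = 0 := hτ
    rw [← hP] at hτ'
    exact hτ'
  have hZm : Measurable fun q : ℝ × (Fin n → Fin m → ℝ) => f (X₀ + q.1 • q.2) :=
    hf.comp (by fun_prop)
  have hW : MeasurableSet {q : ℝ × (Fin n → Fin m → ℝ) | q.1 • q.2 ∈ Z} :=
    hZm (measurableSet_singleton 0)
  have hnull : ∀ᵐ τ : ℝ, volume ((fun Y : Fin n → Fin m → ℝ => τ • Y) ⁻¹' Z) = 0 := by
    refine Measure.measure_ae_null_of_prod_null (ν := (volume : Measure (Fin n → Fin m → ℝ)))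
      (s := {q : ℝ × (Fin n → Fin m → ℝ) | q.1 • q.2 ∈ Z}) ?_
    rw [Measure.prod_apply_symm hW]
    simp only [lintegral_eq_zero_iff (measurable_measure_prodMk_right hW)]
    exact Eventually.of_forall fun Y => hfin Y
  have hne : ∀ᵐ τ : ℝ, τ ≠ 0 := by
    simp [ae_iff]
  obtain ⟨τ, hτ, hτ0⟩ := (hnull.and hne).exists
  rw [Measure.addHaar_preimage_smul _ hτ0] at hτ
  have hZ0 : volume Z = 0 := by
    rcases mul_eq_zero.1 hτ with h | h
    · exfalso
      rw [ENNReal.ofReal_eq_zero] at h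
      have : 0 < |(τ ^ Module.finrank ℝ (Fin n → Fin m → ℝ))⁻¹| := abs_pos.2 (by positivity)
      linarith
    · exact h
  have := measure_preimage_add (volume : Measure (Fin n → Fin m → ℝ)) X₀ {X | f X = 0}
  rw [← this]
  exact hZ0

/-- A polynomial in the entries of `X` that vanishes exactly when the eigenvalues of `XᵀX` are not
positive and distinct: the determinant of `XᵀX` times that of the Hankel matrix of its power sums,
which is the discriminant of its characteristic polynomial. -/
def gramDiscr {R : Type*} [CommRing R] (X : Matrix (Fin n) (Fin m) R) : R :=
  (Xᵀ * X).det * (Matrix.of fun i j : Fin m => ((Xᵀ * X) ^ (i + j : ℕ)).trace).det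

theorem map_gramDiscr {R S : Type*} [CommRing R] [CommRing S] (φ : R →+* S)
    (X : Matrix (Fin n) (Fin m) R) : φ (gramDiscr X) = gramDiscr (X.map φ) := by
  have h : (X.map φ)ᵀ * X.map φ = φ.mapMatrix (Xᵀ * X) := by
    rw [RingHom.mapMatrix_apply, Matrix.map_mul, Matrix.transpose_map]
  rw [gramDiscr, gramDiscr, map_mul, RingHom.map_det, RingHom.map_det, h]
  congr 2
  ext i j
  simp only [RingHom.mapMatrix_apply, Matrix.map_apply, Matrix.of_apply]
  rw [← RingHom.mapMatrix_apply, ← map_pow, RingHom.mapMatrix_apply]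
  exact AddMonoidHom.map_trace φ.toAddMonoidHom _

theorem continuous_gramDiscr :
    Continuous fun X : Fin n → Fin m → ℝ => gramDiscr (Matrix.of X) := by
  have hg := continuous_gram (n := n) (m := m)
  have h2 : Continuous fun X : Fin n → Fin m → ℝ =>
      (Matrix.of fun i j : Fin m => (gram X ^ (i + j : ℕ)).trace) :=
    continuous_matrix fun i j => (hg.pow _).matrix_trace
  exact hg.matrix_det.mul h2.matrix_det

theorem conj_pow {V : Matrix (Fin m) (Fin m) ℝ} {l : Fin m → ℝ} (hV : Vᵀ * V = 1)
    (hV' : V * Vᵀ = 1) (k : ℕ) :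
    (V * Matrix.diagonal l * Vᵀ) ^ k = V * Matrix.diagonal (fun i => l i ^ k) * Vᵀ := by
  induction k with
  | zero => simp [hV']
  | succ k ih =>
    rw [pow_succ, ih, conj_mul_conj hV]
    simp only [pow_succ]

theorem gramDiscr_eq {X : Fin n → Fin m → ℝ} {V : Matrix (Fin m) (Fin m) ℝ} {l : Fin m → ℝ}
    (hV : Vᵀ * V = 1) (hV' : V * Vᵀ = 1) (h : gram X = V * Matrix.diagonal l * Vᵀ) :
    gramDiscr (Matrix.of X) = (∏ i, l i) * (Matrix.vandermonde l).det ^ 2 := by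
  have h' : (Matrix.of X)ᵀ * Matrix.of X = V * Matrix.diagonal l * Vᵀ := h
  rw [gramDiscr, h']
  congr 1
  · rw [Matrix.det_mul, mul_comm, ← Matrix.det_mul, ← Matrix.mul_assoc, hV, Matrix.one_mul,
      Matrix.det_diagonal]
  · rw [sq]
    nth_rewrite 1 [← Matrix.det_transpose (Matrix.vandermonde l)]
    rw [← Matrix.det_mul]
    congr 1
    ext i j
    rw [Matrix.of_apply, conj_pow hV hV', trace_conj hV, Matrix.mul_apply]
    refine Finset.sum_congr rfl fun k _ => ?_
    rw [Matrix.transpose_apply, Matrix.vandermonde_apply, Matrix.vandermonde_apply, pow_add]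

/-- The reference matrix has the singular values `1, …, m`. -/
theorem exists_gramDiscr_ne_zero (hmn : m ≤ n) :
    ∃ X : Fin n → Fin m → ℝ, gramDiscr (Matrix.of X) ≠ 0 := by
  let X : Fin n → Fin m → ℝ := fun i j => if i = Fin.castLE hmn j then (j : ℝ) + 1 else 0
  have h : gram X = 1 * Matrix.diagonal (fun j : Fin m => ((j : ℝ) + 1) ^ 2) * 1ᵀ := by
    rw [Matrix.one_mul, Matrix.transpose_one, Matrix.mul_one]
    ext i j
    simp only [gram, Matrix.mul_apply, Matrix.transpose_apply, Matrix.of_apply, X, ite_mul,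
      zero_mul, Finset.sum_ite_eq', Finset.mem_univ, if_true, Matrix.diagonal_apply]
    by_cases hij : i = j
    · subst hij; simp [sq]
    · simp [hij]
  refine ⟨X, ?_⟩
  rw [gramDiscr_eq (by simp) (by simp) h]
  refine mul_ne_zero (Finset.prod_ne_zero_iff.2 fun i _ => by positivity) (pow_ne_zero 2 ?_)
  rw [Matrix.det_vandermonde_ne_zero_iff]
  intro i j hij
  have h1 : (i : ℝ) + 1 = (j : ℝ) + 1 :=
    (pow_left_inj₀ (by positivity) (by positivity) two_ne_zero).1 hij
  exact Fin.ext (by exact_mod_cast add_right_cancel h1)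

theorem ae_gramDiscr_ne_zero (hmn : m ≤ n) :
    ∀ᵐ X : Fin n → Fin m → ℝ, gramDiscr (Matrix.of X) ≠ 0 := by
  obtain ⟨X₀, h0⟩ := exists_gramDiscr_ne_zero hmn
  rw [ae_iff]
  simp only [ne_eq, not_not]
  refine volume_zeros_eq_zero (f := fun X => gramDiscr (Matrix.of X))
    continuous_gramDiscr.measurable X₀ h0 fun X => ?_
  refine ⟨gramDiscr (Matrix.of fun i j =>
    Polynomial.C (X₀ i j) + Polynomial.X * Polynomial.C (X i j)), fun τ => ?_⟩
  rw [← Polynomial.coe_evalRingHom, map_gramDiscr]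
  congr 1
  ext i j
  simp
  ring

theorem exists_isSVD {X : Fin n → Fin m → ℝ} (h : gramDiscr (Matrix.of X) ≠ 0) :
    ∃ U s V, IsSVD (Matrix.of X) U s V ∧ (∀ i, 0 < s i) ∧ Function.Injective s := by
  obtain ⟨V, l, hV, hV', hl, hX⟩ := exists_gram_spectral X
  rw [gramDiscr_eq hV hV' hX] at h
  have hl0 : ∀ i, 0 < l i := fun i =>
    lt_of_le_of_ne (hl i) (Finset.prod_ne_zero_iff.1 (left_ne_zero_of_mul h) i
      (Finset.mem_univ i)).symm
  have hinj : Function.Injective l := by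
    rw [← Matrix.det_vandermonde_ne_zero_iff]
    exact fun h0 => h (by rw [h0]; ring)
  let σ : Equiv.Perm (Fin m) := Tuple.sort fun i => -l i
  have hσ : Antitone fun i => l (σ i) := fun i j hij => by
    have := Tuple.monotone_sort (fun i => -l i) hij
    simpa using this
  let s : Fin m → ℝ := fun i => √(l (σ i))
  have hs : ∀ i, 0 < s i := fun i => Real.sqrt_pos.2 (hl0 _)
  have hss : ∀ i, s i * s i = l (σ i) := fun i => Real.mul_self_sqrt (hl _)
  let W : Matrix (Fin m) (Fin m) ℝ := V.submatrix id σ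
  have hW : Wᵀ * W = 1 := by
    have : Wᵀ * W = (Vᵀ * V).submatrix σ σ := by
      rw [Matrix.transpose_submatrix, Matrix.submatrix_mul_equiv Vᵀ V σ (Equiv.refl _) σ |>.symm]
      rfl
    rw [this, hV, Matrix.submatrix_one_equiv]
  have hW' : W * Wᵀ = 1 := mul_eq_one_comm.1 hW
  have hXW : gram X = W * Matrix.diagonal (fun i => l (σ i)) * Wᵀ := by
    rw [hX]
    ext i j
    rw [conj_apply, conj_apply]
    exact (Equiv.sum_comp σ fun k => l k * (V i k * V j k)).symm
  refine ⟨Matrix.of X * W * Matrix.diagonal (fun i => (s i)⁻¹), s, W, ⟨?_, hW, ?_, ?_, ?_⟩, hs, ?_⟩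
  · have e : (Matrix.of X * W * Matrix.diagonal (fun i => (s i)⁻¹))ᵀ *
        (Matrix.of X * W * Matrix.diagonal (fun i => (s i)⁻¹)) =
        Matrix.diagonal (fun i => (s i)⁻¹) * (Wᵀ * gram X * W) *
          Matrix.diagonal (fun i => (s i)⁻¹) := by
      rw [Matrix.transpose_mul, Matrix.transpose_mul, Matrix.diagonal_transpose, gram]
      simp only [Matrix.mul_assoc]
    have e2 : Wᵀ * gram X * W = Matrix.diagonal (fun i => l (σ i)) := by
      rw [hXW]
      calc Wᵀ * (W * Matrix.diagonal (fun i => l (σ i)) * Wᵀ) * W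
          = (Wᵀ * W) * Matrix.diagonal (fun i => l (σ i)) * (Wᵀ * W) := by
            simp only [Matrix.mul_assoc]
        _ = _ := by rw [hW, Matrix.one_mul, Matrix.mul_one]
    rw [e, e2, Matrix.diagonal_mul_diagonal, Matrix.diagonal_mul_diagonal, ← Matrix.diagonal_one]
    congr 1
    funext i
    have := (hs i).ne'
    rw [← hss]; field_simp
  · exact fun i j hij => Real.sqrt_le_sqrt (hσ hij)
  · exact fun i => (hs i).le
  · have : (fun i => (s i)⁻¹ * s i) = fun _ => 1 :=
      funext fun i => inv_mul_cancel₀ (hs i).ne'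
    rw [Matrix.mul_assoc (Matrix.of X * W), Matrix.diagonal_mul_diagonal, this,
      Matrix.diagonal_one, Matrix.mul_one, Matrix.mul_assoc, hW', Matrix.mul_one]
  · intro i j hij
    have : l (σ i) = l (σ j) := by rw [← hss, ← hss]; exact congrArg (fun x => x * x) hij
    exact σ.injective (hinj this)

/-! ### The limit of the regularized estimators -/

theorem mul_self_sum_sub_eq_two_mul (r : Fin m → ℝ) :
    (∑ i, r i) * (∑ i, r i) - ∑ i, r i * r i = 2 * ∑ i, ∑ j ∈ Finset.Ioi i, r i * r j := by
  have h1 : ∀ i, r i * ∑ j, r j =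
      r i * r i + ∑ j ∈ Finset.Ioi i, r i * r j + ∑ j ∈ Finset.Iio i, r i * r j := by
    intro i
    have e : (Finset.univ : Finset (Fin m)).erase i = Finset.Ioi i ∪ Finset.Iio i := by
      ext j; simp [lt_or_lt_iff_ne, ne_comm]
    have hd : Disjoint (Finset.Ioi i) (Finset.Iio i) :=
      Finset.disjoint_left.2 fun j h h' =>
        lt_asymm (Finset.mem_Ioi.1 h) (Finset.mem_Iio.1 h')
    rw [← Finset.add_sum_erase _ _ (Finset.mem_univ i), e, Finset.sum_union hd, mul_add, mul_add,
      Finset.mul_sum, Finset.mul_sum, add_assoc]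
  have h2 : ∑ i, ∑ j ∈ Finset.Iio i, r i * r j = ∑ i, ∑ j ∈ Finset.Ioi i, r i * r j := by
    rw [Finset.sum_comm' (t' := Finset.univ) (s' := fun j => Finset.Ioi j) (by simp)]
    exact Finset.sum_congr rfl fun i _ => Finset.sum_congr rfl fun j _ => mul_comm _ _
  rw [Finset.sum_mul]
  simp only [h1, Finset.sum_add_distrib, h2]
  ring

theorem pairInt_eq_sum {a ε : ℝ} {X : Fin n → Fin m → ℝ} {V : Matrix (Fin m) (Fin m) ℝ}
    {l : Fin m → ℝ} (ha : 0 < a) (ha1 : a < 1) (hε : 0 < ε) (hV : Vᵀ * V = 1)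
    (hV' : V * Vᵀ = 1) (hl : ∀ i, 0 ≤ l i) (hinj : Function.Injective l)
    (h : gram X = V * Matrix.diagonal l * Vᵀ) :
    pairInt a ε X = 2 * ∑ i, ∑ j ∈ Finset.Ioi i,
      ((ε + l i) * stieltjes a (ε + l i) - (ε + l j) * stieltjes a (ε + l j)) / (l i - l j) := by
  have hx : ∀ i, 0 < ε + l i := fun i => by linarith [hl i]
  have hi := fun i j => integrableOn_rpow_mul_inv_mul_inv' ha ha1 (hx i) (hx j)
  rw [pairInt_eq hε hV hV' hl h]
  simp only [mul_self_sum_sub_eq_two_mul, mul_left_comm _ (2 : ℝ)]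
  rw [integral_const_mul]
  congr 1
  simp only [Finset.mul_sum]
  rw [integral_finsetSum _ fun i _ => integrable_finsetSum _ fun j _ => hi i j]
  refine Finset.sum_congr rfl fun i _ => ?_
  rw [integral_finsetSum _ fun j _ => hi i j]
  refine Finset.sum_congr rfl fun j hj => ?_
  have hne : l i ≠ l j := fun e => (Finset.mem_Ioi.1 hj).ne (hinj e)
  rw [integral_rpow_mul_inv_mul_inv ha ha1 (hx i) (hx j) (fun e => hne (by linarith))]
  congr 1; ring

/-- At a matrix with distinct positive singular values, the regularized estimators converge to the
estimator `U diag(s - α s^(p-1)) Vᵀ`. -/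
theorem tendsto_add_sureField {p : ℝ} (hp0 : 0 < p) (hp1 : p ≤ 1) {X : Fin n → Fin m → ℝ}
    {U : Matrix (Fin n) (Fin m) ℝ} {s : Fin m → ℝ} {V : Matrix (Fin m) (Fin m) ℝ}
    (hsvd : IsSVD (Matrix.of X) U s V) (hs : ∀ i, 0 < s i) (hinj : Function.Injective s) :
    Tendsto (fun ε => X + sureField (p / 2) ε ((n : ℝ) - m - 1 + 2 * (p / 2)) X) (𝓝[>] 0)
      (𝓝 (Matrix.of.symm
        (U * Matrix.diagonal (fun i => s i - alphaOpt n p s * s i ^ (p - 1)) * Vᵀ))) := by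
  have hV := hsvd.right_orth
  have hV' : V * Vᵀ = 1 := mul_eq_one_comm.1 hV
  have ha : 0 < p / 2 := by linarith
  have ha1 : p / 2 < 1 := by linarith
  have hl : ∀ i, 0 ≤ s i ^ 2 := fun i => sq_nonneg _
  have hinj2 : Function.Injective fun i => s i ^ 2 := fun i j hij =>
    hinj ((pow_left_inj₀ (hs i).le (hs j).le two_ne_zero).1 hij)
  have hgram : gram X = V * Matrix.diagonal (fun i => s i ^ 2) * Vᵀ := by
    rw [gram, hsvd.eq, Matrix.transpose_mul, Matrix.transpose_mul, Matrix.transpose_transpose,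
      Matrix.diagonal_transpose]
    calc V * (Matrix.diagonal s * Uᵀ) * (U * Matrix.diagonal s * Vᵀ)
        = V * (Matrix.diagonal s * (Uᵀ * U) * Matrix.diagonal s) * Vᵀ := by
          simp only [Matrix.mul_assoc]
      _ = _ := by
          rw [hsvd.left_orth, Matrix.mul_one, Matrix.diagonal_mul_diagonal]
          simp only [sq]
  set c := stieltjes (p / 2) 1 with hc
  have hc0 : 0 < c := stieltjes_pos ha ha1 one_pos
  -- Limits of the spectral functions.
  have hlim0 : ∀ i, Tendsto (fun ε : ℝ => ε + s i ^ 2) (𝓝[>] 0) (𝓝 (s i ^ 2)) := fun i => by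
    have : Tendsto (fun ε : ℝ => ε + s i ^ 2) (𝓝 0) (𝓝 (0 + s i ^ 2)) :=
      Continuous.tendsto (by fun_prop) 0
    rw [zero_add] at this
    exact this.mono_left nhdsWithin_le_nhds
  have hf : ∀ i, Tendsto (fun ε : ℝ => stieltjes (p / 2) (ε + s i ^ 2)) (𝓝[>] 0)
      (𝓝 (c * s i ^ (p - 2))) := fun i => by
    have h1 : s i ^ (p - 2) = (s i ^ 2) ^ (p / 2 - 1) := by
      rw [← Real.rpow_natCast, ← Real.rpow_mul (hs i).le]; congr 1; push_cast; ring
    rw [h1]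
    refine (((hlim0 i).rpow_const (Or.inl (pow_pos (hs i) 2).ne')).const_mul c).congr' ?_
    filter_upwards [self_mem_nhdsWithin] with ε hε
    rw [stieltjes_eq (add_pos hε (pow_pos (hs i) 2))]
  have hxf : ∀ i, Tendsto (fun ε : ℝ => (ε + s i ^ 2) * stieltjes (p / 2) (ε + s i ^ 2)) (𝓝[>] 0)
      (𝓝 (c * s i ^ p)) := fun i => by
    have h1 : c * s i ^ p = s i ^ 2 * (c * s i ^ (p - 2)) := by
      have : s i ^ p = s i ^ (p - 2) * s i ^ 2 := by
        rw [← Real.rpow_add_natCast (hs i).ne']; congr 1; push_cast; ring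
      rw [this]; ring
    rw [h1]
    exact (hlim0 i).mul (hf i)
  have hden : Tendsto (fun ε : ℝ => shrinkDen (p / 2) ε X) (𝓝[>] 0)
      (𝓝 (c ^ 2 * ∑ i, s i ^ (2 * p - 2))) := by
    have h1 : c ^ 2 * ∑ i, s i ^ (2 * p - 2) =
        ∑ i, (c * s i ^ (p - 2)) * (c * s i ^ p) := by
      rw [Finset.mul_sum]
      refine Finset.sum_congr rfl fun i _ => ?_
      have : s i ^ (2 * p - 2) = s i ^ (p - 2) * s i ^ p := by
        rw [← Real.rpow_add (hs i)]; congr 1; ring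
      rw [this]; ring
    rw [h1]
    refine (tendsto_finsetSum _ fun i _ => (hf i).mul (hxf i)).congr' ?_
    filter_upwards [self_mem_nhdsWithin] with ε hε
    rw [shrinkDen_eq ha ha1 hε hV hV' hl hgram]
    exact Finset.sum_congr rfl fun i _ => by ring
  have hnum : Tendsto (fun ε : ℝ => shrinkNum (p / 2) ε ((n : ℝ) - m - 1 + 2 * (p / 2)) X) (𝓝[>] 0)
      (𝓝 (c * (((n : ℝ) - m + p - 1) * ∑ i, s i ^ (p - 2) + 2 * pairSum p s))) := by
    have h1 : c * (((n : ℝ) - m + p - 1) * ∑ i, s i ^ (p - 2) + 2 * pairSum p s) =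
        ((n : ℝ) - m - 1 + 2 * (p / 2)) * ∑ i, c * s i ^ (p - 2) + 2 * ∑ i, ∑ j ∈ Finset.Ioi i,
          (c * s i ^ p - c * s j ^ p) / (s i ^ 2 - s j ^ 2) := by
      simp only [← mul_sub, mul_div_assoc, ← Finset.mul_sum]
      rw [pairSum]; ring
    rw [h1]
    refine (((tendsto_finsetSum _ fun i _ => hf i).const_mul _).add
      ((tendsto_finsetSum _ fun i _ => tendsto_finsetSum _ fun j _ =>
        ((hxf i).sub (hxf j)).div_const _).const_mul 2)).congr' ?_
    filter_upwards [self_mem_nhdsWithin] with ε hε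
    rw [shrinkNum, pairInt_eq_sum ha ha1 hε hV hV' hl hinj2 hgram,
      powInt_eq ha ha1 hε hV hV' hl hgram, trace_conj hV]
  refine tendsto_pi_nhds.2 fun i => tendsto_pi_nhds.2 fun j => ?_
  have hm : 0 < m := Fin.pos j
  have hS : 0 < ∑ i, s i ^ (2 * p - 2) :=
    Finset.sum_pos (fun i _ => Real.rpow_pos_of_pos (hs i) _) ⟨j, Finset.mem_univ _⟩
  have hα : Tendsto (fun ε : ℝ => shrinkFactor (p / 2) ε ((n : ℝ) - m - 1 + 2 * (p / 2)) X)
      (𝓝[>] 0) (𝓝 (alphaOpt n p s / c)) := by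
    have := hnum.div hden (by positivity)
    have e : alphaOpt n p s / c = c * (((n : ℝ) - m + p - 1) * ∑ i, s i ^ (p - 2) +
        2 * pairSum p s) / (c ^ 2 * ∑ i, s i ^ (2 * p - 2)) := by
      unfold alphaOpt
      field_simp
    rw [e]
    exact this
  have hY : Tendsto (fun ε : ℝ => powField (p / 2) ε X i j) (𝓝[>] 0)
      (𝓝 (c * ∑ k, s k ^ (p - 1) * (U i k * V j k))) := by
    have h1 : c * ∑ k, s k ^ (p - 1) * (U i k * V j k) =
        ∑ k, s k * (c * s k ^ (p - 2)) * (U i k * V j k) := by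
      rw [Finset.mul_sum]
      refine Finset.sum_congr rfl fun k _ => ?_
      have : s k ^ (p - 1) = s k ^ (p - 2) * s k := by
        rw [← Real.rpow_add_one (hs k).ne']; congr 1; ring
      rw [this]; ring
    rw [h1]
    refine (tendsto_finsetSum _ fun k _ => ((hf k).const_mul _).mul_const _).congr' ?_
    filter_upwards [self_mem_nhdsWithin] with ε hε
    have h2 : Matrix.of X * powInt (p / 2) ε X =
        U * Matrix.diagonal (fun k => s k * stieltjes (p / 2) (ε + s k ^ 2)) * Vᵀ := by
      rw [powInt_eq ha ha1 hε hV hV' hl hgram, hsvd.eq]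
      calc U * Matrix.diagonal s * Vᵀ *
            (V * Matrix.diagonal (fun k => stieltjes (p / 2) (ε + s k ^ 2)) * Vᵀ)
          = U * (Matrix.diagonal s * (Vᵀ * V) *
            Matrix.diagonal (fun k => stieltjes (p / 2) (ε + s k ^ 2))) * Vᵀ := by
            simp only [Matrix.mul_assoc]
        _ = _ := by rw [hV, Matrix.mul_one, Matrix.diagonal_mul_diagonal]
    rw [powField, h2, conj_apply]
  have hX : X i j = ∑ k, s k * (U i k * V j k) := by
    rw [← conj_apply, ← hsvd.eq, Matrix.of_apply]
  have hlim : (Matrix.of.symm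
      (U * Matrix.diagonal (fun i => s i - alphaOpt n p s * s i ^ (p - 1)) * Vᵀ)) i j =
      X i j + -(alphaOpt n p s / c * (c * ∑ k, s k ^ (p - 1) * (U i k * V j k))) := by
    rw [Matrix.of_symm_apply, conj_apply, hX, ← mul_assoc, div_mul_cancel₀ _ hc0.ne',
      Finset.mul_sum, ← sub_eq_add_neg, ← Finset.sum_sub_distrib]
    exact Finset.sum_congr rfl fun k _ => by ring
  rw [hlim]
  exact (hα.mul hY).neg.const_add _

/-- Every `δ` with `IsSureEstimator p δ` is the almost everywhere limit of regularized estimators,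
because almost every matrix has distinct positive singular values. -/
theorem ae_tendsto_of_isSureEstimator {p : ℝ} (hp0 : 0 < p) (hp1 : p ≤ 1) (hmn : m ≤ n)
    {δ : (Fin n → Fin m → ℝ) → (Fin n → Fin m → ℝ)} (hδ : IsSureEstimator p δ) :
    ∀ᵐ X : Fin n → Fin m → ℝ, Tendsto (fun k : ℕ => X +
      sureField (p / 2) (1 / ((k : ℝ) + 1)) ((n : ℝ) - m - 1 + 2 * (p / 2)) X) atTop
      (𝓝 (δ X)) := by
  have hε : Tendsto (fun k : ℕ => 1 / ((k : ℝ) + 1)) atTop (𝓝[>] 0) :=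
    tendsto_nhdsWithin_iff.2 ⟨tendsto_one_div_add_atTop_nhds_zero_nat,
      Eventually.of_forall fun k => by simp only [mem_Ioi]; positivity⟩
  filter_upwards [ae_gramDiscr_ne_zero hmn] with X hX
  obtain ⟨U, s, V, hsvd, hs, hinj⟩ := exists_isSVD hX
  have h := (tendsto_add_sureField hp0 hp1 hsvd hs hinj).comp hε
  rw [← hδ X U s V hsvd hs hinj] at h
  exact h

theorem exists_isSureEstimator {p : ℝ} (hp0 : 0 < p) (hp1 : p ≤ 1) :
    ∃ δ : (Fin n → Fin m → ℝ) → (Fin n → Fin m → ℝ), IsSureEstimator p δ := by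
  -- The limit depends on `X` only, so the formula does not depend on the decomposition.
  refine ⟨fun X => limUnder (𝓝[>] (0 : ℝ)) fun ε => X +
    sureField (p / 2) ε ((n : ℝ) - m - 1 + 2 * (p / 2)) X, fun X U s V hsvd hs hinj => ?_⟩
  exact (congrArg Matrix.of (tendsto_add_sureField hp0 hp1 hsvd hs hinj).limUnder_eq).trans
    (Equiv.apply_symm_apply _ _)

theorem aemeasurable_of_isSureEstimator {p : ℝ} (hp0 : 0 < p) (hp1 : p ≤ 1) (hmn : m ≤ n)
    {δ : (Fin n → Fin m → ℝ) → (Fin n → Fin m → ℝ)} (hδ : IsSureEstimator p δ) :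
    AEMeasurable δ :=
  aemeasurable_of_tendsto_metrizable_ae atTop
    (fun _ => (measurable_id.add (measurable_sureField _)).aemeasurable)
    (ae_tendsto_of_isSureEstimator hp0 hp1 hmn hδ)

/-- Fatou's lemma transfers the risk bound to the limit of the regularized estimators. -/
theorem frobeniusRisk_le_of_isSureEstimator {p : ℝ} (hp0 : 0 < p) (hp1 : p ≤ 1)
    (hnm : 5 - 3 * p ≤ (n : ℝ) - m) (hmn : m ≤ n)
    {δ : (Fin n → Fin m → ℝ) → (Fin n → Fin m → ℝ)} (hδ : IsSureEstimator p δ)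
    (M : Fin n → Fin m → ℝ) : frobeniusRisk δ M ≤ n * m := by
  set δr : ℕ → (Fin n → Fin m → ℝ) → (Fin n → Fin m → ℝ) := fun k X => X +
    sureField (p / 2) (1 / ((k : ℝ) + 1)) ((n : ℝ) - m - 1 + 2 * (p / 2)) X with hδr
  have hlim := (gaussianLaw_absolutelyContinuous M).ae_le
    (ae_tendsto_of_isSureEstimator hp0 hp1 hmn hδ)
  have hcont : Continuous fun y : Fin n → Fin m → ℝ => frobeniusLoss M y :=
    ENNReal.continuous_ofReal.comp (by fun_prop)
  calc frobeniusRisk δ M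
      = ∫⁻ X, liminf (fun k => frobeniusLoss M (δr k X)) atTop ∂(gaussianLaw M) := by
        rw [frobeniusRisk_eq]
        refine lintegral_congr_ae ?_
        filter_upwards [hlim] with X hX
        exact ((hcont.tendsto _).comp hX).liminf_eq.symm
    _ ≤ liminf (fun k => ∫⁻ X, frobeniusLoss M (δr k X) ∂(gaussianLaw M)) atTop :=
        lintegral_liminf_le fun k => measurable_frobeniusLoss measurable_const
          (measurable_id.add (measurable_sureField _))
    _ ≤ liminf (fun _ : ℕ => (n * m : ℝ≥0∞)) atTop :=
        liminf_le_liminf (Eventually.of_forall fun k =>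
          frobeniusRisk_regularized_le (by linarith) (by linarith) (by positivity)
            (by linarith) M)
    _ = n * m := by simp

end MatrixMean

theorem theorem2 (n m : ℕ) (p : ℝ) (hp0 : 0 < p) (hp1 : p ≤ 1)
    (hnm : 5 - 3 * p ≤ (n : ℝ) - m) :
    (∃ δ : (Fin n → Fin m → ℝ) → (Fin n → Fin m → ℝ), MatrixMean.IsSureEstimator p δ) ∧
      ∀ δ : (Fin n → Fin m → ℝ) → (Fin n → Fin m → ℝ),
        MatrixMean.IsSureEstimator p δ → MatrixMean.IsMinimax δ := by
  have hmn : m ≤ n := by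
    have : (m : ℝ) ≤ n := by linarith
    exact_mod_cast this
  refine ⟨MatrixMean.exists_isSureEstimator hp0 hp1, fun δ hδ => ?_⟩
  have hm := MatrixMean.aemeasurable_of_isSureEstimator hp0 hp1 hmn hδ
  refine ⟨fun M => hm.mono_ac (MatrixMean.gaussianLaw_absolutelyContinuous M), le_antisymm ?_
    (MatrixMean.minimaxRisk_le_iSup_frobeniusRisk hm)⟩
  exact (iSup_le (MatrixMean.frobeniusRisk_le_of_isSureEstimator hp0 hp1 hnm hmn hδ)).trans MatrixMean.le_minimaxRisk
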